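/- Let $H=\langle s_1,\dots,s_n\mid R_1,\dots,R_m\rangle$ be a finite presentation of a group, and let $G(H)$ be its Miller group, i.e. the group with generators $q, s_1,\dots,s_n,t_1,\dots,t_m,d_1,\dots,d_n$ and relations $$t_i^{-1}qt_i=qR_i,\quad t_i^{-1}s_jt_i=s_j,\quad d_j^{-1}qd_j=s_j^{-1}qs_j,\quad d_k^{-1}s_jd_k=s_j .$$ Let $S=\{s_j\}$, $T=\{t_i\}$, $D=\{d_j\}$, let $F(S)$ and $F(T,D)$ be the free groups on $S$ and on $T\cup D$, and let $K=\langle S\cup T\cup D\rangle = F(T,D)\times F(S)$, $A=\langle t_i,\ s_jd_j^{-1}\rangle$ and $B=\langle t_iR_i^{-1},\ s_jd_j^{-1}\rangle$ (all $i,j$). Then $G(H)$ is the HNN-extension of $K$ with stable letter $q$ and $q^{-1}Aq=B$. Let $l(g)$ be the number of letters $q^{\pm1}$ in a reduced form of $g$, that is, an expression $g=h_0q^{\varepsilon_1}h_1\cdots q^{\varepsilon_k}h_k$ with $h_i\in K$ that contains no $q^{-1}aq$ with $a\in A$ and no $qbq^{-1}$ with $b\in B$. An element $g$ with $l(g)>0$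 is cyclically reduced if $l(g^2)=2l(g)$; one with $l(g)=0$ is cyclically reduced if $g\in A\cup B$ or $g$ is not conjugate in $K$ to an element of $A\cup B$. A normal form is an expression $us_0q^{\varepsilon_1}s_1\cdots q^{\varepsilon_k}s_k$ with $u\in F(T,D)$, $s_i\in F(S)$, $\varepsilon_i=\pm1$, and $s_i\ne1$ whenever $\varepsilon_{i+1}=-\varepsilon_i$; it is written as a word with $u$ and all $s_i$ as reduced words. Algorithm III, applied to $g\in G(H)$, proceeds as follows. Put $g$ in normal form $g=hq^{\varepsilon_1}s_1\cdots q^{\varepsilon_k}s_k$, where $h=us_0$. If $k=0$: return $g$ if $g\in A\cup B$ or $g$ is not conjugate in $K$ to an element of $A\cup B$; otherwise return (the normal form of) some conjugate $x^{-1}gx\in A\cup B$ with $x\in K$. If $k=1$, or if $k\ge2$ and $\varepsilon_1=\varepsilon_k$, return $g$. If $k\ge 2$ and $\varepsilon_1=-\varepsilon_k$, test whether $s_kh\in A$ (when $\varepsilon_k=-1$), respectively $s_kh\in B$ (when $\varepsilon_k=1$). If not, return $g$; if so, repeat with $q^{-\varepsilon_1}h^{-1}gh\,q^{\varepsilon_1}$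 in place of $g$. Elements of $G(H)$ are input and output as words in the standard generators and their inverses; $|g|$ is the length of the input word, and each generator or inverse is one symbol. Time is the number of steps of a deterministic multi-stack Turing machine, and the machines and constants may depend on the presentation of $H$. Then: (i) Every element of $G(H)$ has exactly one normal form, and there is a machine that, given any word representing an element $g$, outputs the normal form of $g$ in time $O((|g|+1)^3)$. (ii) There is a machine that, given any word representing an element $g$, outputs in time $O((|g|+1)^3)$ a result of Algorithm III on $g$ (for some choice of the conjugator $x$ in the case $k=0$); this result is the normal form of a cyclically reduced element of $G(H)$ that is conjugate to $g$. -/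

import Mathlib

namespace Miller

/-- The standard generators `q, s_1, …, s_n, t_1, …, t_m, d_1, …, d_n` of the Miller group. -/
inductive Gen (n m : ℕ) : Type
  | q : Gen n m
  | s (j : Fin n) : Gen n m
  | t (i : Fin m) : Gen n m
  | d (j : Fin n) : Gen n m

/-- Words in the standard generators (`true`) and their inverses (`false`). -/
abbrev Word (n m : ℕ) : Type := List (Gen n m × Bool)

section Group

variable {n m : ℕ}

/-- A word `R_i` in the `s_j`, seen as an element of the free group on the standard generators. -/
def liftS (r : FreeGroup (Fin n)) : FreeGroup (Gen n m) := FreeGroup.map Gen.s r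

/-- The relators `t_i⁻¹ q t_i = q R_i`, `t_i⁻¹ s_j t_i = s_j`, `d_j⁻¹ q d_j = s_j⁻¹ q s_j`,
`d_k⁻¹ s_j d_k = s_j`. -/
def relators (R : Fin m → FreeGroup (Fin n)) : Set (FreeGroup (Gen n m)) :=
  let q : FreeGroup (Gen n m) := FreeGroup.of Gen.q
  let s : Fin n → FreeGroup (Gen n m) := fun j => FreeGroup.of (Gen.s j)
  let t : Fin m → FreeGroup (Gen n m) := fun i => FreeGroup.of (Gen.t i)
  let d : Fin n → FreeGroup (Gen n m) := fun j => FreeGroup.of (Gen.d j)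
  {r | (∃ i, r = (t i)⁻¹ * q * t i * (q * liftS (R i))⁻¹) ∨
       (∃ i j, r = (t i)⁻¹ * s j * t i * (s j)⁻¹) ∨
       (∃ j, r = (d j)⁻¹ * q * d j * ((s j)⁻¹ * q * s j)⁻¹) ∨
       (∃ k j, r = (d k)⁻¹ * s j * d k * (s j)⁻¹)}

/-- The Miller group `G(H)` of `H = ⟨s_1, …, s_n ∣ R_1, …, R_m⟩`. -/
abbrev MillerGroup (R : Fin m → FreeGroup (Fin n)) : Type := PresentedGroup (relators R)

variable (R : Fin m → FreeGroup (Fin n))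

/-- The element of `G(H)` represented by a word. -/
def val (w : Word n m) : MillerGroup R := PresentedGroup.mk (relators R) (FreeGroup.mk w)

/-- The standard generators as elements of `G(H)`. -/
def gen (x : Gen n m) : MillerGroup R := PresentedGroup.of x

/-- The image of `R_i` in `G(H)`. -/
def relWord (i : Fin m) : MillerGroup R := PresentedGroup.mk (relators R) (liftS (R i))

/-- The base group `K = F(T, D) × F(S)`, as the subgroup of `G(H)` generated by `T ∪ D ∪ S`. -/
def K : Subgroup (MillerGroup R) :=
  Subgroup.closure (Set.range (fun i => gen R (Gen.t i)) ∪ Set.range (fun j => gen R (Gen.d j)) ∪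
    Set.range (fun j => gen R (Gen.s j)))

/-- The associated subgroup `A = ⟨t_i, s_j d_j⁻¹⟩`. -/
def A : Subgroup (MillerGroup R) :=
  Subgroup.closure (Set.range (fun i => gen R (Gen.t i)) ∪
    Set.range (fun j => gen R (Gen.s j) * (gen R (Gen.d j))⁻¹))

/-- The associated subgroup `B = ⟨t_i R_i⁻¹, s_j d_j⁻¹⟩`; one has `q⁻¹ A q = B`. -/
def B : Subgroup (MillerGroup R) :=
  Subgroup.closure (Set.range (fun i => gen R (Gen.t i) * (relWord R i)⁻¹) ∪
    Set.range (fun j => gen R (Gen.s j) * (gen R (Gen.d j))⁻¹))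

/-- `C = A ∪ B`. -/
def C : Set (MillerGroup R) := (A R : Set (MillerGroup R)) ∪ (B R : Set (MillerGroup R))

/-- `q^ε`, where `true` stands for the exponent `1` and `false` for `-1`. -/
def qPow (ε : Bool) : MillerGroup R := if ε then gen R Gen.q else (gen R Gen.q)⁻¹

/-- `h₀ q^{ε_1} h_1 ⋯ q^{ε_k} h_k` with the `h_i` in `K` is a reduced form of `g`: it represents `g`
and has no pinch `q⁻¹ a q` (`a ∈ A`) or `q b q⁻¹` (`b ∈ B`). -/
def IsReducedForm (g h₀ : MillerGroup R) (L : List (Bool × MillerGroup R)) : Prop :=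
  g = h₀ * (L.map fun p => qPow R p.1 * p.2).prod ∧
  h₀ ∈ K R ∧ (∀ p ∈ L, p.2 ∈ K R) ∧
  L.IsChain fun p p' =>
    ¬ (p.1 = false ∧ p.2 ∈ A R ∧ p'.1 = true) ∧ ¬ (p.1 = true ∧ p.2 ∈ B R ∧ p'.1 = false)

/-- The length `l(g)`: the number of letters `q^{±1}` in a reduced form of `g`. All reduced forms
of `g` have the same number of them (and there is one); the infimum only selects it. -/
noncomputable def len (g : MillerGroup R) : ℕ :=
  sInf {k | ∃ h₀ L, IsReducedForm R g h₀ L ∧ L.length = k}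

/-- `g` is cyclically reduced: `l(g²) = 2 l(g)` if `l(g) > 0`; if `l(g) = 0`, then `g ∈ A ∪ B` or
`g` is not conjugate in `K` to an element of `A ∪ B`. -/
def IsCyclicallyReduced (g : MillerGroup R) : Prop :=
  (0 < len R g → len R (g ^ 2) = 2 * len R g) ∧
  (len R g = 0 → g ∈ C R ∨ ∀ x ∈ K R, x⁻¹ * g * x ∉ C R)

end Group

/-- A normal form `u s₀ q^{ε_1} s_1 ⋯ q^{ε_k} s_k`: `u ∈ F(T, D)`, `s_i ∈ F(S)`, `ε_i = ±1`, and
`s_i ≠ 1` whenever `ε_{i+1} = -ε_i`. -/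
structure NormalForm (n m : ℕ) : Type where
  u : FreeGroup (Fin m ⊕ Fin n)
  s₀ : FreeGroup (Fin n)
  tail : List (Bool × FreeGroup (Fin n))
  chain : tail.IsChain fun p p' => p'.1 ≠ p.1 → p.2 ≠ 1

namespace NormalForm

variable {n m : ℕ}

/-- The reduced word in `T ∪ D` of an element of `F(T, D)`. -/
def wordTD (u : FreeGroup (Fin m ⊕ Fin n)) : Word n m :=
  u.toWord.map fun p => (Sum.elim Gen.t Gen.d p.1, p.2)

/-- The reduced word in `S` of an element of `F(S)`. -/
def wordS (s : FreeGroup (Fin n)) : Word n m := s.toWord.map fun p => (Gen.s p.1, p.2)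

/-- A normal form written out as a word in the standard generators. -/
def toWord (x : NormalForm n m) : Word n m :=
  wordTD x.u ++ wordS x.s₀ ++ x.tail.flatMap fun p => (Gen.q, p.1) :: wordS p.2

variable (R : Fin m → FreeGroup (Fin n))

/-- The element of `G(H)` that a normal form represents. -/
def elt (x : NormalForm n m) : MillerGroup R := val R x.toWord

/-- The head `h = u s₀ ∈ K`. -/
def head (x : NormalForm n m) : MillerGroup R := val R (wordTD x.u ++ wordS x.s₀)

end NormalForm

section AlgorithmIII

variable {n m : ℕ} (R : Fin m → FreeGroup (Fin n))

/-- The test of the second step, for a normal form with head `h` and last syllable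
`last = (ε_k, s_k)`: `s_k h ∈ A` if `ε_k = -1`, and `s_k h ∈ B` if `ε_k = 1`. -/
def CyclicPinch (h : MillerGroup R) (last : Bool × FreeGroup (Fin n)) : Prop :=
  (last.1 = false ∧ val R (NormalForm.wordS last.2) * h ∈ A R) ∨
  (last.1 = true ∧ val R (NormalForm.wordS last.2) * h ∈ B R)

/-- `AlgorithmIII R x y`: Algorithm III, run on the element with normal form `x`, can return the
normal form `y`. The only freedom is the choice of the conjugator in the case `conj`. -/
inductive AlgorithmIII : NormalForm n m → NormalForm n m → Prop
  /-- `l(g) = 0`, and `g ∈ A ∪ B` or `g` is not conjugate in `K` to an element of `A ∪ B`. -/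
  | base (x : NormalForm n m) :
      x.tail = [] → (x.elt R ∈ C R ∨ ∀ z ∈ K R, z⁻¹ * x.elt R * z ∉ C R) → AlgorithmIII x x
  /-- `l(g) = 0`, `g ∉ A ∪ B`, but `g^z ∈ A ∪ B` with `z ∈ K`: replace `g` by `g^z`. -/
  | conj (x y : NormalForm n m) (z : MillerGroup R) :
      x.tail = [] → x.elt R ∉ C R → z ∈ K R → z⁻¹ * x.elt R * z ∈ C R →
      y.elt R = z⁻¹ * x.elt R * z → AlgorithmIII x y
  /-- `l(g) = 1`. -/
  | single (x : NormalForm n m) : x.tail.length = 1 → AlgorithmIII x x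
  /-- `l(g) ≥ 2` and `ε_1 = ε_k`. -/
  | sameSign (x : NormalForm n m) (first last : Bool × FreeGroup (Fin n)) :
      2 ≤ x.tail.length → x.tail.head? = some first → x.tail.getLast? = some last →
      first.1 = last.1 → AlgorithmIII x x
  /-- `l(g) ≥ 2`, `ε_1 = -ε_k`, and the test fails. -/
  | noPinch (x : NormalForm n m) (first last : Bool × FreeGroup (Fin n)) :
      2 ≤ x.tail.length → x.tail.head? = some first → x.tail.getLast? = some last →
      first.1 ≠ last.1 → ¬ CyclicPinch R (x.head R) last → AlgorithmIII x x
  /-- `l(g) ≥ 2`, `ε_1 = -ε_k`, and the test succeeds: pass to the normal form `x'` of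
  `q^{-ε_1} h⁻¹ g h q^{ε_1}` and iterate. -/
  | iterate (x x' y : NormalForm n m) (first last : Bool × FreeGroup (Fin n)) :
      2 ≤ x.tail.length → x.tail.head? = some first → x.tail.getLast? = some last →
      first.1 ≠ last.1 → CyclicPinch R (x.head R) last →
      x'.elt R = (qPow R first.1)⁻¹ * (x.head R)⁻¹ * x.elt R * x.head R * qPow R first.1 →
      AlgorithmIII x' y → AlgorithmIII x y

end AlgorithmIII

/-- `f` is computed by a (multi-stack, deterministic) Turing machine in time `O(k ^ 3)`, where `k`
is the length of the input word; one letter `x^{±1}` is one symbol of the alphabet. -/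
def ComputableInCubicTime {n m : ℕ} (f : Word n m → Word n m) : Prop :=
  ∃ (M : Turing.TM2ComputableInTime (fun w : Word n m => w) (fun w : Word n m => w) f) (c : ℕ),
    ∀ k : ℕ, M.time k ≤ c * (k + 1) ^ 3

end Miller

/-! The associated subgroups are graphs: an element `u s` of `K` lies in `A` or `B` exactly when `s
= twist ε u` for a homomorphism `twist ε` from F(T, D) to F(S) (`mul_mem_assoc`). The relations for
`q` amount to `u⁻¹ q u = twist false u · q · (twist true u)⁻¹`. Hence F(T, D) acts on a free group
containing S and q, and G(H) maps to the semidirect product. A normal form `u s₀ q^{ε_1} s_1 ⋯` goes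
to `u` times a freely reduced word in S and q, so different normal forms have different images
(`elt_injective`); Britton's lemma is not needed. Moving the parts in F(T, D) to the left turns a
reduced form into a normal form with the same signs (`exists_tail_of_chain`), so `len` counts the
letters q of the normal form. If the two ends do not pinch, two copies joined together are again a
reduced form, which gives cyclic reducedness (`isCyclicallyReduced_of_last`).

To compute normal forms, a word is read from right to left while the pair of `u ∈ F(T, D)` and a
reduced word in S and q is maintained. A letter q inserts two twisted images of `u`. A word of
length a with b letters q thus takes time O((a+1)(b+1)), has |u| ≤ a, and has a syllable word of
length O(a(b+1)).

In Algorithm III a literal execution would rewrite all syllables in every round. But the part `u`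
never changes, and after r rounds the element is `c⁻¹ (u · a · s q^{ε} ⋯) c`, where `s q^{ε} ⋯` is
an inner segment of the original syllable word, `c = u^r · twist β (u^r)`, `a = twist β u`, and β is
the sign of the last left end removed. The cyclic test does not depend on `c`
(`conjForm_pinch_iff`), and a successful round only deletes both ends, stores a sign and increments
r (`conjForm_step`, `exists_run_loop`). So there are linearly many rounds, each linear in a word of
quadratic length. At the end the conjugation by `c` is written out once: the resulting word has
quadratic length but only linearly many letters q, so bringing it into normal form is again cubic.

If no letter q remains, `u s` is conjugate in `K` into `A ∪ B` exactly when `s` is conjugate in F(S)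
to some `twist ε u` (`algorithmIII_base_conj`, `algorithmIII_base_not_conj`). This is decided by
comparing cyclic reductions up to rotation (`isConj_iff_rotate`). The rotated word is that of `twist
ε u`, of linear length, so linearly many comparisons of quadratic cost suffice.

The time bounds are proved for structured stack programs with a cost semantics, which compile to
Turing machines (`Prog.Run.steps`, `Prog.exists_computableInTime`). -/

namespace Miller

/-! ### The structure of `K`, `A` and `B`, and a semidirect product that separates normal forms -/

section Structure

variable {n m : ℕ} (R : Fin m → FreeGroup (Fin n))

/-- The homomorphisms whose graphs are the associated subgroups `A` (`false`) and `B` (`true`). -/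
def twist (ε : Bool) : FreeGroup (Fin m ⊕ Fin n) →* FreeGroup (Fin n) :=
  FreeGroup.lift (Sum.elim (fun i => if ε then (R i)⁻¹ else 1) fun j => (FreeGroup.of j)⁻¹)

/-- `F(T, D) → G(H)`. -/
def ofTD : FreeGroup (Fin m ⊕ Fin n) →* MillerGroup R :=
  (PresentedGroup.mk (relators R)).comp (FreeGroup.map (Sum.elim Gen.t Gen.d))

/-- `F(S) → G(H)`. -/
def ofS : FreeGroup (Fin n) →* MillerGroup R :=
  (PresentedGroup.mk (relators R)).comp (FreeGroup.map Gen.s)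

/-- The associated subgroup `A` (`false`) or `B` (`true`). -/
def assoc (ε : Bool) : Subgroup (MillerGroup R) := if ε then B R else A R

lemma ofTD_t (i : Fin m) : ofTD R (FreeGroup.of (Sum.inl i)) = gen R (Gen.t i) := by
  simp [ofTD, gen, PresentedGroup.of, FreeGroup.map.of]

lemma ofTD_d (j : Fin n) : ofTD R (FreeGroup.of (Sum.inr j)) = gen R (Gen.d j) := by
  simp [ofTD, gen, PresentedGroup.of, FreeGroup.map.of]

lemma ofS_of (j : Fin n) : ofS R (FreeGroup.of j) = gen R (Gen.s j) := by
  simp [ofS, gen, PresentedGroup.of, FreeGroup.map.of]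

lemma ofS_relWord (i : Fin m) : ofS R (R i) = relWord R i := rfl

lemma t_conj_q (i : Fin m) :
    (gen R (Gen.t i))⁻¹ * gen R Gen.q * gen R (Gen.t i) = gen R Gen.q * relWord R i := by
  have h : PresentedGroup.mk (relators R) _ = 1 :=
    PresentedGroup.one_of_mem (rels := relators R) (Or.inl ⟨i, rfl⟩)
  simp only [map_mul, map_inv] at h
  exact mul_inv_eq_one.mp h

lemma t_conj_s (i : Fin m) (j : Fin n) :
    (gen R (Gen.t i))⁻¹ * gen R (Gen.s j) * gen R (Gen.t i) = gen R (Gen.s j) := by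
  have h : PresentedGroup.mk (relators R) _ = 1 :=
    PresentedGroup.one_of_mem (rels := relators R) (Or.inr (Or.inl ⟨i, j, rfl⟩))
  simp only [map_mul, map_inv] at h
  exact mul_inv_eq_one.mp h

lemma d_conj_q (j : Fin n) :
    (gen R (Gen.d j))⁻¹ * gen R Gen.q * gen R (Gen.d j) =
      (gen R (Gen.s j))⁻¹ * gen R Gen.q * gen R (Gen.s j) := by
  have h : PresentedGroup.mk (relators R) _ = 1 :=
    PresentedGroup.one_of_mem (rels := relators R) (Or.inr (Or.inr (Or.inl ⟨j, rfl⟩)))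
  simp only [map_mul, map_inv] at h
  exact mul_inv_eq_one.mp h

lemma d_conj_s (k j : Fin n) :
    (gen R (Gen.d k))⁻¹ * gen R (Gen.s j) * gen R (Gen.d k) = gen R (Gen.s j) := by
  have h : PresentedGroup.mk (relators R) _ = 1 :=
    PresentedGroup.one_of_mem (rels := relators R) (Or.inr (Or.inr (Or.inr ⟨k, j, rfl⟩)))
  simp only [map_mul, map_inv] at h
  exact mul_inv_eq_one.mp h

lemma commute_of_conj {G : Type*} [Group G] {a b : G} (h : a⁻¹ * b * a = b) : Commute a b := by
  rw [mul_assoc, inv_mul_eq_iff_eq_mul] at h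
  exact h.symm

lemma commute_ofTD_ofS (u : FreeGroup (Fin m ⊕ Fin n)) (s : FreeGroup (Fin n)) :
    Commute (ofTD R u) (ofS R s) := by
  induction u using FreeGroup.induction_on with
  | C1 => simp
  | inv_of x h => simpa using h.inv_left
  | mul x y hx hy => simpa using hx.mul_left hy
  | of x =>
    induction s using FreeGroup.induction_on with
    | C1 => simp
    | inv_of x h => simpa using h.inv_right
    | mul x y hx hy => simpa using hx.mul_right hy
    | of y =>
      rw [ofS_of]
      rcases x with i | k
      · rw [ofTD_t]; exact commute_of_conj (t_conj_s R i y)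
      · rw [ofTD_d]; exact commute_of_conj (d_conj_s R k y)

/-- `F(T, D) × F(S) → G(H)`, with range `K`. -/
def ofKer : FreeGroup (Fin m ⊕ Fin n) × FreeGroup (Fin n) →* MillerGroup R :=
  (ofTD R).noncommCoprod (ofS R) (commute_ofTD_ofS R)

/-- The isomorphism of `F(T, D)` with `A` or `B`. -/
def graphHom (ε : Bool) : FreeGroup (Fin m ⊕ Fin n) →* MillerGroup R :=
  (ofKer R).comp ((MonoidHom.id _).prod (twist R ε))

lemma graphHom_apply (ε : Bool) (u : FreeGroup (Fin m ⊕ Fin n)) :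
    graphHom R ε u = ofTD R u * ofS R (twist R ε u) := rfl

lemma qPow_not (ε : Bool) : qPow R (!ε) = (qPow R ε)⁻¹ := by cases ε <;> simp [qPow]

/-- On free generators of F(T, D) this is a rewriting of the relations for `q`, and both sides of
`key` are homomorphisms. It is the rule for moving an element of F(T, D) through a letter `q^{±1}`.
-/
lemma graphHom_mul_qPow (ε : Bool) (u : FreeGroup (Fin m ⊕ Fin n)) :
    graphHom R (!ε) u * qPow R ε = qPow R ε * graphHom R ε u := by
  have key : graphHom R false =
      (MulAut.conj (gen R Gen.q)).toMonoidHom.comp (graphHom R true) := by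
    refine FreeGroup.ext_hom _ _ fun x => ?_
    rcases x with i | j
    · have h1 := t_conj_q R i
      have h2 := (commute_ofTD_ofS R (FreeGroup.of (Sum.inl i)) (R i)).inv_right
      rw [ofTD_t, ofS_relWord] at h2
      simp only [graphHom_apply, twist, FreeGroup.lift_apply_of, Sum.elim_inl, ofTD_t, map_inv,
        MonoidHom.comp_apply, MulEquiv.coe_toMonoidHom, MulAut.conj_apply, ofS_relWord, if_true,
        Bool.false_eq_true, if_false, map_one, mul_one]
      rw [mul_assoc, inv_mul_eq_iff_eq_mul] at h1
      rw [← mul_assoc, h1]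
      simp only [mul_assoc, mul_inv_cancel, mul_one]
    · have h1 := d_conj_q R j
      have h2 := (commute_ofTD_ofS R (FreeGroup.of (Sum.inr j)) (FreeGroup.of j)).inv_right
      rw [ofTD_d, ofS_of] at h2
      simp only [graphHom_apply, twist, FreeGroup.lift_apply_of, Sum.elim_inr, ofTD_d, map_inv,
        MonoidHom.comp_apply, MulEquiv.coe_toMonoidHom, MulAut.conj_apply, ofS_of]
      rw [mul_assoc, inv_mul_eq_iff_eq_mul] at h1
      rw [← mul_assoc, h1]
      simp only [mul_assoc, mul_inv_cancel, mul_one]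
  have h : ∀ u, graphHom R false u = gen R Gen.q * graphHom R true u * (gen R Gen.q)⁻¹ :=
    fun u => DFunLike.congr_fun key u
  cases ε
  · simp [qPow, h, mul_assoc]
  · simp [qPow, h, mul_assoc]

/-- The values of `graphHom` on the free generators are, up to inversion, the given generators of
`A` and `B`, so the subgroup is the range of this homomorphism. -/
lemma mem_assoc {ε : Bool} {g : MillerGroup R} : g ∈ assoc R ε ↔ ∃ u, graphHom R ε u = g := by
  have hl : graphHom R ε = FreeGroup.lift (fun x => graphHom R ε (FreeGroup.of x)) :=
    FreeGroup.ext_hom _ _ fun x => by simp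
  have hd : ∀ ε j, graphHom R ε (FreeGroup.of (Sum.inr j)) =
      (gen R (Gen.s j) * (gen R (Gen.d j))⁻¹)⁻¹ := fun ε j => by
    simp [graphHom_apply, twist, ofTD_d, ofS_of]
  have ht : ∀ i, graphHom R false (FreeGroup.of (Sum.inl i)) = gen R (Gen.t i) := fun i => by
    simp [graphHom_apply, twist, ofTD_t]
  have ht' : ∀ i, graphHom R true (FreeGroup.of (Sum.inl i)) =
      gen R (Gen.t i) * (relWord R i)⁻¹ := fun i => by
    simp [graphHom_apply, twist, ofTD_t, ofS_relWord]
  have : assoc R ε = (graphHom R ε).range := by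
    rw [hl, FreeGroup.range_lift_eq_closure]
    cases ε
    · apply le_antisymm <;> simp only [assoc, A, Subgroup.closure_le, Bool.false_eq_true, if_false]
      · rintro _ (⟨i, rfl⟩ | ⟨j, rfl⟩)
        · exact Subgroup.subset_closure ⟨Sum.inl i, ht i⟩
        · exact inv_mem_iff.mp (Subgroup.subset_closure ⟨Sum.inr j, hd _ j⟩)
      · rintro _ ⟨i | j, rfl⟩
        · exact Subgroup.subset_closure (Or.inl ⟨i, (ht i).symm⟩)
        · change graphHom R false _ ∈ _
          rw [hd]
          exact inv_mem (Subgroup.subset_closure (Or.inr ⟨j, rfl⟩))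
    · apply le_antisymm <;> simp only [assoc, B, Subgroup.closure_le, if_true]
      · rintro _ (⟨i, rfl⟩ | ⟨j, rfl⟩)
        · exact Subgroup.subset_closure ⟨Sum.inl i, ht' i⟩
        · exact inv_mem_iff.mp (Subgroup.subset_closure ⟨Sum.inr j, hd _ j⟩)
      · rintro _ ⟨i | j, rfl⟩
        · exact Subgroup.subset_closure (Or.inl ⟨i, (ht' i).symm⟩)
        · change graphHom R true _ ∈ _
          rw [hd]
          exact inv_mem (Subgroup.subset_closure (Or.inr ⟨j, rfl⟩))
  rw [this, MonoidHom.mem_range]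

lemma mem_K {g : MillerGroup R} : g ∈ K R ↔ ∃ u s, ofTD R u * ofS R s = g := by
  constructor
  · intro h
    have : K R ≤ (ofKer R).range := by
      rw [K, Subgroup.closure_le]
      rintro _ ((⟨i, rfl⟩ | ⟨j, rfl⟩) | ⟨j, rfl⟩)
      · exact ⟨(FreeGroup.of (Sum.inl i), 1), by simp [ofKer, ofTD_t]⟩
      · exact ⟨(FreeGroup.of (Sum.inr j), 1), by simp [ofKer, ofTD_d]⟩
      · exact ⟨(1, FreeGroup.of j), by simp [ofKer, ofS_of]⟩
    obtain ⟨⟨u, s⟩, h⟩ := this h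
    exact ⟨u, s, h⟩
  · rintro ⟨u, s, rfl⟩
    have h1 : ∀ u, ofTD R u ∈ K R := by
      intro u
      induction u using FreeGroup.induction_on with
      | C1 => simp
      | inv_of x h => simpa using h
      | mul x y hx hy => simpa using mul_mem hx hy
      | of x =>
        rcases x with i | j
        · rw [ofTD_t]; exact Subgroup.subset_closure (Or.inl (Or.inl ⟨i, rfl⟩))
        · rw [ofTD_d]; exact Subgroup.subset_closure (Or.inl (Or.inr ⟨j, rfl⟩))
    have h2 : ∀ s, ofS R s ∈ K R := by
      intro u
      induction u using FreeGroup.induction_on with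
      | C1 => simp
      | inv_of x h => simpa using h
      | mul x y hx hy => simpa using mul_mem hx hy
      | of x => rw [ofS_of]; exact Subgroup.subset_closure (Or.inr ⟨x, rfl⟩)
    exact mul_mem (h1 u) (h2 s)

/-- Conjugation by `u ∈ F(T, D)` on the free group on all standard generators: `w ↦ u⁻¹ w u`
on `F(S, q)`. -/
def conjTD (u : FreeGroup (Fin m ⊕ Fin n)) : FreeGroup (Gen n m) →* FreeGroup (Gen n m) :=
  FreeGroup.lift fun x => match x with
    | Gen.q => FreeGroup.map Gen.s (twist R false u) * FreeGroup.of Gen.q *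
        (FreeGroup.map Gen.s (twist R true u))⁻¹
    | x => FreeGroup.of x

lemma conjTD_map_s (u : FreeGroup (Fin m ⊕ Fin n)) (s : FreeGroup (Fin n)) :
    conjTD R u (FreeGroup.map Gen.s s) = FreeGroup.map Gen.s s := by
  have : (conjTD R u).comp (FreeGroup.map Gen.s) = FreeGroup.map Gen.s :=
    FreeGroup.ext_hom _ _ fun x => by simp [conjTD]
  exact DFunLike.congr_fun this s

/-- The twists around `q` lie in F(S), which `conjTD` fixes, so a second conjugation only inserts
its own twists next to `q`. The order is reversed because `w ↦ u⁻¹ w u` is a right action; `actTD`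
uses `u⁻¹` for that reason. -/
lemma conjTD_mul (u v : FreeGroup (Fin m ⊕ Fin n)) :
    conjTD R (u * v) = (conjTD R v).comp (conjTD R u) := by
  refine FreeGroup.ext_hom _ _ fun x => ?_
  have h := conjTD_map_s R v
  rcases x with _ | j | i | j
  · have h' : ∀ u, conjTD R u (FreeGroup.of Gen.q) = FreeGroup.map Gen.s (twist R false u) *
        FreeGroup.of Gen.q * (FreeGroup.map Gen.s (twist R true u))⁻¹ := fun u => by simp [conjTD]
    rw [MonoidHom.comp_apply, h' (u * v), h' u]
    simp only [map_mul, map_inv, h, h', mul_assoc, mul_inv_rev]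
  all_goals simp [conjTD]

lemma conjTD_one : conjTD R 1 = MonoidHom.id _ := by
  refine FreeGroup.ext_hom _ _ fun x => ?_
  rcases x with _ | j | i | j <;> simp [conjTD]

/-- `F(T, D)` acts on the free group on the standard generators. -/
def actTD : FreeGroup (Fin m ⊕ Fin n) →* MulAut (FreeGroup (Gen n m)) where
  toFun u := MonoidHom.toMulEquiv (conjTD R u⁻¹) (conjTD R u)
    (by rw [← conjTD_mul]; simp [conjTD_one]) (by rw [← conjTD_mul]; simp [conjTD_one])
  map_one' := by ext1 x; simp [conjTD_one]
  map_mul' u v := by ext1 x; simp [conjTD_mul]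

lemma actTD_apply (u : FreeGroup (Fin m ⊕ Fin n)) (w : FreeGroup (Gen n m)) :
    actTD R u w = conjTD R u⁻¹ w := rfl

/-- The model of `G(H)`: a semidirect product with `F(T, D)` that separates normal forms. -/
abbrev Model : Type := FreeGroup (Gen n m) ⋊[actTD R] FreeGroup (Fin m ⊕ Fin n)

/-- The images of the standard generators in the model. -/
def modelGen : Gen n m → Model R
  | Gen.q => SemidirectProduct.inl (FreeGroup.of Gen.q)
  | Gen.s j => SemidirectProduct.inl (FreeGroup.of (Gen.s j))
  | Gen.t i => SemidirectProduct.inr (FreeGroup.of (Sum.inl i))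
  | Gen.d j => SemidirectProduct.inr (FreeGroup.of (Sum.inr j))

lemma lift_modelGen_liftS (r : FreeGroup (Fin n)) :
    FreeGroup.lift (modelGen R) (liftS r) = SemidirectProduct.inl (FreeGroup.map Gen.s r) := by
  have : (FreeGroup.lift (modelGen R)).comp (FreeGroup.map Gen.s) =
      SemidirectProduct.inl.comp (FreeGroup.map Gen.s) :=
    FreeGroup.ext_hom _ _ fun x => by simp [modelGen]
  exact DFunLike.congr_fun this r

lemma inr_inv_mul_inl_mul_inr (u : FreeGroup (Fin m ⊕ Fin n)) (w : FreeGroup (Gen n m)) :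
    (SemidirectProduct.inr u : Model R)⁻¹ * SemidirectProduct.inl w * SemidirectProduct.inr u =
      SemidirectProduct.inl (conjTD R u w) := by
  have := SemidirectProduct.inl_aut (φ := actTD R) u⁻¹ w
  rw [actTD_apply, inv_inv, map_inv] at this
  exact this.symm

/-- The homomorphism from `G(H)` to its model. -/
def toModel : MillerGroup R →* Model R :=
  PresentedGroup.toGroup (f := modelGen R) (by
    rintro r (⟨i, rfl⟩ | ⟨i, j, rfl⟩ | ⟨j, rfl⟩ | ⟨k, j, rfl⟩) <;>
    simp only [map_mul, map_inv, FreeGroup.lift_apply_of, modelGen, mul_inv_eq_one,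
      inr_inv_mul_inl_mul_inr, lift_modelGen_liftS] <;> simp [conjTD, twist])

lemma toModel_ofTD (u : FreeGroup (Fin m ⊕ Fin n)) :
    toModel R (ofTD R u) = SemidirectProduct.inr u := by
  have : (toModel R).comp (ofTD R) = SemidirectProduct.inr := by
    refine FreeGroup.ext_hom _ _ fun x => ?_
    rcases x with i | j
    · rw [MonoidHom.comp_apply, ofTD_t]; simp [toModel, gen, modelGen]
    · rw [MonoidHom.comp_apply, ofTD_d]; simp [toModel, gen, modelGen]
  exact DFunLike.congr_fun this u

lemma toModel_ofS (s : FreeGroup (Fin n)) :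
    toModel R (ofS R s) = SemidirectProduct.inl (FreeGroup.map Gen.s s) := by
  have : (toModel R).comp (ofS R) = SemidirectProduct.inl.comp (FreeGroup.map Gen.s) := by
    refine FreeGroup.ext_hom _ _ fun x => ?_
    rw [MonoidHom.comp_apply, ofS_of]; simp [toModel, gen, modelGen]
  exact DFunLike.congr_fun this s

lemma toModel_qPow (ε : Bool) :
    toModel R (qPow R ε) = SemidirectProduct.inl (FreeGroup.mk [(Gen.q, ε)]) := by
  cases ε
  · have : (FreeGroup.mk [(Gen.q, false)] : FreeGroup (Gen n m)) = (FreeGroup.of Gen.q)⁻¹ := by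
      simp [FreeGroup.of, FreeGroup.invRev]
    rw [this]
    simp [toModel, gen, modelGen, qPow]
  · simp [toModel, gen, modelGen, qPow, FreeGroup.of]

lemma inr_mul_inl_inj {u u' : FreeGroup (Fin m ⊕ Fin n)} {w w' : FreeGroup (Gen n m)} :
    (SemidirectProduct.inr u * SemidirectProduct.inl w : Model R) =
      SemidirectProduct.inr u' * SemidirectProduct.inl w' ↔ u = u' ∧ w = w' := by
  constructor
  · intro h
    have h1 := congrArg SemidirectProduct.right h
    simp only [SemidirectProduct.mul_right, SemidirectProduct.right_inr,
      SemidirectProduct.right_inl, mul_one] at h1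
    subst h1
    exact ⟨rfl, SemidirectProduct.inl_injective (mul_left_cancel h)⟩
  · rintro ⟨rfl, rfl⟩; rfl

lemma gen_s_injective : Function.Injective (Gen.s : Fin n → Gen n m) := fun _ _ h => by
  cases h; rfl

/-- Read off in the model; it shows that `K` really is the direct product of the two free groups. -/
lemma ofTD_mul_ofS_inj {u u' : FreeGroup (Fin m ⊕ Fin n)} {s s' : FreeGroup (Fin n)} :
    ofTD R u * ofS R s = ofTD R u' * ofS R s' ↔ u = u' ∧ s = s' := by
  constructor
  · intro h
    have h := congrArg (toModel R) h
    simp only [map_mul, toModel_ofTD, toModel_ofS, inr_mul_inl_inj] at h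
    exact ⟨h.1, FreeGroup.map_injective gen_s_injective h.2⟩
  · rintro ⟨rfl, rfl⟩; rfl

/-- Both factors of an element of `K` are unique, so an element of the graph is determined by its
first factor. Every membership test of the algorithm becomes the evaluation of a homomorphism. -/
lemma mul_mem_assoc {ε : Bool} {u : FreeGroup (Fin m ⊕ Fin n)} {s : FreeGroup (Fin n)} :
    ofTD R u * ofS R s ∈ assoc R ε ↔ s = twist R ε u := by
  rw [mem_assoc]
  constructor
  · rintro ⟨u', h⟩
    rw [graphHom_apply, ofTD_mul_ofS_inj] at h
    rw [← h.1, ← h.2]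
  · rintro rfl
    exact ⟨u, rfl⟩

end Structure

end Miller

/-! ### Normal forms as freely reduced words, and their uniqueness -/

namespace Miller

section Syllables

variable {n m : ℕ} (R : Fin m → FreeGroup (Fin n))

/-- The word `s₀ q^{ε_1} s_1 ⋯ q^{ε_k} s_k`. -/
def sylWord (s : FreeGroup (Fin n)) (tail : List (Bool × FreeGroup (Fin n))) : Word n m :=
  NormalForm.wordS s ++ tail.flatMap fun p => (Gen.q, p.1) :: NormalForm.wordS p.2

/-- The element `q^{ε_1} s_1 ⋯ q^{ε_k} s_k`. -/
def tailProd (tail : List (Bool × FreeGroup (Fin n))) : MillerGroup R :=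
  (tail.map fun p => qPow R p.1 * ofS R p.2).prod

@[simp] lemma tailProd_nil : tailProd R [] = 1 := rfl

@[simp] lemma tailProd_cons (p : Bool × FreeGroup (Fin n))
    (tail : List (Bool × FreeGroup (Fin n))) :
    tailProd R (p :: tail) = qPow R p.1 * ofS R p.2 * tailProd R tail := by simp [tailProd]

@[simp] lemma tailProd_append (l l' : List (Bool × FreeGroup (Fin n))) :
    tailProd R (l ++ l') = tailProd R l * tailProd R l' := by simp [tailProd]

/-- The condition on a normal form: no subword `q^ε q^{-ε}`. -/
def TailReduced (tail : List (Bool × FreeGroup (Fin n))) : Prop :=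
  tail.IsChain fun p p' => p'.1 ≠ p.1 → p.2 ≠ 1

lemma val_append (v w : Word n m) : val R (v ++ w) = val R v * val R w := by
  simp [val, ← FreeGroup.mul_mk]

lemma val_wordTD (u : FreeGroup (Fin m ⊕ Fin n)) : val R (NormalForm.wordTD u) = ofTD R u := by
  conv_rhs => rw [← FreeGroup.mk_toWord (x := u)]
  rw [ofTD, MonoidHom.comp_apply, FreeGroup.map.mk]; rfl

lemma val_wordS (s : FreeGroup (Fin n)) : val R (NormalForm.wordS s) = ofS R s := by
  conv_rhs => rw [← FreeGroup.mk_toWord (x := s)]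
  rw [ofS, MonoidHom.comp_apply, FreeGroup.map.mk]; rfl

lemma val_q (ε : Bool) : val R [(Gen.q, ε)] = qPow R ε := by
  cases ε
  · have : (FreeGroup.mk [(Gen.q, false)] : FreeGroup (Gen n m)) = (FreeGroup.of Gen.q)⁻¹ := by
      simp [FreeGroup.of, FreeGroup.invRev]
    rw [val, this]; simp [qPow, gen, PresentedGroup.of]
  · rfl

lemma val_sylWord (s : FreeGroup (Fin n)) (tail : List (Bool × FreeGroup (Fin n))) :
    val R (sylWord s tail : Word n m) = ofS R s * tailProd R tail := by
  rw [sylWord, val_append, val_wordS]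
  congr 1
  induction tail with
  | nil => simp [val, ← FreeGroup.one_eq_mk]
  | cons p tail ih =>
    rw [List.flatMap_cons, val_append, ih, tailProd_cons, ← List.singleton_append, val_append,
      val_q, val_wordS]

lemma toWord_eq (x : NormalForm n m) :
    x.toWord = NormalForm.wordTD x.u ++ sylWord x.s₀ x.tail := by
  simp [NormalForm.toWord, sylWord]

lemma elt_eq (x : NormalForm n m) :
    x.elt R = ofTD R x.u * ofS R x.s₀ * tailProd R x.tail := by
  rw [NormalForm.elt, toWord_eq, val_append, val_wordTD, val_sylWord, mul_assoc]

lemma head_eq (x : NormalForm n m) : x.head R = ofTD R x.u * ofS R x.s₀ := by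
  rw [NormalForm.head, val_append, val_wordTD, val_wordS]

lemma elt_eq_head_mul (x : NormalForm n m) : x.elt R = x.head R * tailProd R x.tail := by
  rw [elt_eq, head_eq]

lemma sylWord_cons_eq (s : FreeGroup (Fin n)) (p : Bool × FreeGroup (Fin n))
    (tail : List (Bool × FreeGroup (Fin n))) :
    (sylWord s (p :: tail) : Word n m) =
      NormalForm.wordS s ++ (Gen.q, p.1) :: sylWord p.2 tail := by
  simp [sylWord]

lemma sylWord_nil (s : FreeGroup (Fin n)) :
    (sylWord s [] : Word n m) = NormalForm.wordS s := by simp [sylWord]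

lemma isReduced_map {α β : Type*} {f : α → β} (hf : Function.Injective f) {l : List (α × Bool)}
    (h : FreeGroup.IsReduced l) : FreeGroup.IsReduced (l.map fun p => (f p.1, p.2)) := by
  rw [FreeGroup.IsReduced, List.isChain_map]
  exact h.imp fun a b hab e => hab (hf e)

lemma isReduced_wordS (s : FreeGroup (Fin n)) :
    FreeGroup.IsReduced (NormalForm.wordS s : Word n m) :=
  isReduced_map gen_s_injective FreeGroup.isReduced_toWord

lemma wordS_eq_nil {s : FreeGroup (Fin n)} : (NormalForm.wordS s : Word n m) = [] ↔ s = 1 := by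
  simp [NormalForm.wordS, FreeGroup.toWord_eq_nil_iff]

lemma mem_wordS {s : FreeGroup (Fin n)} {x : Gen n m × Bool} (h : x ∈ NormalForm.wordS s) :
    ∃ j, x.1 = Gen.s j := by
  obtain ⟨y, -, rfl⟩ := List.mem_map.mp h
  exact ⟨_, rfl⟩

/-- The letters q and `s_j` cannot cancel each other, so the only possible cancellation is across an
empty syllable at a sign change, which a normal form excludes. -/
lemma isReduced_sylWord {s : FreeGroup (Fin n)} {tail : List (Bool × FreeGroup (Fin n))}
    (h : TailReduced tail) : FreeGroup.IsReduced (sylWord s tail : Word n m) := by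
  induction tail generalizing s with
  | nil => rw [sylWord_nil]; exact isReduced_wordS s
  | cons p tail ih =>
    rw [sylWord_cons_eq, FreeGroup.IsReduced, List.isChain_append]
    rw [TailReduced, List.isChain_cons] at h
    refine ⟨isReduced_wordS s, ?_, ?_⟩
    · rw [List.isChain_cons]
      refine ⟨?_, ih h.2⟩
      intro y hy
      cases tail with
      | nil =>
        rw [sylWord_nil] at hy
        obtain ⟨j, hj⟩ := mem_wordS (List.mem_of_mem_head? hy)
        simp [hj]
      | cons p' tail =>
        rw [sylWord_cons_eq] at hy
        by_cases hp : p.2 = 1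
        · have := h.1 p' (by simp)
          rw [wordS_eq_nil.mpr hp] at hy
          simp only [List.nil_append, List.head?_cons, Option.mem_def, Option.some.injEq] at hy
          subst hy
          intro _
          by_contra hne
          exact this (fun e => hne e.symm) hp
        · have hne : (NormalForm.wordS p.2 : Word n m) ≠ [] := fun e => hp (wordS_eq_nil.mp e)
          rw [List.head?_append_of_ne_nil _ hne] at hy
          obtain ⟨j, hj⟩ := mem_wordS (List.mem_of_mem_head? hy)
          simp [hj]
    · intro x hx y hy
      obtain ⟨j, hj⟩ := mem_wordS (List.mem_of_mem_getLast? hx)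
      simp only [List.head?_cons, Option.mem_def, Option.some.injEq] at hy
      subst hy
      simp [hj]

/-- Split a word in the `s_j` and `q` at the letters `q`. -/
def splitWord : Word n m → FreeGroup (Fin n) × List (Bool × FreeGroup (Fin n))
  | [] => (1, [])
  | (Gen.s j, b) :: l => (FreeGroup.mk [(j, b)] * (splitWord l).1, (splitWord l).2)
  | (Gen.q, b) :: l => (1, (b, (splitWord l).1) :: (splitWord l).2)
  | _ :: l => splitWord l

lemma splitWord_map_append (l : List (Fin n × Bool)) (w : Word n m) :
    splitWord (l.map (fun p => (Gen.s p.1, p.2)) ++ w) =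
      (FreeGroup.mk l * (splitWord w).1, (splitWord w).2) := by
  induction l with
  | nil => simp [← FreeGroup.one_eq_mk]
  | cons a l ih =>
    rw [List.map_cons, List.cons_append, splitWord, ih, ← mul_assoc, FreeGroup.mul_mk]
    rfl

lemma splitWord_sylWord (s : FreeGroup (Fin n)) (tail : List (Bool × FreeGroup (Fin n))) :
    splitWord (sylWord s tail : Word n m) = (s, tail) := by
  induction tail generalizing s with
  | nil =>
    have := splitWord_map_append (m := m) s.toWord []
    simpa [sylWord_nil, NormalForm.wordS, splitWord, FreeGroup.mk_toWord] using this
  | cons p tail ih =>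
    rw [sylWord_cons_eq, NormalForm.wordS, splitWord_map_append, splitWord, ih,
      FreeGroup.mk_toWord]
    simp

lemma sylWord_inj {s s' : FreeGroup (Fin n)} {tail tail' : List (Bool × FreeGroup (Fin n))}
    (h : (sylWord s tail : Word n m) = sylWord s' tail') : s = s' ∧ tail = tail' := by
  have := congrArg splitWord h
  rw [splitWord_sylWord, splitWord_sylWord] at this
  exact Prod.ext_iff.mp this

/-- A letter `s_j^{±1}` or `q^{±1}`. -/
def IsSQ : Gen n m → Prop
  | Gen.q => True
  | Gen.s _ => True
  | _ => False

/-- The converse of `isReduced_sylWord`: a machine that keeps its word in S and q freely reduced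
holds a normal form without further work. -/
lemma exists_sylWord {l : Word n m} (hl : FreeGroup.IsReduced l) (hs : ∀ x ∈ l, IsSQ x.1) :
    ∃ s tail, TailReduced tail ∧ l = sylWord s tail := by
  induction l with
  | nil =>
    refine ⟨1, [], List.isChain_nil, ?_⟩
    rw [sylWord_nil, wordS_eq_nil.mpr rfl]
  | cons x l ih =>
    obtain ⟨s, tail, ht, rfl⟩ := ih (hl.infix (List.suffix_cons x l).isInfix)
      fun y hy => hs y (List.mem_cons_of_mem _ hy)
    have hx := hs x List.mem_cons_self
    rcases x with ⟨_ | j | i | j, b⟩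
    · refine ⟨1, (b, s) :: tail, ?_, ?_⟩
      · rw [TailReduced, List.isChain_cons]
        refine ⟨?_, ht⟩
        intro p hp hne hs1
        dsimp only at hne hs1
        subst hs1
        cases tail with
        | nil => simp at hp
        | cons p' tail =>
          simp only [List.head?_cons, Option.mem_def, Option.some.injEq] at hp
          subst hp
          rw [sylWord_cons_eq, wordS_eq_nil.mpr rfl, FreeGroup.IsReduced,
            List.nil_append, List.isChain_cons_cons] at hl
          exact hne (hl.1 rfl).symm
      · rw [sylWord_cons_eq, wordS_eq_nil.mpr rfl]; rfl
    · have hred : FreeGroup.IsReduced ((j, b) :: s.toWord) := by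
        rw [FreeGroup.IsReduced, List.isChain_cons]
        refine ⟨?_, FreeGroup.isReduced_toWord⟩
        intro y hy e
        rw [FreeGroup.IsReduced, List.isChain_cons] at hl
        refine hl.1 (Gen.s y.1, y.2) ?_ (congrArg Gen.s e)
        have : (NormalForm.wordS s : Word n m).head? = some (Gen.s y.1, y.2) := by
          rw [NormalForm.wordS, List.head?_map, hy]; rfl
        rw [sylWord, List.head?_append, this]; rfl
      refine ⟨FreeGroup.mk ((j, b) :: s.toWord), tail, ht, ?_⟩
      rw [sylWord, sylWord, NormalForm.wordS, NormalForm.wordS, FreeGroup.toWord_mk,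
        hred.reduce_eq]
      rfl
    · exact hx.elim
    · exact hx.elim

lemma toModel_tailProd (tail : List (Bool × FreeGroup (Fin n))) :
    toModel R (tailProd R tail) = SemidirectProduct.inl (FreeGroup.mk
      (tail.flatMap fun p => (Gen.q, p.1) :: NormalForm.wordS p.2)) := by
  induction tail with
  | nil => simp [← FreeGroup.one_eq_mk]
  | cons p tail ih =>
    rw [tailProd_cons, map_mul, map_mul, ih, toModel_qPow, toModel_ofS, ← map_mul, ← map_mul]
    conv_lhs => rw [← FreeGroup.mk_toWord (x := p.2)]
    rw [FreeGroup.map.mk, FreeGroup.mul_mk, FreeGroup.mul_mk]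
    rfl

lemma toModel_elt (x : NormalForm n m) :
    toModel R (x.elt R) = SemidirectProduct.inr x.u *
      SemidirectProduct.inl (FreeGroup.mk (sylWord x.s₀ x.tail)) := by
  rw [elt_eq, map_mul, map_mul, toModel_ofTD, toModel_ofS, toModel_tailProd, mul_assoc, ← map_mul]
  conv_lhs => rw [← FreeGroup.mk_toWord (x := x.s₀)]
  rw [FreeGroup.map.mk, FreeGroup.mul_mk]
  rfl

/-- The factorization in the semidirect product is unique, and the words that represent the free
factor are already reduced, hence equal as words; the syllables can be recovered from them. -/
lemma elt_injective {x y : NormalForm n m} (h : x.elt R = y.elt R) : x = y := by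
  classical
  have h := congrArg (toModel R) h
  rw [toModel_elt, toModel_elt, inr_mul_inl_inj] at h
  obtain ⟨hu, hw⟩ := h
  have hw := FreeGroup.reduce.sound hw
  rw [(isReduced_sylWord x.chain).reduce_eq, (isReduced_sylWord y.chain).reduce_eq] at hw
  obtain ⟨hs, ht⟩ := sylWord_inj hw
  cases x; cases y
  simp_all

end Syllables

end Miller

/-! ### The length `len` and cyclically reduced elements -/

namespace Miller

section Length

variable {n m : ℕ} (R : Fin m → FreeGroup (Fin n))

/-- No pinch between two consecutive syllables. -/
def NoPinch (p p' : Bool × MillerGroup R) : Prop :=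
  ¬ (p.1 = false ∧ p.2 ∈ A R ∧ p'.1 = true) ∧ ¬ (p.1 = true ∧ p.2 ∈ B R ∧ p'.1 = false)

lemma noPinch_iff {p p' : Bool × MillerGroup R} :
    NoPinch R p p' ↔ (p.2 ∈ assoc R p.1 → p'.1 = p.1) := by
  rcases p with ⟨_ | _, g⟩ <;> rcases p' with ⟨_ | _, g'⟩ <;> simp [NoPinch, assoc]

/-- The product `q^{ε_1} h_1 ⋯ q^{ε_k} h_k`. -/
def formProd (L : List (Bool × MillerGroup R)) : MillerGroup R :=
  (L.map fun p => qPow R p.1 * p.2).prod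

/-- From the right end on, the parts in F(T, D) are moved to the left through the letters q, which
preserves the signs. The last clause carries the induction: the new head differs from `h₀` by an
element of the subgroup of the sign opposite to the first one, so a syllable that vanishes at a sign
change betrays a pinch in the given form. -/
lemma exists_tail_of_chain {L : List (Bool × MillerGroup R)} {h₀ : MillerGroup R}
    (h0 : h₀ ∈ K R) (hK : ∀ p ∈ L, p.2 ∈ K R) (hL : L.IsChain (NoPinch R)) :
    ∃ u s tail, TailReduced tail ∧ h₀ * formProd R L = ofTD R u * ofS R s * tailProd R tail ∧
      tail.map Prod.fst = L.map Prod.fst ∧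
      ∀ p ∈ L.head?, ∃ v, ofTD R u * ofS R s = h₀ * graphHom R (!p.1) v := by
  induction L generalizing h₀ with
  | nil =>
    obtain ⟨u, s, rfl⟩ := (mem_K R).mp h0
    exact ⟨u, s, [], List.isChain_nil, by simp [formProd], by simp, by simp⟩
  | cons a L ih =>
    obtain ⟨ε, h₁⟩ := a
    rw [List.isChain_cons] at hL
    obtain ⟨u1, s1, tail1, ht, hprod, hfst, hv⟩ :=
      ih (hK (ε, h₁) (by simp)) (fun p hp => hK p (List.mem_cons_of_mem _ hp)) hL.2
    obtain ⟨u0, s0, rfl⟩ := (mem_K R).mp h0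
    have hc := (commute_ofTD_ofS R u1 s0).eq
    have hu : ofTD R (u0 * u1) * ofS R (s0 * twist R (!ε) u1) =
        ofTD R u0 * ofS R s0 * graphHom R (!ε) u1 := by
      rw [map_mul, map_mul, graphHom_apply]
      simp only [mul_assoc]
      rw [← mul_assoc (ofTD R u1), hc, mul_assoc]
    refine ⟨u0 * u1, s0 * twist R (!ε) u1, (ε, (twist R ε u1)⁻¹ * s1) :: tail1, ?_, ?_, ?_, ?_⟩
    · rw [TailReduced, List.isChain_cons]
      refine ⟨?_, ht⟩
      intro p hp hne heq
      dsimp only at hne heq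
      rw [inv_mul_eq_one] at heq
      cases L with
      | nil => simp at hfst; simp [hfst] at hp
      | cons b L =>
        cases tail1 with
        | nil => simp at hfst
        | cons c tail1 =>
          simp only [List.head?_cons, Option.mem_def, Option.some.injEq] at hp
          subst hp
          simp only [List.map_cons, List.cons.injEq] at hfst
          obtain ⟨v, hv⟩ := hv b (by simp)
          have h2 := (noPinch_iff R).mp (hL.1 b (by simp))
          rw [hfst.1] at hne
          have hb : (!b.1) = ε := by revert hne; cases b.1 <;> cases ε <;> simp
          refine hne (h2 ?_)
          rw [hb] at hv
          -- A trivial new syllable puts the head of the remaining form into `assoc R ε`. By the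
          -- last clause this head is `h₁` times an element of the same subgroup, so `h₁` itself
          -- would pinch.
          have h3 : ofTD R u1 * ofS R s1 ∈ assoc R ε := (mul_mem_assoc R).mpr heq.symm
          rw [hv] at h3
          exact (Subgroup.mul_mem_cancel_right _ ((mem_assoc R).mpr ⟨v, rfl⟩)).mp h3
    · have e1 : formProd R ((ε, h₁) :: L) = qPow R ε * (h₁ * formProd R L) := by
        simp [formProd, mul_assoc]
      rw [e1, hprod, hu, tailProd_cons]
      have e2 := graphHom_mul_qPow R ε u1
      simp only [mul_assoc]
      rw [← mul_assoc (graphHom R (!ε) u1), e2, graphHom_apply, map_mul, map_inv]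
      simp only [mul_assoc, mul_inv_cancel_left]
    · simp [hfst]
    · intro p hp
      simp only [List.head?_cons, Option.mem_def, Option.some.injEq] at hp
      subst hp
      exact ⟨u1, hu⟩

lemma exists_nf_of_reducedForm {g h₀ : MillerGroup R} {L : List (Bool × MillerGroup R)}
    (h : IsReducedForm R g h₀ L) :
    ∃ x : NormalForm n m, x.elt R = g ∧ x.tail.length = L.length := by
  obtain ⟨hg, h0, hK, hL⟩ := h
  obtain ⟨u, s, tail, ht, hprod, hfst, -⟩ := exists_tail_of_chain R h0 hK hL
  refine ⟨⟨u, s, tail, ht⟩, ?_, by simpa using congrArg List.length hfst⟩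
  rw [elt_eq, hg]
  exact hprod.symm

/-- Any two reduced forms lead to the same normal form without changing the number of letters q, so
the set in the definition of `len` has a single element. -/
lemma len_of_reducedForm {g h₀ : MillerGroup R} {L : List (Bool × MillerGroup R)}
    (h : IsReducedForm R g h₀ L) : len R g = L.length := by
  have : {k | ∃ h₀ L, IsReducedForm R g h₀ L ∧ L.length = k} = {L.length} := by
    ext k
    constructor
    · rintro ⟨h₀', L', h', rfl⟩
      obtain ⟨x, hx, hxl⟩ := exists_nf_of_reducedForm R h
      obtain ⟨y, hy, hyl⟩ := exists_nf_of_reducedForm R h'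
      have := elt_injective R (hx.trans hy.symm)
      rw [Set.mem_singleton_iff, ← hyl, ← hxl, this]
    · rintro rfl
      exact ⟨h₀, L, h, rfl⟩
  rw [len, this, csInf_singleton]

lemma ofS_mem_assoc {ε : Bool} {s : FreeGroup (Fin n)} : ofS R s ∈ assoc R ε ↔ s = 1 := by
  have := mul_mem_assoc R (ε := ε) (u := 1) (s := s)
  simpa using this

/-- The syllables of a normal form, as elements of `G(H)`. -/
def sylForm (tail : List (Bool × FreeGroup (Fin n))) : List (Bool × MillerGroup R) :=
  tail.map fun p => (p.1, ofS R p.2)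

lemma formProd_sylForm (tail : List (Bool × FreeGroup (Fin n))) :
    formProd R (sylForm R tail) = tailProd R tail := by
  simp [formProd, sylForm, tailProd, Function.comp_def]

lemma isChain_sylForm {tail : List (Bool × FreeGroup (Fin n))} (h : TailReduced tail) :
    (sylForm R tail).IsChain (NoPinch R) := by
  rw [sylForm, List.isChain_map]
  refine h.imp fun p p' hp => ?_
  rw [noPinch_iff, ofS_mem_assoc]
  intro h1
  by_contra hne
  exact hp hne h1

lemma ofS_mem_K (s : FreeGroup (Fin n)) : ofS R s ∈ K R :=
  (mem_K R).mpr ⟨1, s, by simp⟩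

lemma sylForm_mem_K {tail : List (Bool × FreeGroup (Fin n))} :
    ∀ p ∈ sylForm R tail, p.2 ∈ K R := by
  intro p hp
  obtain ⟨p', -, rfl⟩ := List.mem_map.mp hp
  exact ofS_mem_K R _

lemma head_mem_K (x : NormalForm n m) : x.head R ∈ K R :=
  (mem_K R).mpr ⟨_, _, (head_eq R x).symm⟩

lemma len_elt (x : NormalForm n m) : len R (x.elt R) = x.tail.length := by
  have : IsReducedForm R (x.elt R) (x.head R) (sylForm R x.tail) :=
    ⟨by rw [elt_eq_head_mul, ← formProd_sylForm]; rfl, head_mem_K R x, sylForm_mem_K R,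
      isChain_sylForm R x.chain⟩
  rw [len_of_reducedForm R this, sylForm, List.length_map]

lemma cyclicPinch_iff {h : MillerGroup R} {last : Bool × FreeGroup (Fin n)} :
    CyclicPinch R h last ↔ ofS R last.2 * h ∈ assoc R last.1 := by
  rcases last with ⟨_ | _, s⟩ <;> simp [CyclicPinch, assoc, val_wordS]

/-- In the square of the element only the junction of the two copies, with `s_k h` between the
letters q, could pinch. That would need opposite signs at the ends together with a successful test.
-/
lemma isCyclicallyReduced_of_last {x : NormalForm n m} {first last : Bool × FreeGroup (Fin n)}
    (hf : x.tail.head? = some first) (hl : x.tail.getLast? = some last)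
    (h : CyclicPinch R (x.head R) last → first.1 = last.1) :
    IsCyclicallyReduced R (x.elt R) := by
  have hlen := len_elt R x
  have hne : x.tail ≠ [] := by rintro e; simp [e] at hf
  have hpos : 0 < x.tail.length := List.length_pos_of_ne_nil hne
  refine ⟨fun _ => ?_, fun h0 => by omega⟩
  obtain ⟨init, hinit⟩ : ∃ init, x.tail = init ++ [last] :=
    ⟨_, (List.dropLast_append_getLast? last hl).symm⟩
  have hform : IsReducedForm R (x.elt R ^ 2) (x.head R)
      (sylForm R init ++ (last.1, ofS R last.2 * x.head R) :: sylForm R x.tail) := by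
    refine ⟨?_, head_mem_K R x, ?_, ?_⟩
    · change _ = _ * formProd R _
      have : formProd R (sylForm R init ++ (last.1, ofS R last.2 * x.head R) :: sylForm R x.tail) =
          tailProd R init * (qPow R last.1 * (ofS R last.2 * x.head R) * tailProd R x.tail) := by
        rw [← formProd_sylForm, ← formProd_sylForm]
        simp [formProd]
      rw [this, pow_two, elt_eq_head_mul]
      conv_lhs => enter [1, 2]; rw [hinit]
      simp [mul_assoc]
    · intro p hp
      rcases List.mem_append.mp hp with hp | hp
      · exact sylForm_mem_K R p hp
      · rcases List.mem_cons.mp hp with rfl | hp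
        · exact mul_mem (ofS_mem_K R _) (head_mem_K R x)
        · exact sylForm_mem_K R p hp
    · change List.IsChain (NoPinch R) _
      have hc := isChain_sylForm R x.chain
      have hc' := hc
      rw [hinit, sylForm, List.map_append, List.map_singleton, List.isChain_append] at hc'
      rw [List.isChain_append, List.isChain_cons]
      refine ⟨hc'.1, ⟨?_, hc⟩, ?_⟩
      · intro p hp
        rw [sylForm, List.head?_map, hf] at hp
        simp only [Option.map_some, Option.mem_def, Option.some.injEq] at hp
        subst hp
        rw [noPinch_iff]
        intro h1
        exact h ((cyclicPinch_iff R).mpr h1)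
      · intro p hp p' hp'
        have := hc'.2.2 p hp (last.1, ofS R last.2) (by simp)
        simp only [List.head?_cons, Option.mem_def, Option.some.injEq] at hp'
        subst hp'
        exact this
  rw [len_of_reducedForm R hform, hlen]
  have : x.tail.length = init.length + 1 := by rw [hinit]; simp
  simp only [List.length_append, List.length_cons, sylForm, List.length_map]
  omega

lemma conj_ofTD_mul_ofS (u u' : FreeGroup (Fin m ⊕ Fin n)) (s s' : FreeGroup (Fin n)) :
    (ofTD R u * ofS R s)⁻¹ * (ofTD R u' * ofS R s') * (ofTD R u * ofS R s) =
      ofTD R (u⁻¹ * u' * u) * ofS R (s⁻¹ * s' * s) := by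
  change (ofKer R (u, s))⁻¹ * ofKer R (u', s') * ofKer R (u, s) = _
  rw [← map_inv, ← map_mul, ← map_mul]
  rfl

theorem AlgorithmIII.isConj {x y : NormalForm n m} (h : AlgorithmIII R x y) :
    IsConj (x.elt R) (y.elt R) := by
  induction h with
  | base => exact IsConj.refl _
  | single => exact IsConj.refl _
  | sameSign => exact IsConj.refl _
  | noPinch => exact IsConj.refl _
  | conj x y z _ _ _ _ hy =>
    rw [hy, isConj_iff]
    exact ⟨z⁻¹, by simp⟩
  | iterate x x' y first last _ _ _ _ _ hx' _ ih =>
    refine IsConj.trans ?_ ih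
    rw [hx', isConj_iff]
    exact ⟨(x.head R * qPow R first.1)⁻¹, by simp [mul_assoc]⟩

theorem AlgorithmIII.isCyclicallyReduced {x y : NormalForm n m} (h : AlgorithmIII R x y) :
    IsCyclicallyReduced R (y.elt R) := by
  induction h with
  | base x h0 h =>
    refine ⟨fun hp => ?_, fun _ => h⟩
    rw [len_elt, h0] at hp
    exact absurd hp (lt_irrefl 0)
  | conj x y z h0 _ hz hC hy =>
    rw [← hy] at hC
    refine ⟨fun hp => ?_, fun _ => Or.inl hC⟩
    exfalso
    obtain ⟨u, s, rfl⟩ := (mem_K R).mp hz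
    -- A conjugate within `K` has an evident normal form without letters q, and by uniqueness it is
    -- `y`; so positive length is impossible.
    have : (⟨u⁻¹ * x.u * u, s⁻¹ * x.s₀ * s, [], List.isChain_nil⟩ : NormalForm n m) = y := by
      refine elt_injective R ?_
      rw [hy, elt_eq, elt_eq, h0, tailProd_nil, mul_one, mul_one, conj_ofTD_mul_ofS]
    rw [len_elt, ← this] at hp
    exact absurd hp (lt_irrefl 0)
  | single x h1 =>
    obtain ⟨p, hp⟩ := List.length_eq_one_iff.mp h1
    exact isCyclicallyReduced_of_last R (first := p) (last := p) (by simp [hp]) (by simp [hp])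
      fun _ => rfl
  | sameSign x first last _ hf hl h => exact isCyclicallyReduced_of_last R hf hl fun _ => h
  | noPinch x first last _ hf hl _ h =>
    exact isCyclicallyReduced_of_last R hf hl fun h' => absurd h' h
  | iterate _ _ _ _ _ _ _ _ _ _ _ _ ih => exact ih

end Length

end Miller

/-! ### Algorithm III with the conjugation postponed to the end -/

namespace Miller

section Lazy

variable {n m : ℕ} (R : Fin m → FreeGroup (Fin n))

/-- The factor that a syllable receives from the right when `v e` is moved to the left. -/
def carry (v : FreeGroup (Fin m ⊕ Fin n)) (e : FreeGroup (Fin n)) :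
    List (Bool × FreeGroup (Fin n)) → FreeGroup (Fin n)
  | [] => e
  | p :: _ => twist R (!p.1) v

/-- The syllables after moving `v e` from the right end to the left. -/
def moveTail (v : FreeGroup (Fin m ⊕ Fin n)) (e : FreeGroup (Fin n)) :
    List (Bool × FreeGroup (Fin n)) → List (Bool × FreeGroup (Fin n))
  | [] => []
  | p :: l => (p.1, (twist R p.1 v)⁻¹ * p.2 * carry R v e l) :: moveTail v e l

/-- Crossing `q^ε`, the element `v` leaves `twist (!ε) v` on its left and `(twist ε v)⁻¹` on its
right. The former joins the preceding syllable through `carry`, the latter the following one. -/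
lemma moveTail_spec (v : FreeGroup (Fin m ⊕ Fin n)) (e s : FreeGroup (Fin n))
    (tail : List (Bool × FreeGroup (Fin n))) :
    ofS R s * tailProd R tail * (ofTD R v * ofS R e) =
      ofTD R v * ofS R (s * carry R v e tail) * tailProd R (moveTail R v e tail) := by
  induction tail generalizing s with
  | nil =>
    have := (commute_ofTD_ofS R v s).eq
    simp only [tailProd_nil, mul_one, carry, moveTail, map_mul]
    rw [← mul_assoc, ← this, mul_assoc]
  | cons p tail ih =>
    have h1 := graphHom_mul_qPow R p.1 v
    have h2 := (commute_ofTD_ofS R v s).eq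
    have h3 : ofTD R v = graphHom R p.1 v * (ofS R (twist R p.1 v))⁻¹ := by
      rw [graphHom_apply, mul_inv_cancel_right]
    calc ofS R s * tailProd R (p :: tail) * (ofTD R v * ofS R e)
        = ofS R s * (qPow R p.1 * (ofS R p.2 * tailProd R tail * (ofTD R v * ofS R e))) := by
          simp [mul_assoc]
      _ = ofS R s * (qPow R p.1 * (graphHom R p.1 v * (ofS R (twist R p.1 v))⁻¹ *
            ofS R (p.2 * carry R v e tail) * tailProd R (moveTail R v e tail))) := by rw [ih, ← h3]
      _ = ofS R s * (qPow R p.1 * graphHom R p.1 v) * ((ofS R (twist R p.1 v))⁻¹ *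
            ofS R (p.2 * carry R v e tail) * tailProd R (moveTail R v e tail)) := by
          simp only [mul_assoc]
      _ = _ := by
          rw [← h1, graphHom_apply]
          simp only [carry, moveTail, tailProd_cons, map_mul, map_inv, mul_assoc]
          rw [← mul_assoc (ofS R s), ← h2, mul_assoc]

/-- At a sign change a syllable receives `(twist ε v)⁻¹` on the left and `twist ε v` on the right
with the same ε. It is merely conjugated, and so it stays nontrivial. -/
lemma tailReduced_moveTail {v : FreeGroup (Fin m ⊕ Fin n)} {e : FreeGroup (Fin n)}
    {tail : List (Bool × FreeGroup (Fin n))} (h : TailReduced tail) :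
    TailReduced (moveTail R v e tail) := by
  induction tail with
  | nil => exact List.isChain_nil
  | cons p tail ih =>
    rw [TailReduced, List.isChain_cons] at h
    rw [moveTail, TailReduced, List.isChain_cons]
    refine ⟨?_, ih h.2⟩
    cases tail with
    | nil => simp [moveTail]
    | cons p' tail =>
      intro p'' hp'' hne
      simp only [moveTail, List.head?_cons, Option.mem_def, Option.some.injEq] at hp''
      subst hp''
      dsimp only at hne ⊢
      have hb : (!p'.1) = p.1 := by revert hne; cases p'.1 <;> cases p.1 <;> simp
      intro heq
      rw [carry, hb, mul_assoc, inv_mul_eq_one] at heq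
      exact h.1 p' (by simp) hne (by simpa using heq.symm)

lemma moveTail_length (v : FreeGroup (Fin m ⊕ Fin n)) (e : FreeGroup (Fin n))
    (tail : List (Bool × FreeGroup (Fin n))) :
    (moveTail R v e tail).length = tail.length := by
  induction tail <;> simp_all [moveTail]

lemma moveTail_concat (v : FreeGroup (Fin m ⊕ Fin n)) (e : FreeGroup (Fin n))
    (tail : List (Bool × FreeGroup (Fin n))) (p : Bool × FreeGroup (Fin n)) :
    (moveTail R v e (tail ++ [p])).getLast? = some (p.1, (twist R p.1 v)⁻¹ * p.2 * e) := by
  induction tail with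
  | nil => simp [moveTail, carry]
  | cons p' tail ih =>
    have hne : moveTail R v e (tail ++ [p]) ≠ [] := by
      rw [← List.length_pos_iff_ne_nil, moveTail_length]; simp
    rw [List.cons_append, moveTail, List.getLast?_cons, ih]
    simp

/-- The normal form of `c⁻¹ (u a s q^{ε_1} s_1 ⋯ q^{ε_k} s_k) c`, where `c = v e` and `v` commutes
with `u`. -/
def conjForm (u v : FreeGroup (Fin m ⊕ Fin n)) (e a s : FreeGroup (Fin n))
    (tail : List (Bool × FreeGroup (Fin n))) (h : TailReduced tail) : NormalForm n m :=
  ⟨u, e⁻¹ * a * s * carry R v e tail, moveTail R v e tail, tailReduced_moveTail R h⟩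

variable {u v : FreeGroup (Fin m ⊕ Fin n)} {e a s : FreeGroup (Fin n)}
  {tail : List (Bool × FreeGroup (Fin n))}

/-- Moving `v e` to the left end brings `v` next to `v⁻¹ u`; since `v` commutes with `u`, the factor
in F(T, D) is still `u`. -/
lemma elt_conjForm (h : TailReduced tail) (huv : Commute u v) :
    (conjForm R u v e a s tail h).elt R = (ofTD R v * ofS R e)⁻¹ *
      (ofTD R u * ofS R a * (ofS R s * tailProd R tail)) * (ofTD R v * ofS R e) := by
  have h1 := moveTail_spec R v e s tail
  have h2 : (ofS R e)⁻¹ * (ofTD R v)⁻¹ * ofTD R u * ofS R a * ofTD R v =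
      ofTD R u * ofS R (e⁻¹ * a) := by
    have h3 := (commute_ofTD_ofS R v a).eq
    have h4 := (commute_ofTD_ofS R u e).inv_right.eq
    have h5 : ofTD R u * ofTD R v = ofTD R v * ofTD R u := by rw [← map_mul, huv.eq, map_mul]
    rw [map_mul, map_inv, ← mul_assoc, h4, mul_assoc _ (ofS R a), ← h3, ← mul_assoc,
      mul_assoc _ (ofTD R u), h5]
    simp only [mul_assoc, inv_mul_cancel_left]
  rw [elt_eq]
  simp only [conjForm]
  rw [show e⁻¹ * a * s * carry R v e tail = e⁻¹ * a * (s * carry R v e tail) by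
      simp only [mul_assoc], map_mul, ← mul_assoc, ← h2, mul_inv_rev]
  simp only [mul_assoc] at h1 ⊢
  rw [h1]

/-- In the product of the last syllable with the head, `e` cancels and the rest is conjugated by
`twist q.1 v`, which commutes with `twist q.1 u`. The test can therefore be made on the unconjugated
syllables, whatever `v` and `e` are. -/
lemma conjForm_pinch_iff {p q : Bool × FreeGroup (Fin n)} {t : List (Bool × FreeGroup (Fin n))}
    (h : TailReduced (p :: (t ++ [q]))) (huv : Commute u v) (hpq : p.1 ≠ q.1) :
    CyclicPinch R ((conjForm R u v e a s _ h).head R) (q.1, (twist R q.1 v)⁻¹ * q.2 * e) ↔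
      q.2 * a * s = twist R q.1 u := by
  have hb : (!p.1) = q.1 := by revert hpq; cases p.1 <;> cases q.1 <;> simp
  have hc : Commute (twist R q.1 v) (twist R q.1 u) := (huv.symm).map _
  rw [cyclicPinch_iff, head_eq]
  simp only [conjForm, carry, hb]
  rw [← mul_assoc, ← (commute_ofTD_ofS R u _).eq, mul_assoc, ← map_mul, mul_mem_assoc]
  rw [show (twist R q.1 v)⁻¹ * q.2 * e * (e⁻¹ * a * s * twist R q.1 v) =
    (twist R q.1 v)⁻¹ * (q.2 * a * s) * twist R q.1 v by group]
  rw [mul_assoc, inv_mul_eq_iff_eq_mul, hc.eq, mul_left_inj]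

/-- A successful test collapses the two outer letters q, with the unconjugated last syllable and
head between them, to `graphHom R p.1 u`, which stands to the right of the inner segment.
Conjugation by this element moves it to the front, where it is `u` times the new `a`. The new
conjugator is `graphHom R p.1 (u * v)`: it depends only on the latest sign and on the exponent when
`v` is a power of `u`. -/
lemma conjForm_step {p q : Bool × FreeGroup (Fin n)} {t : List (Bool × FreeGroup (Fin n))}
    (h : TailReduced (p :: (t ++ [q]))) (h' : TailReduced t) (huv : Commute u v)
    (hpq : p.1 ≠ q.1) (hp : q.2 * a * s = twist R q.1 u) :
    (conjForm R u (u * v) (twist R p.1 (u * v)) (twist R p.1 u) p.2 t h').elt R =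
      (qPow R p.1)⁻¹ * ((conjForm R u v e a s _ h).head R)⁻¹ *
        (conjForm R u v e a s _ h).elt R * (conjForm R u v e a s _ h).head R * qPow R p.1 := by
  have hb : q.1 = !p.1 := by revert hpq; cases p.1 <;> cases q.1 <;> simp
  have huu : Commute u (u * v) := (Commute.refl u).mul_right huv
  rw [elt_conjForm R h' huu, elt_conjForm R h huv]
  set H := (conjForm R u v e a s _ h).head R with hH
  -- The old conjugator passes through the head and through `q^{ε_1}`; what remains on the right is
  -- its factor `v` completed to an element of `A` or `B`.
  have e1 : ofTD R v * ofS R e * H * qPow R p.1 =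
      ofTD R u * ofS R a * ofS R s * qPow R p.1 * graphHom R p.1 v := by
    have h1 := graphHom_mul_qPow R p.1 v
    rw [mul_assoc _ _ (graphHom R p.1 v), ← h1, hH, head_eq]
    simp only [conjForm, carry, graphHom_apply]
    have h2 : ofTD R v * ofS R e * (ofTD R u * ofS R (e⁻¹ * a * s * twist R (!p.1) v)) =
        ofTD R u * ofS R (a * s) * (ofTD R v * ofS R (twist R (!p.1) v)) := by
      change ofKer R (v, e) * ofKer R (u, _) = ofKer R (u, a * s) * ofKer R (v, _)
      rw [← map_mul, ← map_mul]
      congr 1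
      ext1
      · exact huv.symm.eq
      · change e * _ = a * s * _
        group
    rw [h2, map_mul]
    simp only [mul_assoc]
  have e2 : ofS R q.2 * (ofTD R u * ofS R a * ofS R s) = graphHom R q.1 u := by
    rw [graphHom_apply, ← hp, map_mul, map_mul, ← mul_assoc, ← mul_assoc,
      ← (commute_ofTD_ofS R u q.2).eq]
    simp only [mul_assoc]
  have e3 : (ofTD R v * ofS R e)⁻¹ * (ofTD R u * ofS R a * ofS R s * qPow R p.1) =
      H * qPow R p.1 * (graphHom R p.1 v)⁻¹ := by
    rw [inv_mul_eq_iff_eq_mul, eq_comm, ← mul_assoc, mul_inv_eq_iff_eq_mul, ← mul_assoc, e1]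
  -- The pinch itself, for the opposite signs of the two ends.
  have e4 : qPow R q.1 * (graphHom R q.1 u * qPow R p.1) = graphHom R p.1 u := by
    rw [hb, graphHom_mul_qPow R p.1 u, qPow_not, inv_mul_cancel_left]
  have e5 : ofTD R (u * v) * ofS R (twist R p.1 (u * v)) =
      graphHom R p.1 u * graphHom R p.1 v := by rw [← map_mul]; rfl
  rw [e5]
  have e6 : ofTD R u * ofS R (twist R p.1 u) = graphHom R p.1 u := rfl
  rw [e6]
  symm
  calc (qPow R p.1)⁻¹ * H⁻¹ * ((ofTD R v * ofS R e)⁻¹ *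
          (ofTD R u * ofS R a * (ofS R s * tailProd R (p :: (t ++ [q])))) *
            (ofTD R v * ofS R e)) * H * qPow R p.1
      = (H * qPow R p.1)⁻¹ * ((ofTD R v * ofS R e)⁻¹ *
          (ofTD R u * ofS R a * ofS R s * qPow R p.1)) * ofS R p.2 * tailProd R t *
            (qPow R q.1 * ofS R q.2 * (ofTD R v * ofS R e * H * qPow R p.1)) := by
        simp only [mul_assoc, tailProd_cons, tailProd_append, tailProd_nil, mul_inv_rev, mul_one]
    _ = (graphHom R p.1 v)⁻¹ * ofS R p.2 * tailProd R t * (qPow R q.1 *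
          (ofS R q.2 * (ofTD R u * ofS R a * ofS R s) * qPow R p.1) * graphHom R p.1 v) := by
        rw [e3, e1]
        simp only [mul_assoc, mul_inv_rev, inv_mul_cancel_left]
    _ = (graphHom R p.1 v)⁻¹ * ofS R p.2 * tailProd R t *
          (graphHom R p.1 u * graphHom R p.1 v) := by rw [e2, e4]
    _ = _ := by simp only [mul_inv_rev, mul_assoc, inv_mul_cancel_left]

/-- One round of Algorithm III on `u a s q^{ε_1} s_1 ⋯ q^{ε_k} s_k`: if there is a cyclic pinch, it
returns `ε_1`, `s_1` and the syllables strictly inside. -/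
def pinchStep (u : FreeGroup (Fin m ⊕ Fin n)) (a s : FreeGroup (Fin n)) :
    List (Bool × FreeGroup (Fin n)) → Option (Bool × FreeGroup (Fin n) ×
      List (Bool × FreeGroup (Fin n)))
  | [] => none
  | p :: t => match t.getLast? with
    | none => none
    | some q => if p.1 ≠ q.1 ∧ q.2 * a * s = twist R q.1 u then some (p.1, p.2, t.dropLast)
        else none

lemma exists_of_pinchStep_eq_some {ε : Bool} {s₁ : FreeGroup (Fin n)}
    {t : List (Bool × FreeGroup (Fin n))} (h : pinchStep R u a s tail = some (ε, s₁, t)) :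
    ∃ q, tail = (ε, s₁) :: (t ++ [q]) ∧ ε ≠ q.1 ∧ q.2 * a * s = twist R q.1 u := by
  cases tail with
  | nil => simp [pinchStep] at h
  | cons p t' =>
    rw [pinchStep] at h
    split at h
    · simp at h
    · next q hq =>
      split_ifs at h with hc
      simp only [Option.some.injEq, Prod.mk.injEq] at h
      obtain ⟨h1, h2, h3⟩ := h
      refine ⟨q, ?_, h1 ▸ hc.1, hc.2⟩
      rw [← h3, List.dropLast_append_getLast? _ hq, ← h1, ← h2]

lemma tailReduced_of_pinch {p q : Bool × FreeGroup (Fin n)}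
    {t : List (Bool × FreeGroup (Fin n))} (h : TailReduced (p :: (t ++ [q]))) : TailReduced t := by
  rw [TailReduced, List.isChain_cons, List.isChain_append] at h
  exact h.2.1

lemma algorithmIII_step {p q : Bool × FreeGroup (Fin n)} {t : List (Bool × FreeGroup (Fin n))}
    {y : NormalForm n m} (h : TailReduced (p :: (t ++ [q]))) (h' : TailReduced t)
    (huv : Commute u v) (hpq : p.1 ≠ q.1) (hp : q.2 * a * s = twist R q.1 u)
    (hy : AlgorithmIII R
      (conjForm R u (u * v) (twist R p.1 (u * v)) (twist R p.1 u) p.2 t h') y) :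
    AlgorithmIII R (conjForm R u v e a s _ h) y := by
  refine AlgorithmIII.iterate _ _ y (p.1, (twist R p.1 v)⁻¹ * p.2 * carry R v e (t ++ [q]))
    (q.1, (twist R q.1 v)⁻¹ * q.2 * e) ?_ ?_ ?_ hpq ?_ (conjForm_step R h h' huv hpq hp) hy
  · simp [conjForm, moveTail_length]
  · simp [conjForm, moveTail]
  · exact moveTail_concat R v e (p :: t) q
  · exact (conjForm_pinch_iff R h huv hpq).mpr hp

/-- For a nonempty tail, failure of `pinchStep` merges the three ways to stop: a single letter q,
equal signs at the ends, or a failed test. -/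
lemma algorithmIII_terminal (h : TailReduced tail) (huv : Commute u v) (hne : tail ≠ [])
    (hs : pinchStep R u a s tail = none) :
    AlgorithmIII R (conjForm R u v e a s tail h) (conjForm R u v e a s tail h) := by
  cases tail with
  | nil => exact absurd rfl hne
  | cons p t =>
    rcases List.eq_nil_or_concat' t with rfl | ⟨t, q, rfl⟩
    · exact AlgorithmIII.single _ (by simp [conjForm, moveTail])
    · have h2 : 2 ≤ (conjForm R u v e a s (p :: (t ++ [q])) h).tail.length := by
        simp [conjForm, moveTail_length]
      have hf : (conjForm R u v e a s (p :: (t ++ [q])) h).tail.head? = some (p.1, _) := rfl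
      have hl := moveTail_concat R v e (p :: t) q
      by_cases hpq : p.1 = q.1
      · exact AlgorithmIII.sameSign _ _ _ h2 hf hl hpq
      · refine AlgorithmIII.noPinch _ _ _ h2 hf hl hpq fun hc => ?_
        have := (conjForm_pinch_iff R h huv hpq).mp hc
        simp [pinchStep, hpq, this] at hs

lemma mem_C_iff {u : FreeGroup (Fin m ⊕ Fin n)} {s : FreeGroup (Fin n)} :
    ofTD R u * ofS R s ∈ C R ↔ ∃ ε, s = twist R ε u := by
  have h0 := mul_mem_assoc R (ε := false) (u := u) (s := s)
  have h1 := mul_mem_assoc R (ε := true) (u := u) (s := s)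
  simp only [assoc, Bool.false_eq_true, if_false, if_true] at h0 h1
  simp [C, h0, h1]

lemma algorithmIII_base_mem {x : NormalForm n m} (ht : x.tail = []) {ε : Bool}
    (h : x.s₀ = twist R ε x.u) : AlgorithmIII R x x := by
  refine AlgorithmIII.base x ht (Or.inl ?_)
  rw [elt_eq, ht, tailProd_nil, mul_one, mem_C_iff]
  exact ⟨ε, h⟩

/-- Conjugation in `K` acts on the two factors separately, and `twist` sends conjugates of `x.u` to
conjugates of its twist. So a conjugate in `A ∪ B` would make `x.s₀` conjugate in F(S) to a twist of
`x.u`. -/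
lemma algorithmIII_base_not_conj {x : NormalForm n m} (ht : x.tail = [])
    (h : ∀ ε, ¬ IsConj x.s₀ (twist R ε x.u)) : AlgorithmIII R x x := by
  refine AlgorithmIII.base x ht (Or.inr fun z hz hC => ?_)
  obtain ⟨u, s, rfl⟩ := (mem_K R).mp hz
  rw [elt_eq, ht, tailProd_nil, mul_one, conj_ofTD_mul_ofS, mem_C_iff] at hC
  obtain ⟨ε, hε⟩ := hC
  refine h ε (isConj_iff.mpr ⟨twist R ε u * s⁻¹, ?_⟩)
  rw [show twist R ε u * s⁻¹ * x.s₀ * (twist R ε u * s⁻¹)⁻¹ =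
    twist R ε u * (s⁻¹ * x.s₀ * s) * (twist R ε u)⁻¹ by group, hε]
  simp only [map_mul, map_inv]
  group

/-- A conjugator from F(S) suffices: it leaves `x.u` fixed and carries `x.s₀` to the twist. No
conjugator has to be computed to know the result. -/
lemma algorithmIII_base_conj {x : NormalForm n m} (ht : x.tail = [])
    (hn : ∀ ε, x.s₀ ≠ twist R ε x.u) {ε : Bool} (h : IsConj x.s₀ (twist R ε x.u)) :
    AlgorithmIII R x ⟨x.u, twist R ε x.u, [], List.isChain_nil⟩ := by
  obtain ⟨c, hc⟩ := isConj_iff.mp h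
  have hz : (ofTD R 1 * ofS R c⁻¹)⁻¹ * x.elt R * (ofTD R 1 * ofS R c⁻¹) =
      ofTD R x.u * ofS R (twist R ε x.u) := by
    rw [elt_eq, ht, tailProd_nil, mul_one, conj_ofTD_mul_ofS, ← hc]
    simp
  refine AlgorithmIII.conj x _ (ofTD R 1 * ofS R c⁻¹) ht ?_ ((mem_K R).mpr ⟨_, _, rfl⟩) ?_ ?_
  · rw [elt_eq, ht, tailProd_nil, mul_one, mem_C_iff]
    exact fun ⟨ε, h⟩ => hn ε h
  · rw [hz, mem_C_iff]; exact ⟨ε, rfl⟩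
  · rw [hz, elt_eq]; simp

end Lazy

end Miller

/-! ### Conjugacy and cyclic reduction in free groups -/

namespace Miller

section Conjugacy

variable {α : Type*}

/-- The inverse letter. -/
def letterInv (x : α × Bool) : α × Bool := (x.1, !x.2)

lemma invRev_eq (l : List (α × Bool)) : FreeGroup.invRev l = (l.map letterInv).reverse := rfl

lemma mk_letterInv (x : α × Bool) : FreeGroup.mk [letterInv x] = (FreeGroup.mk [x])⁻¹ := by
  simp [FreeGroup.inv_mk, FreeGroup.invRev, letterInv]

lemma eq_letterInv_iff {x y : α × Bool} : y = letterInv x ↔ ¬ (x.1 = y.1 → x.2 = y.2) := by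
  rcases x with ⟨x, b⟩
  rcases y with ⟨y, c⟩
  simp only [letterInv, Prod.mk.injEq, Classical.not_imp, eq_comm (a := x)]
  cases b <;> cases c <;> simp

lemma cyclicallyReduced_rotate {x : α × Bool} {L : List (α × Bool)}
    (h : FreeGroup.IsCyclicallyReduced (x :: L)) :
    FreeGroup.IsCyclicallyReduced (L ++ [x]) := by
  obtain ⟨h1, h2⟩ := h
  rw [FreeGroup.IsReduced, List.isChain_cons] at h1
  refine ⟨?_, ?_⟩
  · rw [FreeGroup.IsReduced, List.isChain_append]
    refine ⟨h1.2, List.isChain_singleton x, ?_⟩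
    intro a ha b hb
    simp only [List.head?_cons, Option.mem_def, Option.some.injEq] at hb
    subst hb
    refine h2 a ?_ x (by simp)
    rw [Option.mem_def] at ha
    rw [List.getLast?_cons, ha]
    simp
  · intro a ha b hb
    rw [List.getLast?_concat, Option.mem_def, Option.some.injEq] at ha
    subst ha
    cases L with
    | nil => simp at hb; simp [hb]
    | cons c L => simp at hb; subst hb; exact h1.1 c (by simp)

lemma cyclicallyReduced_rotate_back {x : α × Bool} {L : List (α × Bool)}
    (h : FreeGroup.IsCyclicallyReduced (L ++ [x])) :
    FreeGroup.IsCyclicallyReduced (x :: L) := by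
  obtain ⟨h1, h2⟩ := h
  rw [FreeGroup.IsReduced, List.isChain_append] at h1
  refine ⟨?_, ?_⟩
  · rw [FreeGroup.IsReduced, List.isChain_cons]
    refine ⟨?_, h1.1⟩
    intro b hb
    refine h2 x (by simp) b ?_
    rw [Option.mem_def] at hb
    rw [List.head?_append, hb]; rfl
  · intro a ha b hb
    simp only [List.head?_cons, Option.mem_def, Option.some.injEq] at hb
    subst hb
    rcases List.eq_nil_or_concat' L with rfl | ⟨L, c, rfl⟩
    · simp at ha; simp [ha]
    · rw [← List.cons_append, List.getLast?_concat, Option.mem_def, Option.some.injEq] at ha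
      subst ha
      exact h1.2.2 c (by simp) x (by simp)

lemma isConj_mk_rotate (L : List (α × Bool)) (k : ℕ) :
    IsConj (FreeGroup.mk L) (FreeGroup.mk (L.rotate k)) := by
  induction k with
  | zero => rw [List.rotate_zero]
  | succ k ih =>
    refine ih.trans ?_
    rw [← List.rotate_rotate]
    generalize L.rotate k = L
    cases L with
    | nil => rw [List.rotate_nil]
    | cons a L =>
      rw [isConj_iff]
      refine ⟨(FreeGroup.mk [a])⁻¹, ?_⟩
      have e : FreeGroup.mk (a :: L) = FreeGroup.mk [a] * FreeGroup.mk L := by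
        rw [FreeGroup.mul_mk]; rfl
      simp only [List.rotate_cons_succ, List.rotate_zero]
      rw [e, ← FreeGroup.mul_mk]
      group

variable [DecidableEq α]

/-- Induction on the conjugator `l`. If its first letter cancels against either end of `L`, then `L`
is rotated by one letter and `l` becomes shorter. If `L` is empty, so is `L'`. Otherwise `l⁻¹ L l`
is reduced as written, and its two ends are inverse letters, which cannot happen for the cyclically
reduced `L'`. -/
lemma isRotated_of_conj_mk {l : List (α × Bool)} (hl : FreeGroup.IsReduced l)
    {L L' : List (α × Bool)} (hL : FreeGroup.IsCyclicallyReduced L)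
    (hL' : FreeGroup.IsCyclicallyReduced L')
    (h : FreeGroup.mk L' = (FreeGroup.mk l)⁻¹ * FreeGroup.mk L * FreeGroup.mk l) : L ~r L' := by
  have key : ∀ {L₁ L₂ : List (α × Bool)}, FreeGroup.IsReduced L₁ → FreeGroup.IsReduced L₂ →
      FreeGroup.mk L₁ = FreeGroup.mk L₂ → L₁ = L₂ := by
    intro L₁ L₂ h1 h2 h
    have := FreeGroup.reduce.sound h
    rwa [h1.reduce_eq, h2.reduce_eq] at this
  induction l generalizing L with
  | nil =>
    rw [← FreeGroup.one_eq_mk, inv_one, one_mul, mul_one] at h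
    rw [key hL'.1 hL.1 h]
  | cons x l ih =>
    have hl' : FreeGroup.IsReduced l := hl.infix (List.suffix_cons x l).isInfix
    have hx : FreeGroup.mk (x :: l) = FreeGroup.mk [x] * FreeGroup.mk l := by
      rw [FreeGroup.mul_mk]; rfl
    by_cases h1 : ∃ L₁, L = x :: L₁
    · obtain ⟨L₁, rfl⟩ := h1
      have : x :: L₁ ~r L₁ ++ [x] := ⟨1, by simp⟩
      refine this.trans (ih hl' (cyclicallyReduced_rotate hL) ?_)
      have e : FreeGroup.mk (x :: L₁) = FreeGroup.mk [x] * FreeGroup.mk L₁ := by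
        rw [FreeGroup.mul_mk]; rfl
      rw [h, hx, e, ← FreeGroup.mul_mk]
      group
    by_cases h2 : ∃ L₁, L = L₁ ++ [letterInv x]
    · obtain ⟨L₁, rfl⟩ := h2
      have : letterInv x :: L₁ ~r L₁ ++ [letterInv x] := ⟨1, by simp⟩
      refine this.symm.trans (ih hl' (cyclicallyReduced_rotate_back hL) ?_)
      have e : FreeGroup.mk (letterInv x :: L₁) =
          FreeGroup.mk [letterInv x] * FreeGroup.mk L₁ := by
        rw [FreeGroup.mul_mk]; rfl
      rw [h, hx, e, ← FreeGroup.mul_mk, mk_letterInv]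
      group
    by_cases h3 : L = []
    · subst h3
      rw [← FreeGroup.one_eq_mk, mul_one, inv_mul_cancel, FreeGroup.one_eq_mk] at h
      rw [key hL'.1 FreeGroup.IsReduced.nil h]
    exfalso
    have hred : FreeGroup.IsReduced (FreeGroup.invRev (x :: l) ++ (L ++ (x :: l))) := by
      rw [FreeGroup.IsReduced, List.isChain_append, List.isChain_append]
      refine ⟨?_, ⟨hL.1, hl, ?_⟩, ?_⟩
      · have : FreeGroup.invRev (x :: l) = ((FreeGroup.mk (x :: l))⁻¹).toWord := by
          rw [FreeGroup.inv_mk, FreeGroup.toWord_mk, FreeGroup.reduce_invRev, hl.reduce_eq]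
        rw [this]
        exact FreeGroup.isReduced_toWord
      · intro a ha b hb
        simp only [List.head?_cons, Option.mem_def, Option.some.injEq] at hb
        subst hb
        by_contra hab
        have := eq_letterInv_iff.mpr hab
        refine h2 ⟨L.dropLast, ?_⟩
        rw [this]
        have : letterInv (letterInv a) = a := by simp [letterInv]
        rw [this]
        exact (List.dropLast_append_getLast? _ ha).symm
      · intro a ha b hb
        have hla : a = letterInv x := by
          rw [invRev_eq, List.map_cons, List.reverse_cons, List.getLast?_concat, Option.mem_def,
            Option.some.injEq] at ha
          exact ha.symm
        by_contra hab
        obtain ⟨c, L₁, rfl⟩ := List.exists_cons_of_ne_nil h3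
        simp only [List.cons_append, List.head?_cons, Option.mem_def, Option.some.injEq] at hb
        subst hb
        have := eq_letterInv_iff.mpr hab
        rw [hla] at this
        exact h1 ⟨L₁, by rw [this]; simp [letterInv]⟩
    have heq := key hL'.1 hred (by
      rw [h, FreeGroup.inv_mk, FreeGroup.mul_mk, FreeGroup.mul_mk, List.append_assoc])
    -- With `z` the last letter of the conjugator, `L'` begins with the inverse of `z` and ends with
    -- `z`.
    obtain ⟨l₂, z, hz⟩ := (List.eq_nil_or_concat' (x :: l)).resolve_left (by simp)
    rw [hz, invRev_eq, List.map_append, List.reverse_append] at heq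
    simp only [List.map_cons, List.map_nil, List.reverse_cons, List.reverse_nil, List.nil_append,
      List.cons_append] at heq
    rw [← List.append_assoc, ← List.append_assoc, ← List.cons_append] at heq
    rw [heq, FreeGroup.isCyclicallyReduced_cons_append_iff] at hL'
    have := hL'.2 rfl
    simp [letterInv] at this

lemma mk_reduceCyclically_conj (x : FreeGroup α) :
    IsConj x (FreeGroup.mk (FreeGroup.reduceCyclically x.toWord)) := by
  have := FreeGroup.reduceCyclically.conj_conjugator_reduceCyclically x.toWord
  rw [isConj_comm, isConj_iff]
  refine ⟨FreeGroup.mk (FreeGroup.reduceCyclically.conjugator x.toWord), ?_⟩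
  rw [FreeGroup.inv_mk, FreeGroup.mul_mk, FreeGroup.mul_mk, this, FreeGroup.mk_toWord]

/-- Conjugacy in a free group, through the rotations of the cyclic reduction. -/
lemma isConj_iff_rotate {x y : FreeGroup α} : IsConj x y ↔
    ∃ i ≤ (FreeGroup.reduceCyclically y.toWord).length,
      FreeGroup.mk ((FreeGroup.reduceCyclically y.toWord).rotate i) =
        FreeGroup.mk (FreeGroup.reduceCyclically x.toWord) := by
  have hcx := FreeGroup.reduceCyclically.isCyclicallyReduced (FreeGroup.isReduced_toWord (x := x))
  have hcy := FreeGroup.reduceCyclically.isCyclicallyReduced (FreeGroup.isReduced_toWord (x := y))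
  constructor
  · intro h
    have h1 := (mk_reduceCyclically_conj y).symm.trans (h.symm.trans (mk_reduceCyclically_conj x))
    obtain ⟨c, hc⟩ := isConj_iff.mp h1
    obtain ⟨i, hi, e⟩ := List.isRotated_iff_mod.mp
      (isRotated_of_conj_mk (l := c⁻¹.toWord) FreeGroup.isReduced_toWord hcy hcx
        (by rw [FreeGroup.mk_toWord, inv_inv, hc]))
    exact ⟨i, hi, by rw [e]⟩
  · rintro ⟨k, -, hk⟩
    refine (mk_reduceCyclically_conj x).trans (IsConj.trans ?_ (mk_reduceCyclically_conj y).symm)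
    rw [← hk, isConj_comm]
    exact isConj_mk_rotate _ k

/-- The number of letters that cancel when the two ends of a word are compared. -/
def peelCount : List (α × Bool) → List (α × Bool) → ℕ
  | a :: l, b :: l' => if b = letterInv a then peelCount l l' + 1 else 0
  | _, _ => 0

lemma peelCount_append (p l l' : List (α × Bool)) :
    peelCount (p ++ l) (p.map letterInv ++ l') = p.length + peelCount l l' := by
  induction p with
  | nil => simp
  | cons a p ih => simp [peelCount, ih]; omega

/-- Cyclic reduction by cutting off as many letters at both ends as cancel. -/
lemma peel_eq_reduceCyclically {l : List (α × Bool)} (hl : FreeGroup.IsReduced l) :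
    ((l.drop (peelCount l l.reverse)).reverse.drop (peelCount l l.reverse)).reverse =
      FreeGroup.reduceCyclically l := by
  have h := FreeGroup.reduceCyclically.conj_conjugator_reduceCyclically l
  have hc := FreeGroup.reduceCyclically.isCyclicallyReduced hl
  generalize FreeGroup.reduceCyclically l = c at h hc
  generalize FreeGroup.reduceCyclically.conjugator l = p at h
  cases c with
  | nil =>
    have h1 : l = [] := by
      have := FreeGroup.reduce_invRev_left_cancel (L := FreeGroup.invRev p)
      rw [FreeGroup.invRev_invRev] at this
      rw [List.append_nil] at h
      rw [h, hl.reduce_eq] at this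
      exact this
    subst h1
    simp
  | cons a c =>
    -- The word is `p c p⁻¹` with a nonempty cyclically reduced core: the comparison with its
    -- reverse runs through `p` and stops at once at the core, whose end letters do not cancel.
    have hj : peelCount l l.reverse = p.length := by
      rw [← h, invRev_eq, List.reverse_append, List.reverse_append, List.reverse_reverse,
        List.append_assoc, peelCount_append]
      obtain ⟨d, b, hb⟩ := (List.eq_nil_or_concat' (a :: c)).resolve_left (by simp)
      rw [hb, List.reverse_append, List.reverse_singleton, List.singleton_append, ← hb,
        List.cons_append, List.cons_append, peelCount, if_neg]
      · rfl
      · intro hba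
        have h2 := hc.2 b (by rw [hb]; simp) a (by simp)
        rw [hba] at h2
        have := h2 rfl
        simp [letterInv] at this
    have h1 : l.drop p.length = (a :: c) ++ FreeGroup.invRev p := by
      rw [← h, List.append_assoc, List.drop_left]
    rw [hj, h1, List.reverse_append, invRev_eq, List.reverse_reverse]
    have h2 : p.length = (p.map letterInv).length := by simp
    rw [h2, List.drop_left, List.reverse_reverse]

end Conjugacy

end Miller

/-! ### Structured stack programs with running times, compiled to Turing machines -/

namespace Miller

/-- Structured programs on finitely many stacks. The command `act k f` pops the top letter of the
stack `k` and pushes back a list, `loop b p` is a while loop. -/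
inductive Prog (κ Γ σ : Type) : Type
  | act (k : κ) (f : σ → Option Γ → σ × List Γ)
  | seq (p q : Prog κ Γ σ)
  | ite (b : σ → Bool) (p q : Prog κ Γ σ)
  | loop (b : σ → Bool) (p : Prog κ Γ σ)

namespace Prog

variable {κ Γ σ : Type}

section Semantics

variable [DecidableEq κ]

/-- `Run p c c' t`: the program `p` leads from the configuration `c` to `c'` in at most `t` steps. -/
inductive Run : Prog κ Γ σ → σ × (κ → List Γ) → σ × (κ → List Γ) → ℕ → Prop
  | act (k : κ) (f : σ → Option Γ → σ × List Γ) (v : σ) (S : κ → List Γ) :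
      Run (act k f) (v, S) ((f v (S k).head?).1,
        Function.update S k ((f v (S k).head?).2 ++ (S k).tail)) 1
  | seq {p q : Prog κ Γ σ} {c c' c'' : σ × (κ → List Γ)} {t t' : ℕ} :
      Run p c c' t → Run q c' c'' t' → Run (seq p q) c c'' (t + t')
  | iteTrue {b : σ → Bool} {p q : Prog κ Γ σ} {c c' : σ × (κ → List Γ)} {t : ℕ} :
      b c.1 = true → Run p c c' t → Run (ite b p q) c c' (t + 1)
  | iteFalse {b : σ → Bool} {p q : Prog κ Γ σ} {c c' : σ × (κ → List Γ)} {t : ℕ} :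
      b c.1 = false → Run q c c' t → Run (ite b p q) c c' (t + 1)
  | loopTrue {b : σ → Bool} {p : Prog κ Γ σ} {c c' c'' : σ × (κ → List Γ)} {t t' : ℕ} :
      b c.1 = true → Run p c c' t → Run (loop b p) c' c'' t' → Run (loop b p) c c'' (t + t' + 1)
  | loopFalse {b : σ → Bool} {p : Prog κ Γ σ} {c : σ × (κ → List Γ)} :
      b c.1 = false → Run (loop b p) c c 1
  | mono {p : Prog κ Γ σ} {c c' : σ × (κ → List Γ)} {t t' : ℕ} :
      Run p c c' t → t ≤ t' → Run p c c' t'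

end Semantics

/-- The labels of the machine that executes a program. -/
def Label : Prog κ Γ σ → Type
  | act _ _ => Unit
  | seq p q => Label p ⊕ Label q
  | ite _ p q => Option (Label p ⊕ Label q)
  | loop _ p => Option (Label p)

lemma finite_label (p : Prog κ Γ σ) : Finite (Label p) := by
  induction p with
  | act => exact inferInstanceAs (Finite Unit)
  | seq p q hp hq => exact inferInstanceAs (Finite (Label p ⊕ Label q))
  | ite b p q hp hq => exact inferInstanceAs (Finite (Option (Label p ⊕ Label q)))
  | loop b p hp => exact inferInstanceAs (Finite (Option (Label p)))

/-- The first label of a program. -/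
def entry : (p : Prog κ Γ σ) → Label p
  | act _ _ => ()
  | seq p _ => Sum.inl (entry p)
  | ite _ _ _ => none
  | loop _ _ => none

open Turing

/-- Push a list of length at most `N`, computed from the internal state. -/
def pushAll {Λ τ : Type} [Inhabited Γ] (k : κ) : ℕ → (τ → List Γ) →
    TM2.Stmt (fun _ : κ => Γ) Λ τ → TM2.Stmt (fun _ : κ => Γ) Λ τ
  | 0, _, q => q
  | N + 1, g, q => TM2.Stmt.branch (fun v => (g v).isEmpty) q
      (TM2.Stmt.push k (fun v => (g v).getLastD default) (pushAll k N (fun v => (g v).dropLast) q))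

/-- The list is pushed from its last letter on, so that its head ends on top. A machine statement
must have fixed length, hence `N` conditional pushes; `default` is never pushed, because a push is
reached only for a nonempty list. -/
lemma stepAux_pushAll {Λ τ : Type} [Inhabited Γ] [DecidableEq κ] (k : κ) (N : ℕ)
    (g : τ → List Γ) (q : TM2.Stmt (fun _ : κ => Γ) Λ τ) (v : τ) (S : κ → List Γ)
    (h : (g v).length ≤ N) :
    TM2.stepAux (pushAll k N g q) v S = TM2.stepAux q v (Function.update S k (g v ++ S k)) := by
  induction N generalizing g S with
  | zero =>
    have : g v = [] := List.length_eq_zero_iff.mp (by omega)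
    simp [pushAll, this]
  | succ N ih =>
    rcases List.eq_nil_or_concat' (g v) with h0 | ⟨l, a, hl⟩
    · simp [pushAll, h0]
    · have h1 : (g v).isEmpty = false := by simp [hl]
      have h2 : (g v).getLastD default = a := by simp [hl]
      have h3 : (g v).dropLast = l := by simp [hl]
      rw [pushAll, TM2.stepAux, h1, cond_false, TM2.stepAux, ih _ _ (by rw [h3]; simp [hl] at h; omega)]
      rw [h2, h3, hl]
      simp

/-- The machine code of a program, with its labels embedded by `e` and with the exit label `x`. -/
noncomputable def code [Fintype σ] [Fintype Γ] [Inhabited Γ] {Λ : Type} :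
    (p : Prog κ Γ σ) → (Label p → Λ) → Λ → Label p →
      TM2.Stmt (fun _ : κ => Γ) Λ (σ × Option Γ)
  | act k f, _, x => fun _ =>
      TM2.Stmt.pop k (fun v o => (v.1, o))
        (pushAll k (Finset.univ.sup fun v : σ × Option Γ => (f v.1 v.2).2.length)
          (fun v => (f v.1 v.2).2)
          (TM2.Stmt.load (fun v => ((f v.1 v.2).1, none)) (TM2.Stmt.goto fun _ => x)))
  | seq p q, e, x => fun l => match l with
      | Sum.inl l => code p (fun l => e (Sum.inl l)) (e (Sum.inr (entry q))) l
      | Sum.inr l => code q (fun l => e (Sum.inr l)) x l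
  | ite b p q, e, x => fun l => match l with
      | none => TM2.Stmt.branch (fun v => b v.1)
          (TM2.Stmt.goto fun _ => e (some (Sum.inl (entry p))))
          (TM2.Stmt.goto fun _ => e (some (Sum.inr (entry q))))
      | some (Sum.inl l) => code p (fun l => e (some (Sum.inl l))) x l
      | some (Sum.inr l) => code q (fun l => e (some (Sum.inr l))) x l
  | loop b p, e, x => fun l => match l with
      | none => TM2.Stmt.branch (fun v => b v.1)
          (TM2.Stmt.goto fun _ => e (some (entry p))) (TM2.Stmt.goto fun _ => x)
      | some l => code p (fun l => e (some l)) (e none) l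

/-- The configuration `b` is reached from `a` in at most `t` steps. -/
def Steps {α : Type} (f : α → Option α) (a b : α) (t : ℕ) : Prop :=
  ∃ s ≤ t, (flip bind f)^[s] (some a) = some b

lemma Steps.trans {α : Type} {f : α → Option α} {a b c : α} {t t' : ℕ} (h : Steps f a b t)
    (h' : Steps f b c t') : Steps f a c (t + t') := by
  obtain ⟨s, hs, h⟩ := h
  obtain ⟨s', hs', h'⟩ := h'
  exact ⟨s' + s, by omega, by rw [Function.iterate_add_apply, h, h']⟩

lemma Steps.single {α : Type} {f : α → Option α} {a b : α} (h : f a = some b) : Steps f a b 1 :=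
  ⟨1, le_refl 1, h⟩

lemma Steps.mono {α : Type} {f : α → Option α} {a b : α} {t t' : ℕ} (h : Steps f a b t)
    (ht : t ≤ t') : Steps f a b t' := by
  obtain ⟨s, hs, h⟩ := h
  exact ⟨s, hs.trans ht, h⟩

lemma dite_mpr_eq_update [DecidableEq κ] (i k : κ) (w : List Γ) (h : k = i → List Γ = List Γ) :
    (if hk : k = i then (h hk).mpr w else []) = Function.update (fun _ => []) i w k := by
  by_cases hk : k = i
  · subst hk
    simp
  · simp [hk]

variable [Fintype σ] [Fintype Γ] [Inhabited Γ] [DecidableEq κ]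

/-- The code of a subprogram is parametrized by the embedding of its labels and by its exit label.
The induction hypotheses then apply with the exit of one piece equal to the entry of the next, or to
the head of the loop. -/
theorem Run.steps {p : Prog κ Γ σ} {c c' : σ × (κ → List Γ)} {t : ℕ} (h : Run p c c' t)
    {Λ : Type} (M : Λ → TM2.Stmt (fun _ : κ => Γ) Λ (σ × Option Γ)) (e : Label p → Λ) (x : Λ)
    (hM : ∀ l, M (e l) = code p e x l) :
    Steps (TM2.step M) ⟨some (e (entry p)), (c.1, none), c.2⟩ ⟨some x, (c'.1, none), c'.2⟩ t := by
  induction h generalizing x with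
  | act k f v S =>
    refine Steps.single ?_
    rw [TM2.step, hM, code, TM2.stepAux, stepAux_pushAll]
    · simp
    -- There are finitely many states and letters, so one bound covers every list that this command
    -- can push.
    · exact Finset.le_sup (f := fun v : σ × Option Γ => (f v.1 v.2).2.length)
        (Finset.mem_univ (v, (S k).head?))
  | seq _ _ ih1 ih2 =>
    exact (ih1 _ _ fun l => hM (Sum.inl l)).trans (ih2 _ _ fun l => hM (Sum.inr l))
  | @iteTrue b p q c c' t hb _ ih =>
    rw [Nat.add_comm]
    refine (Steps.single ?_).trans (ih _ _ fun l => hM (some (Sum.inl l)))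
    rw [TM2.step, hM, entry, code]
    simp [hb]
  | @iteFalse b p q c c' t hb _ ih =>
    rw [Nat.add_comm]
    refine (Steps.single ?_).trans (ih _ _ fun l => hM (some (Sum.inr l)))
    rw [TM2.step, hM, entry, code]
    simp [hb]
  | @loopTrue b p c c' c'' t t' hb _ _ ih1 ih2 =>
    rw [Nat.add_comm, ← Nat.add_assoc, Nat.add_comm 1]
    refine Steps.mono ((Steps.single ?_).trans ((ih1 _ _ fun l => hM (some l)).trans (ih2 e x hM)))
      (by omega)
    rw [TM2.step, hM, entry, code]
    simp [hb]
  | @loopFalse b p c hb =>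
    refine Steps.single ?_
    rw [TM2.step, hM, entry, code]
    simp [hb]
  | mono _ ht ih => exact (ih e x hM).mono ht

/-- The machine that executes a program. -/
noncomputable def machine [Fintype κ] (p : Prog κ Γ σ) (v : σ) (i o : κ) : FinTM2 :=
  letI : Fintype (Option (Label p)) :=
    haveI := finite_label p
    Fintype.ofFinite _
  { k₀ := i
    k₁ := o
    Γ := fun _ => Γ
    Λ := Option (Label p)
    main := some (entry p)
    σ := σ × Option Γ
    initialState := (v, none)
    Γk₀Fin := inferInstance
    m := fun l => match l with
      | none => TM2.Stmt.halt
      | some l => code p some none l }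

/-- A halting configuration must have the initial internal state and empty stacks apart from the
output. Hence the program is required to clean up after itself; the extra step is the halting
instruction. -/
theorem exists_computableInTime [Fintype κ] (p : Prog κ Γ σ) (v : σ) (i o : κ)
    (f : List Γ → List Γ) (T : ℕ → ℕ)
    (h : ∀ w, Run p (v, Function.update (fun _ => []) i w)
      (v, Function.update (fun _ => []) o (f w)) (T w.length)) :
    ∃ M : TM2ComputableInTime (fun w : List Γ => w) (fun w : List Γ => w) f,
      M.time = fun k => T k + 1 := by
  have key : ∀ w : List Γ, ∃ s ≤ T w.length + 1, (flip bind (machine p v i o).step)^[s]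
      (some (initList (machine p v i o) w)) = some (haltList (machine p v i o) (f w)) := by
    intro w
    have h1 := (h w).steps (machine p v i o).m some none fun l => rfl
    have h2 : Steps (TM2.step (machine p v i o).m)
        ⟨some none, (v, none), Function.update (fun _ => []) o (f w)⟩
        ⟨none, (v, none), Function.update (fun _ => []) o (f w)⟩ 1 := Steps.single rfl
    have h3 := h1.trans h2
    have e1 : initList (machine p v i o) w =
        (⟨some (some (entry p)), (v, none), Function.update (fun _ => []) i w⟩ :
          TM2.Cfg (fun _ : κ => Γ) (Option (Label p)) (σ × Option Γ)) := by
      unfold initList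
      congr 1
      funext k
      exact dite_mpr_eq_update i k w _
    have e2 : haltList (machine p v i o) (f w) =
        (⟨none, (v, none), Function.update (fun _ => []) o (f w)⟩ :
          TM2.Cfg (fun _ : κ => Γ) (Option (Label p)) (σ × Option Γ)) := by
      unfold haltList
      congr 1
      funext k
      exact dite_mpr_eq_update o k (f w) _
    rw [e1, e2]
    exact h3
  choose s hs hs' using key
  refine ⟨{ tm := machine p v i o
            inputAlphabet := Equiv.refl _
            outputAlphabet := Equiv.refl _
            time := fun k => T k + 1
            outputsFun := fun w => ⟨⟨s w, ?_⟩, hs w⟩ }, rfl⟩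
  have e1 : ∀ l : List Γ, l.map (Equiv.refl Γ).invFun = l := fun l => List.map_id l
  have := hs' w
  exact Eq.trans (congrArg (fun l => (flip bind (machine p v i o).step)^[s w]
    (some (initList (machine p v i o) l))) (e1 w))
    (this.trans (congrArg (fun l => some (haltList (machine p v i o) l)) (e1 (f w)).symm))

end Prog

end Miller

/-! ### Programs for reduced words: loops over a stack and multiplication by homomorphic images -/

namespace Miller

section Words

variable {n m : ℕ}

noncomputable instance decidableEqGen : DecidableEq (Gen n m) := Classical.decEq _

instance finiteGen : Finite (Gen n m) := by
  refine Finite.of_surjective (fun x : Option (Fin n ⊕ Fin m ⊕ Fin n) => match x with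
    | none => Gen.q
    | some (Sum.inl j) => Gen.s j
    | some (Sum.inr (Sum.inl i)) => Gen.t i
    | some (Sum.inr (Sum.inr j)) => Gen.d j) ?_
  rintro (_ | j | i | j)
  exacts [⟨none, rfl⟩, ⟨some (Sum.inl j), rfl⟩, ⟨some (Sum.inr (Sum.inl i)), rfl⟩,
    ⟨some (Sum.inr (Sum.inr j)), rfl⟩]

noncomputable instance fintypeGen : Fintype (Gen n m) := Fintype.ofFinite _

/-- Letters `x^{±1}`. -/
abbrev Letter (n m : ℕ) : Type := Gen n m × Bool

instance inhabitedLetter : Inhabited (Letter n m) := ⟨(Gen.q, true)⟩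

/-- The effect on the top letter of a reduced word of multiplying by a letter from the left. -/
noncomputable def cancelPush (x : Letter n m) : Option (Letter n m) → List (Letter n m)
  | none => [x]
  | some y => if y = letterInv x then [] else [x, y]

/-- Left multiplication by a letter changes a reduced word only at its first letter, so it is a
single action on the stack. -/
lemma cancelPush_toWord (x : Letter n m) (w : FreeGroup (Gen n m)) :
    cancelPush x w.toWord.head? ++ w.toWord.tail = (FreeGroup.mk [x] * w).toWord := by
  rw [← FreeGroup.mk_toWord (x := w), FreeGroup.mul_mk, FreeGroup.toWord_mk, FreeGroup.toWord_mk,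
    FreeGroup.reduce_toWord, List.singleton_append, FreeGroup.reduce.cons, FreeGroup.reduce_toWord]
  cases w.toWord with
  | nil => rfl
  | cons y l =>
    have : y = letterInv x ↔ x.1 = y.1 ∧ x.2 = !y.2 := by
      rcases x with ⟨x, b⟩
      rcases y with ⟨y, c⟩
      simp only [letterInv, Prod.mk.injEq, eq_comm (a := x)]
      cases b <;> cases c <;> simp
    by_cases h : y = letterInv x
    · simp [cancelPush, h, letterInv]
    · simp only [cancelPush, List.head?_cons, h, if_false]
      rw [if_neg (fun h' => h (this.mpr h'))]
      rfl

/-- The internal states of the programs: three letter registers and two flags. -/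
structure St (n m : ℕ) : Type where
  reg : Option (Letter n m) := none
  fst : Option (Letter n m) := none
  lst : Option (Letter n m) := none
  sgn : Option Bool := none
  flag : Bool := false

instance finiteSt : Finite (St n m) :=
  Finite.of_injective (fun v => (v.reg, v.fst, v.lst, v.sgn, v.flag)) fun v w h => by
    cases v; cases w; simp_all

noncomputable instance fintypeSt : Fintype (St n m) := Fintype.ofFinite _

/-- The stacks. -/
inductive Stk : Type
  | I | U | W | T | X | P | Y | Q | Z | C
  deriving DecidableEq

instance fintypeStk : Fintype Stk :=
  ⟨{Stk.I, Stk.U, Stk.W, Stk.T, Stk.X, Stk.P, Stk.Y, Stk.Q, Stk.Z, Stk.C}, fun x => by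
    cases x <;> decide⟩

/-- The programs that are used. -/
abbrev Pg (n m : ℕ) : Type := Prog Stk (Letter n m) (St n m)

/-- Contents of the stacks. -/
abbrev Stacks (n m : ℕ) : Type := Stk → List (Letter n m)

namespace Prog

open Function (update)

lemma Run.congr {p : Pg n m} {c : St n m × Stacks n m} {v v' : St n m} {S S' : Stacks n m}
    {t t' : ℕ} (h : Run p c (v, S) t) (hv : v = v') (hS : S = S') (ht : t ≤ t') :
    Run p c (v', S') t' := by
  subst hv hS
  exact h.mono ht

/-- Change the internal state. -/
def set (f : St n m → St n m) : Pg n m := act Stk.I fun v o => (f v, o.toList)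

lemma run_set (f : St n m → St n m) (v : St n m) (S : Stacks n m) :
    Run (set f) (v, S) (f v, S) 1 := by
  have := Run.act Stk.I (fun v o => (f v, o.toList)) v S
  refine Run.congr this rfl ?_ le_rfl
  funext j
  by_cases hj : j = Stk.I
  · subst hj
    rw [Function.update_self]
    cases S Stk.I <;> rfl
  · rw [Function.update_of_ne hj]

/-- Push a word. -/
def push (k : Stk) (g : St n m → List (Letter n m)) : Pg n m :=
  act k fun v o => (v, g v ++ o.toList)

lemma run_push (k : Stk) (g : St n m → List (Letter n m)) (v : St n m) (S : Stacks n m) :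
    Run (push k g) (v, S) (v, update S k (g v ++ S k)) 1 := by
  have := Run.act k (fun v o => (v, g v ++ o.toList)) v S
  refine Run.congr this rfl ?_ le_rfl
  congr 1
  cases S k <;> simp

/-- Pop a letter into the register. -/
def pop (k : Stk) : Pg n m := act k fun v o => ({ v with reg := o }, [])

lemma run_pop (k : Stk) (v : St n m) (S : Stacks n m) :
    Run (pop k) (v, S) ({ v with reg := (S k).head? }, update S k (S k).tail) 1 :=
  Run.act k (fun (v : St n m) o => (({ v with reg := o } : St n m), [])) v S

/-- Multiply a reduced word by a word of length at most `N` from the left. -/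
noncomputable def mulWord (k : Stk) : ℕ → (St n m → List (Letter n m)) → Pg n m
  | 0, _ => set id
  | N + 1, g => seq (mulWord k N fun v => (g v).tail) (act k fun v o => (v,
      match (g v).head? with
      | none => o.toList
      | some x => cancelPush x o))

lemma run_mulWord (k : Stk) (N : ℕ) (g : St n m → List (Letter n m)) {v : St n m}
    {S : Stacks n m} {w : FreeGroup (Gen n m)} (hg : (g v).length ≤ N) (hS : S k = w.toWord) :
    Run (mulWord k N g) (v, S) (v, update S k (FreeGroup.mk (g v) * w).toWord) (N + 1) := by
  induction N generalizing g with
  | zero =>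
    have : g v = [] := List.length_eq_zero_iff.mp (by omega)
    refine (run_set id v S).congr rfl ?_ le_rfl
    rw [this, ← FreeGroup.one_eq_mk, one_mul, ← hS, Function.update_eq_self]
  | succ N ih =>
    refine (Run.seq (ih _ (by rw [List.length_tail]; omega)) (Run.act k _ v _)).congr ?_ ?_ le_rfl
    · rfl
    · rw [Function.update_idem, Function.update_self]
      congr 1
      cases hg' : g v with
      | nil =>
        simp only [List.head?_nil, List.tail_nil]
        cases (FreeGroup.mk [] * w).toWord <;> rfl
      | cons x l =>
        simp only [List.head?_cons, List.tail_cons]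
        rw [cancelPush_toWord, ← mul_assoc, FreeGroup.mul_mk]
        rfl

/-- Pop the letters of a stack one by one and process them. -/
def forEach (k : Stk) (body : Pg n m) : Pg n m :=
  seq (pop k) (loop (fun v => v.reg.isSome) (seq body (pop k)))

lemma run_forEach_state {k : Stk} {body : Pg n m} {L : List (Letter n m)}
    (V : List (Letter n m) → St n m)
    (G : List (Letter n m) → List (Letter n m) → Stacks n m) (t : Letter n m → ℕ)
    (hk : ∀ d l, G d l k = l)
    (hb : ∀ d x l, d.reverse ++ x :: l = L → ∃ r, Run body
      ({ V d with reg := some x }, update (G d (x :: l)) k l)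
      ({ V (x :: d) with reg := r }, G (x :: d) l) (t x)) :
    Run (forEach k body) (V [], G [] L) ({ V L.reverse with reg := none }, G L.reverse [])
      ((L.map fun x => t x + 2).sum + 2) := by
  have key : ∀ l d, d.reverse ++ l = L → Run (loop (fun v => v.reg.isSome) (seq body (pop k)))
      ({ V d with reg := l.head? }, update (G d l) k l.tail)
      ({ V L.reverse with reg := none }, G L.reverse []) ((l.map fun x => t x + 2).sum + 1) := by
    intro l
    induction l with
    | nil =>
      intro d hd
      have : d = L.reverse := by rw [← hd]; simp
      refine (Run.loopFalse (by rfl)).congr (by rw [this]; rfl) ?_ (by simp)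
      rw [this]
      funext j
      by_cases hj : j = k
      · subst hj; simp [hk]
      · simp [hj]
    | cons x l ih =>
      intro d hd
      obtain ⟨r, hr⟩ := hb d x l hd
      have h2 := ih (x :: d) (by rw [← hd]; simp)
      have h3 := run_pop k ({ V (x :: d) with reg := r }) (G (x :: d) l)
      rw [hk] at h3
      refine (Run.loopTrue (by rfl) (Run.seq hr h3) h2).mono ?_
      simp only [List.map_cons, List.sum_cons]
      omega
  have h1 := run_pop k (V []) (G [] L)
  rw [hk] at h1
  exact (Run.seq h1 (key L [] rfl)).mono (by omega)

lemma run_forEach {k : Stk} {body : Pg n m} {v : St n m} {L : List (Letter n m)}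
    (G : List (Letter n m) → List (Letter n m) → Stacks n m) (t : Letter n m → ℕ)
    (hk : ∀ d l, G d l k = l)
    (hb : ∀ d x l, d.reverse ++ x :: l = L → ∃ r, Run body
      ({ v with reg := some x }, update (G d (x :: l)) k l) ({ v with reg := r }, G (x :: d) l)
        (t x)) :
    Run (forEach k body) (v, G [] L) ({ v with reg := none }, G L.reverse [])
      ((L.map fun x => t x + 2).sum + 2) :=
  run_forEach_state (fun _ => v) G t hk hb

/-- Move a stack onto another one. -/
def mv (k k' : Stk) : Pg n m := forEach k (push k' fun v => v.reg.toList)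

lemma run_mv {k k' : Stk} (hk : k ≠ k') (v : St n m) (S : Stacks n m) :
    Run (mv k k') (v, S)
      ({ v with reg := none }, update (update S k []) k' ((S k).reverse ++ S k'))
      (3 * (S k).length + 2) := by
  have := run_forEach (k := k) (body := push k' fun v => v.reg.toList) (v := v) (L := S k)
    (fun d l => update (update S k l) k' (d ++ S k')) (fun _ => 1) (by simp [hk])
    (fun d x l _ => ⟨some x, (run_push k' _ _ _).congr rfl (by
      funext j
      by_cases h1 : j = k'
      · subst h1; simp [hk.symm]
      · by_cases h2 : j = k
        · subst h2; simp [hk]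
        · simp [h1, h2]) le_rfl⟩)
  have e : update (update S k (S k)) k' ([] ++ S k') = S := by simp
  rw [e] at this
  refine this.congr rfl rfl ?_
  simp
  omega

/-- Empty a stack. -/
def clear (k : Stk) : Pg n m := forEach k (set id)

lemma run_clear (k : Stk) (v : St n m) (S : Stacks n m) :
    Run (clear k) (v, S) ({ v with reg := none }, update S k []) (3 * (S k).length + 2) := by
  have := run_forEach (k := k) (body := set id) (v := v) (L := S k)
    (fun _ l => update S k l) (fun _ => 1) (by simp)
    (fun d x l _ => ⟨some x, (run_set id _ _).congr rfl (by simp) le_rfl⟩)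
  rw [Function.update_eq_self] at this
  refine this.congr rfl rfl ?_
  simp
  omega

/-- Move a stack onto another one, and multiply a reduced word on a third stack from the left by a
word for each letter. -/
noncomputable def scan (k k' z : Stk) (N : ℕ) (g : St n m → Letter n m → List (Letter n m)) :
    Pg n m :=
  forEach k (seq (push k' fun v => v.reg.toList) (mulWord z N fun v => v.reg.elim [] (g v)))

lemma run_scan {k k' z : Stk} (hk : k ≠ k') (hz : k ≠ z) (hz' : k' ≠ z) {N : ℕ}
    {g : St n m → Letter n m → List (Letter n m)} {v : St n m} {S : Stacks n m}
    {w : FreeGroup (Gen n m)} (γ : Letter n m → FreeGroup (Gen n m))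
    (hg : ∀ x, g { v with reg := some x } x = (γ x).toWord) (hN : ∀ x, (γ x).norm ≤ N)
    (hS : S z = w.toWord) :
    Run (scan k k' z N g) (v, S)
      ({ v with reg := none }, update (update (update S k []) k' ((S k).reverse ++ S k')) z
        (((S k).reverse.map γ).prod * w).toWord)
      ((N + 4) * (S k).length + 2) := by
  have := run_forEach (k := k)
    (body := seq (push k' fun v => v.reg.toList) (mulWord z N fun v => v.reg.elim [] (g v)))
    (v := v) (L := S k)
    (fun d l => update (update (update S k l) k' (d ++ S k')) z ((d.map γ).prod * w).toWord)
    (fun _ => N + 2) (by simp [hk, hz])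
    (fun d x l _ => ⟨some x, by
      refine (Run.seq (run_push k' _ _ _) (run_mulWord z N _ (w := (d.map γ).prod * w) ?_ ?_)).congr
        rfl ?_ (by omega)
      · simp only [Option.elim, hg]; exact hN x
      · simp [hz.symm, hz'.symm]
      · have e : FreeGroup.mk ((g { v with reg := some x } x)) = γ x := by
          rw [hg, FreeGroup.mk_toWord]
        simp only [Option.elim, e]
        funext j
        by_cases h1 : j = k'
        · subst h1; simp [hk.symm, hz']
        · by_cases h2 : j = k
          · subst h2; simp [hk, hz]
          · by_cases h3 : j = z
            · subst h3; simp [mul_assoc]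
            · simp [h1, h2, h3]⟩)
  have e : update (update (update S k (S k)) k' ([] ++ S k')) z
      (([].map γ).prod * w).toWord = S := by simp [← hS]
  rw [e] at this
  refine this.congr rfl rfl ?_
  simp
  ring_nf
  omega

/-- Multiply a reduced word on `z` from the left by a word for each letter on `k`, starting from
the bottom; `x` is an auxiliary stack. -/
noncomputable def passUp (k x z : Stk) (N : ℕ) (g : St n m → Letter n m → List (Letter n m)) :
    Pg n m := seq (mv k x) (scan x k z N g)

/-- Multiply a reduced word on `z` from the left by a word for each letter on `k`, starting from
the top; `x` is an auxiliary stack. -/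
noncomputable def passDown (k x z : Stk) (N : ℕ) (g : St n m → Letter n m → List (Letter n m)) :
    Pg n m := seq (scan k x z N g) (mv x k)

variable {k x z : Stk} {N : ℕ} {g : St n m → Letter n m → List (Letter n m)} {v : St n m}
  {S : Stacks n m} {w : FreeGroup (Gen n m)}

lemma run_passUp (hk : k ≠ x) (hz : k ≠ z) (hz' : x ≠ z) (γ : Letter n m → FreeGroup (Gen n m))
    (hg : ∀ x, g { v with reg := some x } x = (γ x).toWord) (hN : ∀ x, (γ x).norm ≤ N)
    (hS : S z = w.toWord) (hx : S x = []) :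
    Run (passUp k x z N g) (v, S)
      ({ v with reg := none }, update S z (((S k).map γ).prod * w).toWord)
      ((N + 7) * (S k).length + 4) := by
  refine (Run.seq (run_mv hk v S) (run_scan hk.symm hz' hz γ hg hN (w := w) ?_)).congr
    rfl ?_ ?_
  · simp [hz.symm, hz'.symm, hS]
  · funext j
    by_cases h1 : j = k
    · subst h1; simp [hk, hz, hx]
    · by_cases h2 : j = x
      · subst h2; simp [hk.symm, hz', hx]
      · by_cases h3 : j = z
        · subst h3; simp [hx]
        · simp [h1, h2, h3]
  · simp [hx]
    ring_nf
    omega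

lemma run_passDown (hk : k ≠ x) (hz : k ≠ z) (hz' : x ≠ z) (γ : Letter n m → FreeGroup (Gen n m))
    (hg : ∀ x, g { v with reg := some x } x = (γ x).toWord) (hN : ∀ x, (γ x).norm ≤ N)
    (hS : S z = w.toWord) (hx : S x = []) :
    Run (passDown k x z N g) (v, S)
      ({ v with reg := none }, update S z (((S k).reverse.map γ).prod * w).toWord)
      ((N + 7) * (S k).length + 4) := by
  refine (Run.seq (run_scan hk hz hz' γ hg hN (w := w) hS) (run_mv hk.symm _ _)).congr
    rfl ?_ ?_
  · funext j
    by_cases h1 : j = k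
    · subst h1; simp [hk, hz, hz', hx]
    · by_cases h2 : j = x
      · subst h2; simp [hk.symm, hz', hx]
      · by_cases h3 : j = z
        · subst h3; simp [h1, h2]
        · simp [h1, h2, h3]
  · simp [hx, hz']
    ring_nf
    omega

lemma prod_map_hom (ψ : FreeGroup (Gen n m) →* FreeGroup (Gen n m)) (l : List (Letter n m)) :
    (l.map fun x => ψ (FreeGroup.mk [x])).prod = ψ (FreeGroup.mk l) := by
  induction l with
  | nil => simp [← FreeGroup.one_eq_mk]
  | cons x l ih =>
    rw [List.map_cons, List.prod_cons, ih, ← map_mul, FreeGroup.mul_mk]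
    rfl

lemma prod_reverse_map_hom_inv (ψ : FreeGroup (Gen n m) →* FreeGroup (Gen n m))
    (l : List (Letter n m)) :
    (l.reverse.map fun x => (ψ (FreeGroup.mk [x]))⁻¹).prod = (ψ (FreeGroup.mk l))⁻¹ := by
  rw [← prod_map_hom, List.prod_inv_reverse, List.map_reverse, List.map_map]
  rfl

/-- A bound for the lengths of the images of the letters. -/
noncomputable def letterBound (ψ : FreeGroup (Gen n m) →* FreeGroup (Gen n m)) : ℕ :=
  Finset.univ.sup fun x : Letter n m => (ψ (FreeGroup.mk [x])).norm

lemma le_letterBound (ψ : FreeGroup (Gen n m) →* FreeGroup (Gen n m)) (x : Letter n m) :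
    (ψ (FreeGroup.mk [x])).norm ≤ letterBound ψ :=
  Finset.le_sup (f := fun x : Letter n m => (ψ (FreeGroup.mk [x])).norm) (Finset.mem_univ x)

lemma norm_map_le (ψ : FreeGroup (Gen n m) →* FreeGroup (Gen n m)) {N : ℕ}
    (hN : letterBound ψ ≤ N) (l : List (Letter n m)) :
    (ψ (FreeGroup.mk l)).norm ≤ N * l.length := by
  induction l with
  | nil => simp [← FreeGroup.one_eq_mk]
  | cons x l ih =>
    have e : FreeGroup.mk (x :: l) = FreeGroup.mk [x] * FreeGroup.mk l := by
      rw [FreeGroup.mul_mk]; rfl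
    rw [e, map_mul]
    refine (FreeGroup.norm_mul_le _ _).trans ?_
    have := (le_letterBound ψ x).trans hN
    rw [List.length_cons, Nat.mul_succ]
    omega

/-- Multiply the reduced word on `z` by the image of the word on `k` under a homomorphism. -/
noncomputable def mulHom (k x z : Stk) (N : ℕ)
    (ψ : St n m → FreeGroup (Gen n m) →* FreeGroup (Gen n m)) : Pg n m :=
  passUp k x z N fun v y => (ψ v (FreeGroup.mk [y])).toWord

/-- Multiply the reduced word on `z` by the inverse of the image of the word on `k` under a
homomorphism. -/
noncomputable def mulHomInv (k x z : Stk) (N : ℕ)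
    (ψ : St n m → FreeGroup (Gen n m) →* FreeGroup (Gen n m)) : Pg n m :=
  passDown k x z N fun v y => ((ψ v (FreeGroup.mk [y]))⁻¹).toWord

variable {ψ : St n m → FreeGroup (Gen n m) →* FreeGroup (Gen n m)}

lemma run_mulHom (hk : k ≠ x) (hz : k ≠ z) (hz' : x ≠ z)
    (hψ : ∀ y, ψ { v with reg := some y } = ψ v) (hN : letterBound (ψ v) ≤ N)
    (hS : S z = w.toWord) (hx : S x = []) :
    Run (mulHom k x z N ψ) (v, S)
      ({ v with reg := none }, update S z (ψ v (FreeGroup.mk (S k)) * w).toWord)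
      ((N + 7) * (S k).length + 4) := by
  have := run_passUp (g := fun v y => (ψ v (FreeGroup.mk [y])).toWord) hk hz hz'
    (fun y => ψ v (FreeGroup.mk [y])) (fun y => by rw [hψ]) (fun y => (le_letterBound _ y).trans hN)
    hS hx
  rw [prod_map_hom] at this
  exact this

lemma run_mulHomInv (hk : k ≠ x) (hz : k ≠ z) (hz' : x ≠ z)
    (hψ : ∀ y, ψ { v with reg := some y } = ψ v) (hN : letterBound (ψ v) ≤ N)
    (hS : S z = w.toWord) (hx : S x = []) :
    Run (mulHomInv k x z N ψ) (v, S)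
      ({ v with reg := none }, update S z ((ψ v (FreeGroup.mk (S k)))⁻¹ * w).toWord)
      ((N + 7) * (S k).length + 4) := by
  have := run_passDown (g := fun v y => ((ψ v (FreeGroup.mk [y]))⁻¹).toWord) hk hz hz'
    (fun y => (ψ v (FreeGroup.mk [y]))⁻¹) (fun y => by rw [hψ])
    (fun y => by rw [FreeGroup.norm_inv_eq]; exact (le_letterBound _ y).trans hN) hS hx
  rw [prod_reverse_map_hom_inv] at this
  exact this

end Prog

/-- Is this a letter `q^{±1}`? -/
def isQ (x : Letter n m) : Bool := match x.1 with
  | Gen.q => true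
  | _ => false

namespace Prog

open Function (update)

/-- Move the letters of a stack onto another one until a letter `q^{±1}` has been popped. -/
def spanPop (k k' : Stk) : Pg n m :=
  seq (pop k) (loop (fun v => v.reg.any fun x => !isQ x)
    (seq (push k' fun v => v.reg.toList) (pop k)))

lemma run_spanPop {k k' : Stk} (hk : k ≠ k') (v : St n m) (S : Stacks n m) :
    Run (spanPop k k') (v, S)
      ({ v with reg := ((S k).dropWhile fun x => !isQ x).head? },
        update (update S k ((S k).dropWhile fun x => !isQ x).tail) k'
          (((S k).takeWhile fun x => !isQ x).reverse ++ S k'))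
      (3 * (S k).length + 2) := by
  have key : ∀ (l : List (Letter n m)) (S : Stacks n m),
      Run (loop (fun v => v.reg.any fun x => !isQ x)
        (seq (push k' fun v => v.reg.toList) (pop k)))
      ({ v with reg := l.head? }, update S k l.tail)
      ({ v with reg := (l.dropWhile fun x => !isQ x).head? },
        update (update S k (l.dropWhile fun x => !isQ x).tail) k'
          ((l.takeWhile fun x => !isQ x).reverse ++ S k')) (3 * l.length + 1) := by
    intro l
    induction l with
    | nil =>
      intro S
      refine (Run.loopFalse (by rfl)).congr rfl ?_ (by omega)
      funext j
      by_cases h1 : j = k'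
      · subst h1; simp [hk.symm]
      · simp [h1]
    | cons y l ih =>
      intro S
      by_cases hy : isQ y
      · refine (Run.loopFalse (by simp [hy])).congr ?_ ?_ (by omega)
        · simp [hy]
        · funext j
          by_cases h1 : j = k'
          · subst h1; simp [hy, hk.symm]
          · simp [h1, hy]
      · have h1 := run_push k' (fun v => v.reg.toList) ({ v with reg := some y }) (update S k l)
        have h2 := run_pop k ({ v with reg := some y })
          (update (update S k l) k' ([y] ++ update S k l k'))
        have h3 := ih (update S k' (y :: S k'))
        have e1 : update (update S k l) k' ([y] ++ update S k l k') k = l := by simp [hk]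
        rw [e1] at h2
        have e2 : update (update (update S k l) k' ([y] ++ update S k l k')) k l.tail =
            update (update S k' (y :: S k')) k l.tail := by
          funext j
          by_cases h1 : j = k'
          · subst h1; simp [hk.symm]
          · by_cases h2 : j = k
            · subst h2; simp
            · simp [h1, h2]
        rw [e2] at h2
        refine (Run.loopTrue (by simp [hy]) (Run.seq h1 h2) h3).congr ?_ ?_ ?_
        · simp [hy]
        · funext j
          by_cases h1 : j = k'
          · subst h1; simp [hy]
          · by_cases h2 : j = k
            · subst h2; simp [hk, hy]
            · simp [h1, h2]
        · rw [List.length_cons]; omega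
  have h := key (S k) S
  exact (Run.seq (run_pop k v S) h).mono (by omega)

end Prog

end Words

end Miller

/-! ### The normal form of a word: recursion over its letters, and length bounds -/

namespace Miller

section Normalize

variable {n m : ℕ}

open Prog (letterBound le_letterBound norm_map_le)

lemma toWord_map {α β : Type*} [DecidableEq α] [DecidableEq β] {f : α → β}
    (hf : Function.Injective f) (x : FreeGroup α) :
    (FreeGroup.map f x).toWord = x.toWord.map fun p => (f p.1, p.2) := by
  conv_lhs => rw [← FreeGroup.mk_toWord (x := x)]
  rw [FreeGroup.map.mk, FreeGroup.toWord_mk]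
  exact (isReduced_map hf FreeGroup.isReduced_toWord).reduce_eq

/-- The embedding of `F(S)` into the free group on all standard generators. -/
def embS : FreeGroup (Fin n) →* FreeGroup (Gen n m) := FreeGroup.map Gen.s

/-- The embedding of `F(T, D)` into the free group on all standard generators. -/
def embTD : FreeGroup (Fin m ⊕ Fin n) →* FreeGroup (Gen n m) :=
  FreeGroup.map (Sum.elim Gen.t Gen.d)

lemma toWord_embS (s : FreeGroup (Fin n)) :
    (embS s : FreeGroup (Gen n m)).toWord = NormalForm.wordS s := toWord_map gen_s_injective s

lemma toWord_embTD (u : FreeGroup (Fin m ⊕ Fin n)) :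
    (embTD u : FreeGroup (Gen n m)).toWord = NormalForm.wordTD u := by
  refine toWord_map ?_ u
  rintro (i | j) (i' | j') h <;> cases h <;> rfl

lemma norm_embTD (u : FreeGroup (Fin m ⊕ Fin n)) :
    (embTD u : FreeGroup (Gen n m)).norm = u.norm := by
  rw [FreeGroup.norm, toWord_embTD, NormalForm.wordTD, List.length_map, FreeGroup.norm]

variable (R : Fin m → FreeGroup (Fin n))

/-- `twist`, extended to the free group on the standard generators. -/
def twistG (ε : Bool) : FreeGroup (Gen n m) →* FreeGroup (Gen n m) :=
  FreeGroup.lift fun x => match x with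
    | Gen.t i => embS (twist R ε (FreeGroup.of (Sum.inl i)))
    | Gen.d j => embS (twist R ε (FreeGroup.of (Sum.inr j)))
    | _ => 1

/-- `u ↦ u * twist u`, extended to the free group on the standard generators. -/
def graphG (ε : Bool) : FreeGroup (Gen n m) →* FreeGroup (Gen n m) :=
  FreeGroup.lift fun x => FreeGroup.of x * twistG R ε (FreeGroup.of x)

lemma twistG_embTD (ε : Bool) (u : FreeGroup (Fin m ⊕ Fin n)) :
    twistG R ε (embTD u) = embS (twist R ε u) := by
  have : (twistG R ε).comp embTD = embS.comp (twist R ε) := by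
    refine FreeGroup.ext_hom _ _ fun x => ?_
    rcases x with i | j <;> simp [twistG, embTD]
  exact DFunLike.congr_fun this u

/-- The image of a free group element in `G(H)`. -/
def valG : FreeGroup (Gen n m) →* MillerGroup R := PresentedGroup.mk (relators R)

lemma valG_mk (l : Word n m) : valG R (FreeGroup.mk l) = val R l := rfl

lemma valG_embS (s : FreeGroup (Fin n)) : valG R (embS s) = ofS R s := rfl

lemma valG_embTD (u : FreeGroup (Fin m ⊕ Fin n)) : valG R (embTD u) = ofTD R u := rfl

lemma valG_graphG (ε : Bool) (u : FreeGroup (Fin m ⊕ Fin n)) :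
    valG R (graphG R ε (embTD u)) = graphHom R ε u := by
  have : (valG R).comp ((graphG R ε).comp embTD) = graphHom R ε := by
    refine FreeGroup.ext_hom _ _ fun x => ?_
    have h := twistG_embTD R ε (FreeGroup.of x)
    have h' : embTD (FreeGroup.of x) = (FreeGroup.of (Sum.elim Gen.t Gen.d x) :
      FreeGroup (Gen n m)) := by simp [embTD]
    rw [h'] at h
    simp only [MonoidHom.comp_apply, h', graphG, FreeGroup.lift_apply_of, h, map_mul, valG_embS,
      graphHom_apply]
    rw [← h', valG_embTD]
  exact DFunLike.congr_fun this u

/-- A bound for the lengths of the images of the letters under the homomorphisms used. -/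
noncomputable def homBound : ℕ :=
  letterBound (twistG R false) + letterBound (twistG R true) + letterBound (graphG R false) +
    letterBound (graphG R true) + 1

lemma letterBound_twistG_le (ε : Bool) : letterBound (twistG R ε) ≤ homBound R := by
  unfold homBound
  cases ε <;> omega

lemma letterBound_graphG_le (ε : Bool) : letterBound (graphG R ε) ≤ homBound R := by
  unfold homBound
  cases ε <;> omega

/-- This is what the summand 1 in `homBound` is for. -/
lemma letterBound_id_le : letterBound (MonoidHom.id (FreeGroup (Gen n m))) ≤ homBound R := by
  have : letterBound (MonoidHom.id (FreeGroup (Gen n m))) ≤ 1 :=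
    Finset.sup_le fun x _ => FreeGroup.norm_mk_le
  unfold homBound
  omega

lemma letterBound_one_le : letterBound (1 : FreeGroup (Gen n m) →* FreeGroup (Gen n m)) ≤
    homBound R :=
  Finset.sup_le fun x _ => by simp

lemma norm_embS_twist_le (ε : Bool) (u : FreeGroup (Fin m ⊕ Fin n)) :
    (embS (twist R ε u) : FreeGroup (Gen n m)).norm ≤ homBound R * u.norm := by
  have := norm_map_le (twistG R ε) (letterBound_twistG_le R ε) (embTD u).toWord
  rwa [FreeGroup.mk_toWord, twistG_embTD, ← FreeGroup.norm, norm_embTD] at this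

/-- Multiply a pair `(u, w)`, which stands for `u w`, by a letter from the left. -/
def lmul (x : Letter n m) (p : FreeGroup (Fin m ⊕ Fin n) × FreeGroup (Gen n m)) :
    FreeGroup (Fin m ⊕ Fin n) × FreeGroup (Gen n m) :=
  match x with
  | (Gen.q, ε) => (p.1, embS (twist R (!ε) p.1) *
      (FreeGroup.mk [(Gen.q, ε)] * ((embS (twist R ε p.1))⁻¹ * p.2)))
  | (Gen.s j, b) => (p.1, FreeGroup.mk [(Gen.s j, b)] * p.2)
  | (Gen.t i, b) => (FreeGroup.mk [(Sum.inl i, b)] * p.1, p.2)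
  | (Gen.d j, b) => (FreeGroup.mk [(Sum.inr j, b)] * p.1, p.2)

/-- The pair `(u, w)` with `u ∈ F(T, D)` and `w ∈ F(S, q)` such that `u w` represents a word. -/
def nfPair (l : Word n m) : FreeGroup (Fin m ⊕ Fin n) × FreeGroup (Gen n m) :=
  l.foldr (lmul R) (1, 1)

lemma val_cons (x : Letter n m) (l : Word n m) : val R (x :: l) = val R [x] * val R l := by
  rw [← val_append, List.singleton_append]

lemma val_lmul (x : Letter n m) (p : FreeGroup (Fin m ⊕ Fin n) × FreeGroup (Gen n m)) :
    ofTD R (lmul R x p).1 * valG R (lmul R x p).2 = val R [x] * (ofTD R p.1 * valG R p.2) := by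
  rcases x with ⟨_ | j | i | j, b⟩
  · have h := graphHom_mul_qPow R b p.1
    simp only [graphHom_apply] at h
    simp only [lmul, map_mul, map_inv, valG_embS, valG_mk, val_q]
    rw [← mul_assoc, ← mul_assoc, h, ← mul_assoc, ← mul_assoc, ← mul_assoc, mul_inv_cancel_right]
  · have h := commute_ofTD_ofS R p.1 (FreeGroup.mk [(j, b)])
    have e : ofS R (FreeGroup.mk [(j, b)]) = val R [(Gen.s j, b)] := by
      rw [ofS, MonoidHom.comp_apply, FreeGroup.map.mk]; rfl
    rw [e] at h
    simp only [lmul, map_mul, valG_mk]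
    rw [← mul_assoc, h.eq, mul_assoc]
  · have e : ofTD R (FreeGroup.mk [(Sum.inl i, b)]) = val R [(Gen.t i, b)] := by
      rw [ofTD, MonoidHom.comp_apply, FreeGroup.map.mk]; rfl
    simp only [lmul, map_mul, e, mul_assoc]
  · have e : ofTD R (FreeGroup.mk [(Sum.inr j, b)]) = val R [(Gen.d j, b)] := by
      rw [ofTD, MonoidHom.comp_apply, FreeGroup.map.mk]; rfl
    simp only [lmul, map_mul, e, mul_assoc]

lemma val_nfPair (l : Word n m) : ofTD R (nfPair R l).1 * valG R (nfPair R l).2 = val R l := by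
  induction l with
  | nil =>
    have : val R ([] : Word n m) = 1 := map_one (PresentedGroup.mk (relators R))
    simp [nfPair, this]
  | cons x l ih => rw [val_cons, ← ih, ← val_lmul]; rfl

/-- The number of letters `q^{±1}` of a reduced word. -/
noncomputable def qCount (w : FreeGroup (Gen n m)) : ℕ := w.toWord.countP isQ

lemma qCount_mul_le (v w : FreeGroup (Gen n m)) : qCount (v * w) ≤ qCount v + qCount w := by
  have := (FreeGroup.toWord_mul_sublist v w).countP_le (p := isQ)
  rwa [List.countP_append] at this

lemma qCount_mk_le (l : Word n m) : qCount (FreeGroup.mk l) ≤ l.countP isQ := by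
  rw [qCount, FreeGroup.toWord_mk]
  exact (FreeGroup.Red.sublist FreeGroup.reduce.red).countP_le

lemma isQ_eq_false_of_mem_wordS {s : FreeGroup (Fin n)} {x : Letter n m}
    (h : x ∈ NormalForm.wordS s) : isQ x = false := by
  obtain ⟨j, hj⟩ := mem_wordS h
  simp [isQ, hj]

lemma qCount_embS (s : FreeGroup (Fin n)) : qCount (embS s : FreeGroup (Gen n m)) = 0 := by
  rw [qCount, toWord_embS, List.countP_eq_zero]
  intro x hx
  simp [isQ_eq_false_of_mem_wordS hx]

lemma isSQ_toWord_mul {v w : FreeGroup (Gen n m)} (hv : ∀ x ∈ v.toWord, IsSQ x.1)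
    (hw : ∀ x ∈ w.toWord, IsSQ x.1) : ∀ x ∈ (v * w).toWord, IsSQ x.1 := by
  intro x hx
  rcases List.mem_append.mp ((FreeGroup.toWord_mul_sublist v w).subset hx) with h | h
  exacts [hv x h, hw x h]

lemma isSQ_toWord_embS (s : FreeGroup (Fin n)) :
    ∀ x ∈ (embS s : FreeGroup (Gen n m)).toWord, IsSQ x.1 := by
  intro x hx
  rw [toWord_embS] at hx
  obtain ⟨j, hj⟩ := mem_wordS hx
  rw [hj]
  trivial

lemma isSQ_toWord_mk {x : Letter n m} (hx : IsSQ x.1) :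
    ∀ y ∈ (FreeGroup.mk [x]).toWord, IsSQ y.1 := by
  intro y hy
  rw [FreeGroup.toWord_mk, FreeGroup.reduce_singleton, List.mem_singleton] at hy
  rwa [hy]

lemma isSQ_nfPair (l : Word n m) : ∀ x ∈ (nfPair R l).2.toWord, IsSQ x.1 := by
  induction l with
  | nil => simp [nfPair]
  | cons x l ih =>
    change ∀ y ∈ (lmul R x (nfPair R l)).2.toWord, IsSQ y.1
    rcases x with ⟨_ | j | i | j, b⟩
    · refine isSQ_toWord_mul (isSQ_toWord_embS _) (isSQ_toWord_mul (isSQ_toWord_mk trivial)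
        (isSQ_toWord_mul ?_ ih))
      rw [← map_inv]
      exact isSQ_toWord_embS _
    · exact isSQ_toWord_mul (isSQ_toWord_mk trivial) ih
    · exact ih
    · exact ih

lemma norm_nfPair_fst_le (l : Word n m) : (nfPair R l).1.norm ≤ l.length := by
  induction l with
  | nil => simp [nfPair]
  | cons x l ih =>
    change (lmul R x (nfPair R l)).1.norm ≤ l.length + 1
    have h : ∀ y, (FreeGroup.mk [y] * (nfPair R l).1).norm ≤ l.length + 1 := fun y => by
      have h1 := FreeGroup.norm_mul_le (FreeGroup.mk [y]) (nfPair R l).1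
      have h2 := FreeGroup.norm_mk_le (L₁ := [y])
      rw [List.length_singleton] at h2
      omega
    rcases x with ⟨_ | j | i | j, b⟩
    exacts [ih.trans (Nat.le_succ _), ih.trans (Nat.le_succ _), h _, h _]

/-- The inserted twists contain no letter q, and free reduction only deletes letters. -/
lemma qCount_nfPair_le (l : Word n m) : qCount (nfPair R l).2 ≤ l.countP isQ := by
  induction l with
  | nil => simp [nfPair, qCount]
  | cons x l ih =>
    change qCount (lmul R x (nfPair R l)).2 ≤ _
    rw [List.countP_cons]
    rcases x with ⟨_ | j | i | j, b⟩
    · refine (qCount_mul_le _ _).trans ?_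
      rw [qCount_embS, zero_add]
      refine (qCount_mul_le _ _).trans ?_
      have h1 := qCount_mk_le [((Gen.q : Gen n m), b)]
      have h2 := qCount_mul_le (embS (twist R b (nfPair R l).1))⁻¹ (nfPair R l).2
      rw [← map_inv, qCount_embS] at h2
      simp only [List.countP_singleton] at h1
      rw [← map_inv]
      omega
    · have h1 := qCount_mk_le [((Gen.s j : Gen n m), b)]
      have h2 := qCount_mul_le (FreeGroup.mk [(Gen.s j, b)]) (nfPair R l).2
      simp only [List.countP_singleton] at h1
      exact h2.trans (by omega)
    · exact ih.trans (Nat.le_add_right _ _)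
    · exact ih.trans (Nat.le_add_right _ _)

/-- Only a letter q adds more than one letter: it inserts two twists of a `u` whose length is at
most that of the word read so far. Counting the letters q separately is what later allows a
quadratically long word to be renormalized within the cubic bound. -/
lemma norm_nfPair_snd_le (l : Word n m) :
    (nfPair R l).2.norm ≤ l.length + l.countP isQ * (2 * homBound R * l.length) := by
  -- The length `L` is fixed before the induction, so that every letter q is charged the same
  -- amount.
  have key : ∀ L, ∀ l : Word n m, l.length ≤ L →
      (nfPair R l).2.norm ≤ l.length + l.countP isQ * (2 * homBound R * L) := by
    intro L l
    induction l with
    | nil => simp [nfPair]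
    | cons x l ih =>
      intro hl
      rw [List.length_cons] at hl
      have ih := ih (by omega)
      change (lmul R x (nfPair R l)).2.norm ≤ _
      rw [List.countP_cons, List.length_cons]
      have h1 : ∀ y : Letter n m, (FreeGroup.mk [y] : FreeGroup (Gen n m)).norm ≤ 1 := fun y =>
        FreeGroup.norm_mk_le
      rcases x with ⟨_ | j | i | j, b⟩
      · have h2 := fun b => (norm_embS_twist_le R b (nfPair R l).1).trans
          (Nat.mul_le_mul_left _ ((norm_nfPair_fst_le R l).trans (by omega : _ ≤ L)))
        have h3 := h2 (!b)
        have h4 := h2 b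
        have h5 := FreeGroup.norm_mul_le (embS (twist R b (nfPair R l).1))⁻¹ (nfPair R l).2
        rw [FreeGroup.norm_inv_eq] at h5
        have h6 := FreeGroup.norm_mul_le (FreeGroup.mk [((Gen.q : Gen n m), b)])
          ((embS (twist R b (nfPair R l).1))⁻¹ * (nfPair R l).2)
        have h7 := FreeGroup.norm_mul_le (embS (twist R (!b) (nfPair R l).1))
          (FreeGroup.mk [((Gen.q : Gen n m), b)] *
            ((embS (twist R b (nfPair R l).1))⁻¹ * (nfPair R l).2))
        have h8 := h1 (Gen.q, b)
        have : (if isQ ((Gen.q : Gen n m), b) = true then 1 else 0) = 1 := by simp [isQ]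
        rw [this, Nat.add_mul, Nat.one_mul]
        refine h7.trans ?_
        have : 2 * homBound R * L = homBound R * L + homBound R * L := by ring
        omega
      · have h5 := FreeGroup.norm_mul_le (FreeGroup.mk [(Gen.s j, b)]) (nfPair R l).2
        have h6 := h1 (Gen.s j, b)
        have : (if isQ ((Gen.s j : Gen n m), b) = true then 1 else 0) = 0 := by simp [isQ]
        simp only [this, Nat.add_zero]
        refine h5.trans ?_
        omega
      all_goals
        simp only [isQ, Bool.false_eq_true, if_false, Nat.add_zero]
        exact ih.trans (by omega)
  exact key _ l le_rfl

end Normalize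

end Miller

/-! ### The normalization program -/

namespace Miller

section Tapes

/-- The contents of the stacks. -/
structure Tapes (n m : ℕ) : Type where
  I : List (Letter n m) := []
  U : List (Letter n m) := []
  W : List (Letter n m) := []
  T : List (Letter n m) := []
  X : List (Letter n m) := []
  P : List (Letter n m) := []
  Y : List (Letter n m) := []
  Q : List (Letter n m) := []
  Z : List (Letter n m) := []
  C : List (Letter n m) := []

variable {n m : ℕ}

/-- The contents of the stacks as a function. -/
def Tapes.get (t : Tapes n m) : Stacks n m
  | Stk.I => t.I
  | Stk.U => t.U
  | Stk.W => t.W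
  | Stk.T => t.T
  | Stk.X => t.X
  | Stk.P => t.P
  | Stk.Y => t.Y
  | Stk.Q => t.Q
  | Stk.Z => t.Z
  | Stk.C => t.C

open Function (update)

namespace Tapes

variable (t : Tapes n m) (l : List (Letter n m))

@[simp] lemma get_I : t.get Stk.I = t.I := rfl
@[simp] lemma get_U : t.get Stk.U = t.U := rfl
@[simp] lemma get_W : t.get Stk.W = t.W := rfl
@[simp] lemma get_T : t.get Stk.T = t.T := rfl
@[simp] lemma get_X : t.get Stk.X = t.X := rfl
@[simp] lemma get_P : t.get Stk.P = t.P := rfl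
@[simp] lemma get_Y : t.get Stk.Y = t.Y := rfl
@[simp] lemma get_Q : t.get Stk.Q = t.Q := rfl
@[simp] lemma get_Z : t.get Stk.Z = t.Z := rfl
@[simp] lemma get_C : t.get Stk.C = t.C := rfl

@[simp] lemma update_I : update t.get Stk.I l = ({ t with I := l } : Tapes n m).get := by
  funext j; cases j <;> rfl
@[simp] lemma update_U : update t.get Stk.U l = ({ t with U := l } : Tapes n m).get := by
  funext j; cases j <;> rfl
@[simp] lemma update_W : update t.get Stk.W l = ({ t with W := l } : Tapes n m).get := by
  funext j; cases j <;> rfl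
@[simp] lemma update_T : update t.get Stk.T l = ({ t with T := l } : Tapes n m).get := by
  funext j; cases j <;> rfl
@[simp] lemma update_X : update t.get Stk.X l = ({ t with X := l } : Tapes n m).get := by
  funext j; cases j <;> rfl
@[simp] lemma update_P : update t.get Stk.P l = ({ t with P := l } : Tapes n m).get := by
  funext j; cases j <;> rfl
@[simp] lemma update_Y : update t.get Stk.Y l = ({ t with Y := l } : Tapes n m).get := by
  funext j; cases j <;> rfl
@[simp] lemma update_Q : update t.get Stk.Q l = ({ t with Q := l } : Tapes n m).get := by
  funext j; cases j <;> rfl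
@[simp] lemma update_Z : update t.get Stk.Z l = ({ t with Z := l } : Tapes n m).get := by
  funext j; cases j <;> rfl
@[simp] lemma update_C : update t.get Stk.C l = ({ t with C := l } : Tapes n m).get := by
  funext j; cases j <;> rfl

lemma get_empty : (fun _ => [] : Stacks n m) = ({} : Tapes n m).get := by
  funext j; cases j <;> rfl

end Tapes

end Tapes

section NormalizeProgram

variable {n m : ℕ} (R : Fin m → FreeGroup (Fin n))

open Prog

/-- Is this a letter `s_j^{±1}`? -/
def isS (x : Letter n m) : Bool := match x.1 with
  | Gen.s _ => true
  | _ => false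

/-- The homomorphism `twist` given by the sign of a stored letter. -/
def letterTwist (x : Option (Letter n m)) (f : Bool → Bool) :
    FreeGroup (Gen n m) →* FreeGroup (Gen n m) := x.elim 1 fun x => twistG R (f x.2)

lemma letterBound_letterTwist_le (x : Option (Letter n m)) (f : Bool → Bool) :
    letterBound (letterTwist R x f) ≤ homBound R := by
  cases x
  · exact letterBound_one_le R
  · exact letterBound_twistG_le R _

/-- Multiply by the letter in the register from the left. -/
noncomputable def normBody : Pg n m :=
  ite (fun v => v.reg.any isQ)
    (seq (set fun v => { v with fst := v.reg })
    (seq (mulHomInv Stk.U Stk.X Stk.W (homBound R) fun v => letterTwist R v.fst id)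
    (seq (mulWord Stk.W 1 fun v => v.fst.toList)
    (seq (mulHom Stk.U Stk.X Stk.W (homBound R) fun v => letterTwist R v.fst not)
      (set fun v => { v with fst := none })))))
    (ite (fun v => v.reg.any isS) (mulWord Stk.W 1 fun v => v.reg.toList)
      (mulWord Stk.U 1 fun v => v.reg.toList))

lemma mk_wordTD (u : FreeGroup (Fin m ⊕ Fin n)) :
    (FreeGroup.mk (NormalForm.wordTD u) : FreeGroup (Gen n m)) = embTD u := by
  rw [← toWord_embTD, FreeGroup.mk_toWord]

lemma length_wordTD (u : FreeGroup (Fin m ⊕ Fin n)) :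
    (NormalForm.wordTD u : Word n m).length = u.norm := by
  rw [NormalForm.wordTD, List.length_map]; rfl

lemma run_normBody (x : Letter n m) (p : FreeGroup (Fin m ⊕ Fin n) × FreeGroup (Gen n m))
    (t : Tapes n m) (hU : t.U = NormalForm.wordTD p.1) (hW : t.W = p.2.toWord) (hX : t.X = []) :
    Run (normBody R) ({ reg := some x }, t.get)
      ({ reg := if isQ x then none else some x }, ({ t with
        U := NormalForm.wordTD (lmul R x p).1
        W := (lmul R x p).2.toWord } : Tapes n m).get)
      (if isQ x then 2 * (homBound R + 7) * p.1.norm + 13 else 4) := by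
  have hmk : FreeGroup.mk t.U = embTD p.1 := by rw [hU, mk_wordTD]
  have hlen : t.U.length = p.1.norm := by rw [hU, length_wordTD]
  have hletter : ∀ y : Letter n m, isQ y = false → isS y = false →
      (lmul R y p).2 = p.2 ∧ embTD (lmul R y p).1 = FreeGroup.mk [y] * embTD p.1 := by
    rintro ⟨_ | j | i | j, b⟩ h1 h2
    · simp [isQ] at h1
    · simp [isS] at h2
    · refine ⟨rfl, ?_⟩
      rw [lmul, map_mul, embTD, FreeGroup.map.mk]; rfl
    · refine ⟨rfl, ?_⟩
      rw [lmul, map_mul, embTD, FreeGroup.map.mk]; rfl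
  by_cases hQ : isQ x
  · obtain ⟨ε, rfl⟩ : ∃ ε, x = (Gen.q, ε) := by
      rcases x with ⟨_ | j | i | j, b⟩
      exacts [⟨b, rfl⟩, by simp [isQ] at hQ, by simp [isQ] at hQ, by simp [isQ] at hQ]
    have h1 := run_set (fun v : St n m => { v with fst := v.reg })
      { reg := some ((Gen.q : Gen n m), ε) } t.get
    have h2 := run_mulHomInv (k := Stk.U) (x := Stk.X) (z := Stk.W) (N := homBound R)
      (v := { reg := some ((Gen.q : Gen n m), ε), fst := some ((Gen.q : Gen n m), ε) })
      (S := t.get) (w := p.2) (ψ := fun v => letterTwist R v.fst id)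
      (by decide) (by decide) (by decide) (fun _ => rfl) (letterBound_letterTwist_le R _ _) hW hX
    simp only [Tapes.get_U, Tapes.update_W, hmk, letterTwist, Option.elim, id,
      twistG_embTD, hlen] at h2
    have h3 := run_mulWord Stk.W 1 (fun v => v.fst.toList)
      (v := { fst := some ((Gen.q : Gen n m), ε) })
      (S := ({ t with W := ((embS (twist R ε p.1))⁻¹ * p.2).toWord } : Tapes n m).get)
      (by simp) rfl
    simp only [Option.toList_some, Tapes.update_W] at h3
    have h4 := run_mulHom (k := Stk.U) (x := Stk.X) (z := Stk.W) (N := homBound R)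
      (v := { fst := some ((Gen.q : Gen n m), ε) })
      (S := ({ t with W := (FreeGroup.mk [(Gen.q, ε)] *
        ((embS (twist R ε p.1))⁻¹ * p.2)).toWord } : Tapes n m).get)
      (ψ := fun v => letterTwist R v.fst not)
      (by decide) (by decide) (by decide) (fun _ => rfl) (letterBound_letterTwist_le R _ _) rfl hX
    simp only [Tapes.get_U, Tapes.update_W, hmk, letterTwist, Option.elim,
      twistG_embTD, hlen] at h4
    have h5 := run_set (fun v : St n m => { v with fst := none })
      { fst := some ((Gen.q : Gen n m), ε) } ({ t with W := (embS (twist R (!ε) p.1) *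
        (FreeGroup.mk [(Gen.q, ε)] *
        ((embS (twist R ε p.1))⁻¹ * p.2))).toWord } : Tapes n m).get
    refine (Run.iteTrue (by exact hQ) (Run.seq h1 (Run.seq h2 (Run.seq h3 (Run.seq h4 h5))))).congr
      ?_ ?_ ?_
    · simp [hQ]
    · simp [lmul, hU]
    · simp only [hQ, if_true]
      ring_nf
      omega
  · have hQ' : isQ x = false := by simpa using hQ
    simp only [hQ', Bool.false_eq_true, if_false]
    refine Run.iteFalse (t := 3) (by exact hQ') ?_
    by_cases hS : isS x
    · have h1 := run_mulWord Stk.W 1 (fun v => v.reg.toList)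
        (v := { reg := some x }) (S := t.get) (w := p.2) (by simp) hW
      refine (Run.iteTrue (by exact hS) h1).congr rfl ?_ le_rfl
      rcases x with ⟨_ | j | i | j, b⟩
      exacts [by simp [isS] at hS, by simp [lmul, hU], by simp [isS] at hS, by simp [isS] at hS]
    · have hS' : isS x = false := by simpa using hS
      obtain ⟨e1, e2⟩ := hletter x hQ' hS'
      have h1 := run_mulWord Stk.U 1 (fun v => v.reg.toList)
        (v := { reg := some x }) (S := t.get) (w := embTD p.1) (by simp)
        (by rw [toWord_embTD]; exact hU)
      refine (Run.iteFalse (by exact hS') h1).congr rfl ?_ le_rfl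
      rw [← toWord_embTD, e2, e1]
      simp [hW]

/-- Bring the word on `I` into normal form: the part in `F(T, D)` is put on `U`, the part in
`F(S, q)` on `W`. -/
noncomputable def normalize : Pg n m :=
  seq (mv Stk.I Stk.T) (forEach Stk.T (normBody R))

lemma sum_map_le (l : Word n m) (A B : ℕ) :
    (l.map fun x => if isQ x then A else B).sum ≤ l.countP isQ * A + l.length * B := by
  induction l with
  | nil => simp
  | cons x l ih =>
    rw [List.map_cons, List.sum_cons, List.countP_cons, List.length_cons]
    split_ifs
    · rw [Nat.add_mul, Nat.add_mul]; omega
    · rw [Nat.add_mul, Nat.add_mul]; omega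

lemma run_normalize_aux (l : Word n m) :
    Run (normalize R) ({}, ({ I := l } : Tapes n m).get)
      ({}, ({ U := NormalForm.wordTD (nfPair R l).1
              W := (nfPair R l).2.toWord } : Tapes n m).get)
      (l.countP isQ * (2 * (homBound R + 7) * l.length + 15) + 9 * l.length + 4) := by
  have h1 := run_mv (show Stk.I ≠ Stk.T by decide) {} ({ I := l } : Tapes n m).get
  simp only [Tapes.get_I, Tapes.get_T, Tapes.update_I, Tapes.update_T, List.append_nil] at h1
  -- The input has been reversed onto `T`, so it is read from its right end, and the processed part
  -- `d` is a suffix of `l` in its original order. A letter q costs passes over `U`, any other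
  -- letter a constant.
  have h2 := run_forEach (k := Stk.T) (body := normBody R) (v := {}) (L := l.reverse)
    (fun d l => ({ T := l, U := NormalForm.wordTD (nfPair R d).1
                   W := (nfPair R d).2.toWord } : Tapes n m).get)
    (fun x => if isQ x then 2 * (homBound R + 7) * l.length + 13 else 4)
    (fun d l => rfl) (fun d x l' hd => ⟨_, by
      have hd' : d.length ≤ l.length := by
        have := congrArg List.length hd
        simp at this
        omega
      have := run_normBody R x (nfPair R d) ({ T := l', U := NormalForm.wordTD (nfPair R d).1
                                               W := (nfPair R d).2.toWord } : Tapes n m)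
        rfl rfl rfl
      rw [Tapes.update_T]
      refine this.mono ?_
      split_ifs
      · have := Nat.mul_le_mul_left (2 * (homBound R + 7))
          ((norm_nfPair_fst_le R d).trans hd')
        omega
      · exact le_rfl⟩)
  refine (Run.seq h1 h2).congr rfl (by simp) ?_
  have h3 : (l.reverse.map fun x =>
      (if isQ x then 2 * (homBound R + 7) * l.length + 13 else 4) + 2) =
      l.reverse.map fun x => if isQ x then 2 * (homBound R + 7) * l.length + 15 else 6 :=
    List.map_congr_left fun x _ => by split_ifs <;> rfl
  have h4 := sum_map_le l.reverse (2 * (homBound R + 7) * l.length + 15) 6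
  rw [List.countP_reverse, List.length_reverse] at h4
  rw [h3]
  omega

lemma countP_sylWord (s : FreeGroup (Fin n)) (tail : List (Bool × FreeGroup (Fin n))) :
    (sylWord s tail : Word n m).countP isQ = tail.length := by
  have h0 : ∀ s, (NormalForm.wordS s : Word n m).countP isQ = 0 := fun s =>
    List.countP_eq_zero.mpr fun x hx => by simp [isQ_eq_false_of_mem_wordS hx]
  induction tail generalizing s with
  | nil => rw [sylWord_nil, h0]; rfl
  | cons p tail ih =>
    rw [sylWord_cons_eq, List.countP_append, h0, List.countP_cons, ih, zero_add]
    rfl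

lemma exists_run_normalize (l : Word n m) : ∃ u s tail, TailReduced tail ∧
    ofTD R u * (ofS R s * tailProd R tail) = val R l ∧ u.norm ≤ l.length ∧
    tail.length ≤ l.countP isQ ∧
    (sylWord s tail : Word n m).length ≤
      l.length + l.countP isQ * (2 * homBound R * l.length) ∧
    Run (normalize R) ({}, ({ I := l } : Tapes n m).get)
      ({}, ({ U := NormalForm.wordTD u, W := sylWord s tail } : Tapes n m).get)
      (l.countP isQ * (2 * (homBound R + 7) * l.length + 15) + 9 * l.length + 4) := by
  obtain ⟨s, tail, ht, h⟩ := exists_sylWord (FreeGroup.isReduced_toWord (x := (nfPair R l).2))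
    (isSQ_nfPair R l)
  refine ⟨(nfPair R l).1, s, tail, ht, ?_, norm_nfPair_fst_le R l, ?_, ?_, ?_⟩
  · rw [← val_nfPair R l, ← val_sylWord, ← h, ← valG_mk, FreeGroup.mk_toWord]
  · rw [← countP_sylWord (m := m) s, ← h]
    exact qCount_nfPair_le R l
  · rw [← h]
    exact norm_nfPair_snd_le R l
  · rw [← h]
    exact run_normalize_aux R l

end NormalizeProgram

end Miller

/-! ### Splitting a syllable word at its ends, and the cyclic test -/

namespace Miller

section SplitEnds

variable {n m : ℕ} (R : Fin m → FreeGroup (Fin n))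

open Prog

/-- Split the word on `W` at its first and last letters `q^{±1}`, which are put in the registers;
the parts are put on `P` (reversed), `Y` (reversed) and `Q`. -/
def splitEnds : Pg n m :=
  seq (spanPop Stk.W Stk.P)
  (seq (set fun v => { v with fst := v.reg })
  (seq (mv Stk.W Stk.Y)
  (seq (spanPop Stk.Y Stk.Q)
    (set fun v => { v with reg := none, lst := v.reg }))))

lemma takeWhile_wordS_append (s : FreeGroup (Fin n)) {l : Word n m}
    (hl : ∀ x ∈ l.head?, isQ x = true) :
    (NormalForm.wordS s ++ l).takeWhile (fun x => !isQ x) = NormalForm.wordS s ∧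
      (NormalForm.wordS s ++ l).dropWhile (fun x => !isQ x) = l := by
  have h : ∀ x ∈ (NormalForm.wordS s : Word n m), (!isQ x) = true := fun x hx => by
    simp [isQ_eq_false_of_mem_wordS hx]
  rw [List.takeWhile_append_of_pos h, List.dropWhile_append_of_pos h]
  cases l with
  | nil => simp
  | cons x l => simpa using hl

lemma takeWhile_wordS_reverse_append (s : FreeGroup (Fin n)) {l : Word n m}
    (hl : ∀ x ∈ l.head?, isQ x = true) :
    ((NormalForm.wordS s).reverse ++ l).takeWhile (fun x => !isQ x) =
      (NormalForm.wordS s).reverse ∧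
      ((NormalForm.wordS s).reverse ++ l).dropWhile (fun x => !isQ x) = l := by
  have h : ∀ x ∈ (NormalForm.wordS s : Word n m).reverse, (!isQ x) = true := fun x hx => by
    simp [isQ_eq_false_of_mem_wordS (List.mem_reverse.mp hx)]
  rw [List.takeWhile_append_of_pos h, List.dropWhile_append_of_pos h]
  cases l with
  | nil => simp
  | cons x l => simpa using hl

lemma sylWord_concat (s : FreeGroup (Fin n)) (tail : List (Bool × FreeGroup (Fin n)))
    (p : Bool × FreeGroup (Fin n)) :
    (sylWord s (tail ++ [p]) : Word n m) =
      sylWord s tail ++ (Gen.q, p.1) :: NormalForm.wordS p.2 := by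
  simp [sylWord]

lemma wordS_one : (NormalForm.wordS 1 : Word n m) = [] := wordS_eq_nil.mpr rfl

/-- The first q is found from the top of `W`, the last one from the top after the rest has been
reversed onto `Y`. With fewer than two letters q a register stays empty, which makes the later test
fail, as it should. -/
lemma run_splitEnds (β : Option Bool) (U C : Word n m) (s : FreeGroup (Fin n))
    (tail : List (Bool × FreeGroup (Fin n))) :
    ∃ (f l : Option (Letter n m)) (Y : Word n m) (s' : FreeGroup (Fin n)),
      Run splitEnds ({ sgn := β, flag := true }, ({ U := U, C := C
                                                    W := sylWord s tail } : Tapes n m).get)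
        ({ sgn := β, flag := true, fst := f, lst := l },
          ({ U := U, C := C, P := (NormalForm.wordS s).reverse, Y := Y
             Q := NormalForm.wordS s' } : Tapes n m).get)
        (9 * (sylWord s tail : Word n m).length + 8) ∧
      (sylWord s tail : Word n m) = NormalForm.wordS s ++ (f.toList ++ (Y.reverse ++
        (l.toList ++ NormalForm.wordS s'))) ∧
      (f = none ∨ l = none → tail.length ≤ 1) ∧
      ∀ x y, f = some x → l = some y → ∃ s₁ t, tail = (x.2, s₁) :: (t ++ [(y.2, s')]) ∧
        Y = (sylWord s₁ t).reverse := by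
  -- One execution for all shapes of the word; the cases of no, one and several letters q only
  -- supply the data.
  have key : ∀ (f l : Option (Letter n m)) (V Y : Word n m) (s' : FreeGroup (Fin n)),
      (∀ x ∈ f, isQ x = true) → (f = none → V = []) →
      (sylWord s tail : Word n m) = NormalForm.wordS s ++ (f.toList ++ V) →
      (∀ x ∈ l, isQ x = true) → (l = none → Y = []) →
      V.reverse = (NormalForm.wordS s').reverse ++ (l.toList ++ Y) →
      Run splitEnds ({ sgn := β, flag := true }, ({ U := U, C := C
                                                    W := sylWord s tail } : Tapes n m).get)
        ({ sgn := β, flag := true, fst := f, lst := l },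
          ({ U := U, C := C, P := (NormalForm.wordS s).reverse, Y := Y
             Q := NormalForm.wordS s' } : Tapes n m).get)
        (9 * (sylWord s tail : Word n m).length + 8) := by
    intro f l V Y s' hf hf' h hl hl' h'
    have hh : ∀ (o : Option (Letter n m)) (l : Word n m), (∀ x ∈ o, isQ x = true) →
        (o = none → l = []) → (∀ x ∈ (o.toList ++ l).head?, isQ x = true) ∧
          (o.toList ++ l).head? = o ∧ (o.toList ++ l).tail = l := by
      rintro (_ | x) l h1 h2
      · simp [h2 rfl]
      · simpa using h1
    obtain ⟨a1, a2, a3⟩ := hh f V hf hf'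
    obtain ⟨b1, b2, b3⟩ := hh l Y hl hl'
    obtain ⟨c1, c2⟩ := takeWhile_wordS_append s a1
    obtain ⟨d1, d2⟩ := takeWhile_wordS_reverse_append s' b1
    have r1 := run_spanPop (show Stk.W ≠ Stk.P by decide) { sgn := β, flag := true }
      ({ U := U, C := C, W := sylWord s tail } : Tapes n m).get
    simp only [Tapes.get_W, Tapes.get_P, Tapes.update_W, Tapes.update_P, List.append_nil] at r1
    have r1' := r1
    rw [h, c1, c2, a2, a3, ← h] at r1
    have r3 := run_mv (show Stk.W ≠ Stk.Y by decide) { sgn := β, flag := true, reg := f, fst := f }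
      ({ U := U, C := C, W := V, P := (NormalForm.wordS s).reverse } : Tapes n m).get
    simp only [Tapes.get_W, Tapes.get_Y, Tapes.update_W, Tapes.update_Y, List.append_nil] at r3
    have r4 := run_spanPop (show Stk.Y ≠ Stk.Q by decide) { sgn := β, flag := true, fst := f }
      ({ U := U, C := C, Y := V.reverse, P := (NormalForm.wordS s).reverse } : Tapes n m).get
    simp only [Tapes.get_Y, Tapes.get_Q, Tapes.update_Y, Tapes.update_Q, List.append_nil] at r4
    rw [h', d1, d2, b2, b3, ← h', List.reverse_reverse] at r4
    refine (Run.seq r1 (Run.seq (run_set _ _ _) (Run.seq r3 (Run.seq r4 (run_set _ _ _))))).mono ?_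
    have := congrArg List.length h
    simp only [List.length_append] at this
    rw [List.length_reverse]
    omega
  rcases tail with _ | ⟨p, t⟩
  · refine ⟨none, none, [], 1, key none none [] [] 1 ?_ ?_ ?_ ?_ ?_ ?_, ?_, ?_, ?_⟩ <;>
      simp [sylWord_nil, wordS_one]
  · rcases List.eq_nil_or_concat' t with rfl | ⟨t, q, rfl⟩
    · refine ⟨some (Gen.q, p.1), none, [], p.2,
        key (some (Gen.q, p.1)) none (NormalForm.wordS p.2) [] p.2 ?_ ?_ ?_ ?_ ?_ ?_, ?_, ?_, ?_⟩ <;>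
      simp [sylWord_cons_eq, sylWord_nil, isQ]
    · refine ⟨some (Gen.q, p.1), some (Gen.q, q.1), (sylWord p.2 t).reverse, q.2,
        key (some (Gen.q, p.1)) (some (Gen.q, q.1)) (sylWord p.2 (t ++ [q]))
          (sylWord p.2 t).reverse q.2 ?_ ?_ ?_ ?_ ?_ ?_, ?_, ?_, ?_⟩ <;>
      simp [sylWord_cons_eq, sylWord_concat, isQ]
      exact ⟨p.2, rfl, rfl⟩

/-- Put a word that has been split together again. -/
def joinEnds : Pg n m :=
  seq (mv Stk.Q Stk.T)
  (seq (mv Stk.T Stk.W)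
  (seq (push Stk.Y fun v => v.lst.toList)
  (seq (mv Stk.Y Stk.W)
  (seq (push Stk.W fun v => v.fst.toList)
    (mv Stk.P Stk.W)))))

lemma run_joinEnds (v : St n m) (U C P Y Q : Word n m) :
    Run joinEnds (v, ({ U := U, C := C, P := P, Y := Y, Q := Q } : Tapes n m).get)
      ({ v with reg := none }, ({ U := U, C := C, W := P.reverse ++ (v.fst.toList ++
        (Y.reverse ++ (v.lst.toList ++ Q))) } : Tapes n m).get)
      (3 * P.length + 3 * Y.length + 6 * Q.length + 13) := by
  have r1 := run_mv (show Stk.Q ≠ Stk.T by decide) v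
    ({ U := U, C := C, P := P, Y := Y, Q := Q } : Tapes n m).get
  simp only [Tapes.get_Q, Tapes.get_T, Tapes.update_Q, Tapes.update_T, List.append_nil] at r1
  have r2 := run_mv (show Stk.T ≠ Stk.W by decide) { v with reg := none }
    ({ U := U, C := C, P := P, Y := Y, T := Q.reverse } : Tapes n m).get
  simp only [Tapes.get_T, Tapes.get_W, Tapes.update_T, Tapes.update_W, List.append_nil,
    List.reverse_reverse] at r2
  have r3 := run_push Stk.Y (fun v => v.lst.toList) { v with reg := none }
    ({ U := U, C := C, P := P, Y := Y, W := Q } : Tapes n m).get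
  simp only [Tapes.get_Y, Tapes.update_Y] at r3
  have r4 := run_mv (show Stk.Y ≠ Stk.W by decide) { v with reg := none }
    ({ U := U, C := C, P := P, Y := v.lst.toList ++ Y, W := Q } : Tapes n m).get
  simp only [Tapes.get_Y, Tapes.get_W, Tapes.update_Y, Tapes.update_W] at r4
  have r5 := run_push Stk.W (fun v => v.fst.toList) { v with reg := none }
    ({ U := U, C := C, P := P, W := (v.lst.toList ++ Y).reverse ++ Q } : Tapes n m).get
  simp only [Tapes.get_W, Tapes.update_W] at r5
  have r6 := run_mv (show Stk.P ≠ Stk.W by decide) { v with reg := none }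
    ({ U := U, C := C, P := P, W := v.fst.toList ++
      ((v.lst.toList ++ Y).reverse ++ Q) } : Tapes n m).get
  simp only [Tapes.get_P, Tapes.get_W, Tapes.update_P, Tapes.update_W] at r6
  refine (Run.seq r1 (Run.seq r2 (Run.seq r3 (Run.seq r4 (Run.seq r5 r6))))).congr rfl ?_ ?_
  · cases v.lst <;> simp
  · cases v.lst <;> simp <;> omega

/-- Record in the flag whether the word on a stack is empty, then clear it. -/
def testEmpty (k : Stk) (f : St n m → Bool → Bool) : Pg n m :=
  seq (pop k) (seq (set fun v => { v with flag := f v v.reg.isNone }) (clear k))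

lemma run_testEmpty (k : Stk) (f : St n m → Bool → Bool) (v : St n m) (S : Stacks n m)
    (hf : ∀ r b, f { v with reg := r } b = f v b) :
    Run (testEmpty k f) (v, S) ({ v with reg := none, flag := f v (decide (S k = [])) },
      Function.update S k []) (3 * (S k).length + 4) := by
  refine (Run.seq (run_pop k v S) (Run.seq (run_set _ _ _) (run_clear k _ _))).congr ?_ ?_ ?_
  · have : (S k).head?.isNone = decide (S k = []) := by cases S k <;> simp
    rw [← this]
    simp only [hf]
  · simp
  · simp; omega

/-- Multiply the reduced word on `z` by the image of the reversed word on `k` under a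
homomorphism. -/
noncomputable def mulHomRev (k x z : Stk) (N : ℕ)
    (ψ : St n m → FreeGroup (Gen n m) →* FreeGroup (Gen n m)) : Pg n m :=
  passDown k x z N fun v y => (ψ v (FreeGroup.mk [y])).toWord

lemma run_mulHomRev {k x z : Stk} {N : ℕ} {v : St n m} {S : Stacks n m} {w : FreeGroup (Gen n m)}
    {ψ : St n m → FreeGroup (Gen n m) →* FreeGroup (Gen n m)}
    (hk : k ≠ x) (hz : k ≠ z) (hz' : x ≠ z)
    (hψ : ∀ y, ψ { v with reg := some y } = ψ v) (hN : letterBound (ψ v) ≤ N)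
    (hS : S z = w.toWord) (hx : S x = []) :
    Run (mulHomRev k x z N ψ) (v, S)
      ({ v with reg := none },
        Function.update S z (ψ v (FreeGroup.mk (S k).reverse) * w).toWord)
      ((N + 7) * (S k).length + 4) := by
  have := run_passDown (g := fun v y => (ψ v (FreeGroup.mk [y])).toWord) hk hz hz'
    (fun y => ψ v (FreeGroup.mk [y])) (fun y => by rw [hψ]) (fun y => (le_letterBound _ y).trans hN)
    hS hx
  rw [prod_map_hom] at this
  exact this

/-- The homomorphism `twist` given by a sign, or the trivial homomorphism. -/
def signTwist (β : Option Bool) : FreeGroup (Fin m ⊕ Fin n) →* FreeGroup (Fin n) :=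
  β.elim 1 (twist R)

/-- The homomorphism `twistG` given by a sign, or the trivial homomorphism. -/
def signTwistG (β : Option Bool) : FreeGroup (Gen n m) →* FreeGroup (Gen n m) :=
  β.elim 1 (twistG R)

lemma signTwistG_embTD (β : Option Bool) (u : FreeGroup (Fin m ⊕ Fin n)) :
    signTwistG R β (embTD u) = embS (signTwist R β u) := by
  cases β
  · simp [signTwistG, signTwist]
  · exact twistG_embTD R _ u

lemma letterBound_signTwistG_le (β : Option Bool) : letterBound (signTwistG R β) ≤ homBound R := by
  cases β
  · exact letterBound_one_le R
  · exact letterBound_twistG_le R _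

lemma norm_embS_signTwist_le (β : Option Bool) (u : FreeGroup (Fin m ⊕ Fin n)) :
    (embS (signTwist R β u) : FreeGroup (Gen n m)).norm ≤ homBound R * u.norm := by
  cases β
  · simp [signTwist]
  · exact norm_embS_twist_le R _ u

/-- The test of Algorithm III on a word that has been split. -/
noncomputable def testPinch : Pg n m :=
  seq (mulHomInv Stk.U Stk.X Stk.Z (homBound R) fun v => signTwistG R (v.lst.map Prod.snd))
  (seq (mulHomRev Stk.P Stk.T Stk.Z (homBound R) fun _ => MonoidHom.id _)
  (seq (mulHom Stk.U Stk.X Stk.Z (homBound R) fun v => signTwistG R v.sgn)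
  (seq (mulHom Stk.Q Stk.T Stk.Z (homBound R) fun _ => MonoidHom.id _)
    (testEmpty Stk.Z fun v b => v.fst.any fun x => v.lst.any fun y => decide (x.2 ≠ y.2) && b))))

lemma mk_wordS (s : FreeGroup (Fin n)) :
    (FreeGroup.mk (NormalForm.wordS s) : FreeGroup (Gen n m)) = embS s := by
  rw [← toWord_embS, FreeGroup.mk_toWord]

lemma length_wordS (s : FreeGroup (Fin n)) :
    (NormalForm.wordS s : Word n m).length = (embS s : FreeGroup (Gen n m)).norm := by
  rw [← toWord_embS]; rfl

lemma embS_injective : Function.Injective (embS : FreeGroup (Fin n) →* FreeGroup (Gen n m)) :=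
  FreeGroup.map_injective gen_s_injective

/-- On `Z` the product `s' a s b⁻¹` is built from right to left, where `a` and `b` are the twists of
`u` by the stored sign and by the sign of the last q. It is trivial exactly if the equation of
`conjForm_pinch_iff` holds. All other stacks are restored. -/
lemma run_testPinch (v : St n m) (u : FreeGroup (Fin m ⊕ Fin n)) (s s' : FreeGroup (Fin n))
    (Y C : Word n m) :
    Run (testPinch R) (v, ({ U := NormalForm.wordTD u, C := C, P := (NormalForm.wordS s).reverse
                             Y := Y, Q := NormalForm.wordS s' } : Tapes n m).get)
      ({ v with
          reg := none
          flag := v.fst.any fun x => v.lst.any fun y => decide (x.2 ≠ y.2) &&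
            decide (s' * signTwist R v.sgn u * s = signTwist R (v.lst.map Prod.snd) u) },
        ({ U := NormalForm.wordTD u, C := C, P := (NormalForm.wordS s).reverse
           Y := Y, Q := NormalForm.wordS s' } : Tapes n m).get)
      ((8 * homBound R + 14) * u.norm + (homBound R + 10) *
        ((NormalForm.wordS s : Word n m).length + (NormalForm.wordS s' : Word n m).length) + 20) := by
  set t : Tapes n m := { U := NormalForm.wordTD u, C := C, P := (NormalForm.wordS s).reverse
                         Y := Y, Q := NormalForm.wordS s' } with ht
  have hU : t.U = NormalForm.wordTD u := rfl
  set b := signTwist R (v.lst.map Prod.snd) u with hb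
  set a := signTwist R v.sgn u with ha
  have r1 := run_mulHomInv (k := Stk.U) (x := Stk.X) (z := Stk.Z) (N := homBound R)
    (v := v) (S := t.get) (w := 1) (ψ := fun v => signTwistG R (v.lst.map Prod.snd))
    (by decide) (by decide) (by decide) (fun _ => rfl) (letterBound_signTwistG_le R _)
    FreeGroup.toWord_one.symm rfl
  have r2 := run_mulHomRev (k := Stk.P) (x := Stk.T) (z := Stk.Z) (N := homBound R)
    (v := { v with reg := none }) (S := ({ t with Z := ((embS b)⁻¹ * 1).toWord } : Tapes n m).get)
    (ψ := fun v => MonoidHom.id _)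
    (by decide) (by decide) (by decide) (fun _ => rfl) (letterBound_id_le R) rfl rfl
  have r3 := run_mulHom (k := Stk.U) (x := Stk.X) (z := Stk.Z) (N := homBound R)
    (v := { v with reg := none })
    (S := ({ t with Z := (embS s * ((embS b)⁻¹ * 1)).toWord } : Tapes n m).get)
    (ψ := fun v => signTwistG R v.sgn)
    (by decide) (by decide) (by decide) (fun _ => rfl) (letterBound_signTwistG_le R _) rfl rfl
  have r4 := run_mulHom (k := Stk.Q) (x := Stk.T) (z := Stk.Z) (N := homBound R)
    (v := { v with reg := none })
    (S := ({ t with Z := (embS a * (embS s * ((embS b)⁻¹ * 1))).toWord } : Tapes n m).get)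
    (ψ := fun v => MonoidHom.id _)
    (by decide) (by decide) (by decide) (fun _ => rfl) (letterBound_id_le R) rfl rfl
  have r5 := run_testEmpty Stk.Z
    (fun v b => v.fst.any fun x => v.lst.any fun y => decide (x.2 ≠ y.2) && b)
    { v with reg := none } ({ t with Z := (embS s' * (embS a *
      (embS s * ((embS b)⁻¹ * 1)))).toWord } : Tapes n m).get (fun _ _ => rfl)
  have hmk : FreeGroup.mk t.U = embTD u := mk_wordTD u
  have hP : FreeGroup.mk t.P.reverse = embS s := by
    rw [ht]; simp only [List.reverse_reverse, mk_wordS]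
  have hQ : FreeGroup.mk t.Q = embS s' := mk_wordS s'
  simp only [Tapes.get_U, Tapes.get_P, Tapes.get_Q, Tapes.get_Z, Tapes.update_Z, hmk, hP, hQ,
    signTwistG_embTD, MonoidHom.id_apply, ← ha, ← hb] at r1 r2 r3 r4 r5
  refine (Run.seq r1 (Run.seq r2 (Run.seq r3 (Run.seq r4 r5)))).congr ?_ rfl ?_
  · have : (embS s' * (embS a * (embS s * ((embS b)⁻¹ * 1))) : FreeGroup (Gen n m)).toWord = [] ↔
        s' * a * s = b := by
      rw [FreeGroup.toWord_eq_nil_iff, mul_one, ← mul_assoc, ← mul_assoc, ← map_mul, ← map_mul,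
        mul_inv_eq_one, embS_injective.eq_iff]
    simp only [this]
  · have e1 : t.U.length = u.norm := length_wordTD u
    have e2 : t.P.length = (NormalForm.wordS s : Word n m).length := List.length_reverse
    have e3 : t.Q.length = (NormalForm.wordS s' : Word n m).length := rfl
    have e4 : (embS s' * (embS a * (embS s * ((embS b)⁻¹ * 1))) :
        FreeGroup (Gen n m)).toWord.length ≤ (NormalForm.wordS s' : Word n m).length +
          (NormalForm.wordS s : Word n m).length + 2 * (homBound R * u.norm) := by
      have h1 := FreeGroup.norm_mul_le (embS s' : FreeGroup (Gen n m))
        (embS a * (embS s * ((embS b)⁻¹ * 1)))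
      have h2 := FreeGroup.norm_mul_le (embS a : FreeGroup (Gen n m)) (embS s * ((embS b)⁻¹ * 1))
      have h3 := FreeGroup.norm_mul_le (embS s : FreeGroup (Gen n m)) ((embS b)⁻¹ * 1)
      have h4 : ((embS b)⁻¹ * 1 : FreeGroup (Gen n m)).norm ≤ homBound R * u.norm := by
        rw [mul_one, FreeGroup.norm_inv_eq]
        exact norm_embS_signTwist_le R _ u
      have h5 : (embS a : FreeGroup (Gen n m)).norm ≤ homBound R * u.norm :=
        norm_embS_signTwist_le R _ u
      rw [length_wordS, length_wordS]
      change FreeGroup.norm _ ≤ _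
      omega
    rw [e1, e2, e3]
    have e5 : (8 * homBound R + 14) * u.norm = 2 * ((homBound R + 7) * u.norm) +
      6 * (homBound R * u.norm) := by ring
    have e6 : ∀ k, (homBound R + 10) * k = (homBound R + 7) * k + 3 * k := fun k => by ring
    rw [e5, Nat.mul_add, e6, e6]
    omega

end SplitEnds

end Miller

/-! ### The iteration of Algorithm III -/

namespace Miller

section Loop

variable {n m : ℕ} (R : Fin m → FreeGroup (Fin n))

open Prog

/-- Pass to the next word in Algorithm III, and count this on `C`. -/
def advance : Pg n m :=
  seq (clear Stk.P) (seq (clear Stk.Q) (seq (mv Stk.Y Stk.W) (seq (push Stk.C fun _ => [default])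
    (set fun v => { sgn := v.fst.map Prod.snd, flag := true }))))

lemma run_advance (v : St n m) (U C P Y Q : Word n m) :
    Run advance (v, ({ U := U, C := C, P := P, Y := Y, Q := Q } : Tapes n m).get)
      ({ sgn := v.fst.map Prod.snd, flag := true },
        ({ U := U, C := default :: C, W := Y.reverse } : Tapes n m).get)
      (3 * P.length + 3 * Y.length + 3 * Q.length + 8) := by
  have r1 := run_clear Stk.P v ({ U := U, C := C, P := P, Y := Y, Q := Q } : Tapes n m).get
  have r2 := run_clear Stk.Q { v with reg := none }
    ({ U := U, C := C, Y := Y, Q := Q } : Tapes n m).get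
  have r3 := run_mv (show Stk.Y ≠ Stk.W by decide) { v with reg := none }
    ({ U := U, C := C, Y := Y } : Tapes n m).get
  have r4 := run_push Stk.C (fun _ => [default]) { v with reg := none }
    ({ U := U, C := C, W := Y.reverse } : Tapes n m).get
  simp only [Tapes.get_P, Tapes.get_Q, Tapes.get_Y, Tapes.get_W, Tapes.get_C, Tapes.update_P,
    Tapes.update_Q, Tapes.update_Y, Tapes.update_W, Tapes.update_C, List.append_nil] at r1 r2 r3 r4
  exact (Run.seq r1 (Run.seq r2 (Run.seq r3 (Run.seq r4 (run_set _ _ _))))).congr rfl rfl (by omega)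

/-- One round of Algorithm III; the flag records whether the test has succeeded. -/
noncomputable def iterStep : Pg n m :=
  seq splitEnds (seq (testPinch R) (ite (fun v => v.flag) advance
    (seq joinEnds (set fun v => { sgn := v.sgn }))))

/-- A bound for the time of one round. -/
noncomputable def roundTime (a b : ℕ) : ℕ := (8 * homBound R + 14) * a + (homBound R + 25) * b + 43

lemma run_iterStep (β : Option Bool) (u : FreeGroup (Fin m ⊕ Fin n)) (C : Word n m)
    (s : FreeGroup (Fin n)) (tail : List (Bool × FreeGroup (Fin n))) :
    ∃ v W C', Run (iterStep R) ({ sgn := β, flag := true },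
        ({ U := NormalForm.wordTD u, C := C, W := sylWord s tail } : Tapes n m).get)
      (v, ({ U := NormalForm.wordTD u, C := C', W := W } : Tapes n m).get)
      (roundTime R u.norm (sylWord s tail : Word n m).length) ∧
      ((pinchStep R u (signTwist R β u) s tail = none ∧ v = { sgn := β } ∧ C' = C ∧
          W = sylWord s tail) ∨
        ∃ ε s₁ t, pinchStep R u (signTwist R β u) s tail = some (ε, s₁, t) ∧
          v = { sgn := some ε, flag := true } ∧ C' = default :: C ∧ W = sylWord s₁ t) := by
  obtain ⟨f, l, Y, s', r1, h1, h2, h3⟩ := run_splitEnds β (NormalForm.wordTD u) C s tail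
  have r2 := run_testPinch R { sgn := β, flag := true, fst := f, lst := l } u s s' Y C
  simp only at r2
  have hlen := congrArg List.length h1
  simp only [List.length_append, List.length_reverse] at hlen
  have e6 : (homBound R + 25) * (sylWord s tail : Word n m).length =
      (homBound R + 10) * (sylWord s tail : Word n m).length +
      15 * (sylWord s tail : Word n m).length := by ring
  have e7 : (homBound R + 10) *
        ((NormalForm.wordS s : Word n m).length + (NormalForm.wordS s' : Word n m).length) ≤
      (homBound R + 10) * (sylWord s tail : Word n m).length :=
    Nat.mul_le_mul_left _ (by omega)
  cases hflag : f.any fun x => l.any fun y => decide (x.2 ≠ y.2) &&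
      decide (s' * signTwist R β u * s = signTwist R (l.map Prod.snd) u) with
  | false =>
    rw [hflag] at r2
    have r3 := run_joinEnds ({ sgn := β, fst := f, lst := l } : St n m)
      (NormalForm.wordTD u) C (NormalForm.wordS s).reverse Y (NormalForm.wordS s')
    refine ⟨_, _, _, (Run.seq r1 (Run.seq r2 (Run.iteFalse rfl
      (Run.seq r3 (run_set _ _ _))))).mono ?_, Or.inl ⟨?_, rfl, rfl, ?_⟩⟩
    · rw [roundTime, List.length_reverse]
      omega
    · rcases f with _ | x
      · have := h2 (Or.inl rfl)
        rcases tail with _ | ⟨p, _ | ⟨q, t⟩⟩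
        · rfl
        · rfl
        · simp at this
      · rcases l with _ | y
        · have := h2 (Or.inr rfl)
          rcases tail with _ | ⟨p, _ | ⟨q, t⟩⟩
          · rfl
          · rfl
          · simp at this
        · obtain ⟨s₁, t, rfl, -⟩ := h3 x y rfl rfl
          rw [pinchStep, List.getLast?_concat]
          have : ¬ (x.2 ≠ y.2 ∧ s' * signTwist R β u * s = twist R y.2 u) := by
            rintro ⟨h4, h5⟩
            have h6 : s' * signTwist R β u * s = signTwist R (some y.2) u := h5
            simp [h4, h6] at hflag
          simp only [if_neg this]
    · rw [h1, List.reverse_reverse]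
  | true =>
    rw [hflag] at r2
    obtain ⟨x, rfl⟩ : ∃ x, f = some x := by
      cases f with
      | none => simp at hflag
      | some x => exact ⟨x, rfl⟩
    obtain ⟨y, rfl⟩ : ∃ y, l = some y := by
      cases l with
      | none => simp at hflag
      | some x => exact ⟨x, rfl⟩
    obtain ⟨s₁, t, rfl, rfl⟩ := h3 x y rfl rfl
    have r3 := run_advance ({ sgn := β, fst := some x, lst := some y, flag := true } : St n m)
      (NormalForm.wordTD u) C (NormalForm.wordS s).reverse (sylWord s₁ t).reverse
      (NormalForm.wordS s')
    refine ⟨_, _, _, (Run.seq r1 (Run.seq r2 (Run.iteTrue rfl r3))).mono ?_,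
      Or.inr ⟨x.2, s₁, t, ?_, rfl, rfl, ?_⟩⟩
    · simp only [roundTime, List.length_reverse] at hlen ⊢
      omega
    · rw [pinchStep, List.getLast?_concat]
      have : x.2 ≠ y.2 ∧ s' * signTwist R β u * s = twist R y.2 u := by
        simp only [Option.any_some, Bool.and_eq_true, decide_eq_true_eq] at hflag
        exact hflag
      simp only [if_pos this, List.dropLast_concat]
    · rw [List.reverse_reverse]

/-- The iteration in Algorithm III. -/
noncomputable def iterLoop : Pg n m :=
  seq (set fun _ => { flag := true }) (loop (fun v => v.flag) (iterStep R))

/-- The normal form that is represented by the contents of the stacks during the iteration. -/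
def loopForm (β : Option Bool) (r : ℕ) (u : FreeGroup (Fin m ⊕ Fin n)) (s : FreeGroup (Fin n))
    (tail : List (Bool × FreeGroup (Fin n))) (h : TailReduced tail) : NormalForm n m :=
  conjForm R u (u ^ r) (signTwist R β (u ^ r)) (signTwist R β u) s tail h

/-- Every success removes two syllables, and the stacks hold only a segment of the original word, so
each round is bounded by the cost for the original length `L`. Correctness is handed backwards:
whatever Algorithm III returns from the last form, it also returns from the first. -/
lemma exists_run_loop (u : FreeGroup (Fin m ⊕ Fin n)) (L : ℕ) (k : ℕ) :
    ∀ (β : Option Bool) (C : Word n m) (s : FreeGroup (Fin n))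
    (tail : List (Bool × FreeGroup (Fin n))) (h : TailReduced tail), tail.length ≤ k →
    (sylWord s tail : Word n m).length ≤ L →
    ∃ β' C' s' tail', ∃ h' : TailReduced tail',
      Run (loop (fun v => v.flag) (iterStep R)) ({ sgn := β, flag := true },
        ({ U := NormalForm.wordTD u, C := C, W := sylWord s tail } : Tapes n m).get)
      ({ sgn := β' },
        ({ U := NormalForm.wordTD u, C := C', W := sylWord s' tail' } : Tapes n m).get)
      ((k + 1) * (roundTime R u.norm L + 1) + 1) ∧
      pinchStep R u (signTwist R β' u) s' tail' = none ∧
      (∀ y, AlgorithmIII R (loopForm R β' C'.length u s' tail' h') y →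
        AlgorithmIII R (loopForm R β C.length u s tail h) y) ∧
      C'.length ≤ C.length + tail.length ∧ tail'.length ≤ tail.length ∧
      (sylWord s' tail' : Word n m).length ≤ L := by
  induction k with
  | zero =>
    intro β C s tail h hk hL
    obtain ⟨v, W, C', r, ⟨h1, rfl, rfl, rfl⟩ | ⟨ε, s₁, t, h1, rfl, rfl, rfl⟩⟩ :=
      run_iterStep R β u C s tail
    · refine ⟨β, C', s, tail, h, ?_, h1, fun y hy => hy, Nat.le_add_right _ _, le_rfl, hL⟩
      refine (Run.loopTrue rfl r (Run.loopFalse rfl)).mono ?_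
      have : roundTime R u.norm (sylWord s tail : Word n m).length ≤ roundTime R u.norm L := by
        unfold roundTime; gcongr
      omega
    -- The round is executed even without syllables, but then it cannot succeed.
    · obtain ⟨q, rfl, -, -⟩ := exists_of_pinchStep_eq_some R h1
      simp at hk
  | succ k ih =>
    intro β C s tail h hk hL
    have ht : roundTime R u.norm (sylWord s tail : Word n m).length ≤ roundTime R u.norm L := by
      unfold roundTime; gcongr
    have e : (k + 1 + 1) * (roundTime R u.norm L + 1) =
      (k + 1) * (roundTime R u.norm L + 1) + (roundTime R u.norm L + 1) := by ring
    obtain ⟨v, W, C', r, ⟨h1, rfl, rfl, rfl⟩ | ⟨ε, s₁, t, h1, rfl, rfl, rfl⟩⟩ :=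
      run_iterStep R β u C s tail
    · refine ⟨β, C', s, tail, h, ?_, h1, fun y hy => hy, Nat.le_add_right _ _, le_rfl, hL⟩
      refine (Run.loopTrue rfl r (Run.loopFalse rfl)).mono ?_
      omega
    · obtain ⟨q, rfl, hne, hq⟩ := exists_of_pinchStep_eq_some R h1
      have h' := tailReduced_of_pinch h
      have hlen : (sylWord s₁ t : Word n m).length ≤
          (sylWord s ((ε, s₁) :: (t ++ [q])) : Word n m).length := by
        rw [sylWord_cons_eq, sylWord_concat]
        simp only [List.length_append, List.length_cons]
        omega
      simp only [List.length_cons, List.length_append, List.length_nil] at hk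
      obtain ⟨β', C', s', tail', h'', r', a1, a2, a3, a4, a5⟩ :=
        ih (some ε) (default :: C) s₁ t h' (by omega) (hlen.trans hL)
      refine ⟨β', C', s', tail', h'', (Run.loopTrue rfl r r').mono (by omega), a1, ?_, ?_, ?_, a5⟩
      · intro y hy
        have := a2 y hy
        refine algorithmIII_step R h h' ((Commute.refl u).pow_right _) hne hq ?_
        -- The new factor `u * u ^ r` is the power recorded by the counter `C`, which has just
        -- received one more letter.
        rwa [← pow_succ']
      · simp only [List.length_cons, List.length_append, List.length_nil] at a3 ⊢
        omega
      · simp only [List.length_cons, List.length_append, List.length_nil] at a4 ⊢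
        omega

/-- The sign `none` selects the trivial twist; before the first round both the extra factor and the
conjugator are trivial. -/
lemma loopForm_zero (u : FreeGroup (Fin m ⊕ Fin n)) (s : FreeGroup (Fin n))
    (tail : List (Bool × FreeGroup (Fin n))) (h : TailReduced tail) :
    loopForm R none 0 u s tail h = ⟨u, s, tail, h⟩ := by
  refine elt_injective R ?_
  rw [loopForm, elt_conjForm R h ((Commute.refl u).pow_right _), elt_eq]
  simp [signTwist, mul_assoc]

lemma exists_run_iterLoop (x : NormalForm n m) :
    ∃ β C s tail, ∃ h : TailReduced tail,
      Run (iterLoop R) ({},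
        ({ U := NormalForm.wordTD x.u, W := sylWord x.s₀ x.tail } : Tapes n m).get)
      ({ sgn := β },
        ({ U := NormalForm.wordTD x.u, C := C, W := sylWord s tail } : Tapes n m).get)
      ((x.tail.length + 1) * (roundTime R x.u.norm (sylWord x.s₀ x.tail : Word n m).length + 1)
        + 2) ∧
      (tail ≠ [] → AlgorithmIII R x (loopForm R β C.length x.u s tail h)) ∧
      (∀ y, AlgorithmIII R (loopForm R β C.length x.u s tail h) y → AlgorithmIII R x y) ∧
      C.length ≤ x.tail.length ∧ tail.length ≤ x.tail.length ∧
      (sylWord s tail : Word n m).length ≤ (sylWord x.s₀ x.tail : Word n m).length := by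
  obtain ⟨β, C, s, tail, h, r, a1, a2, a3, a4, a5⟩ := exists_run_loop R x.u
    (sylWord x.s₀ x.tail : Word n m).length x.tail.length none [] x.s₀ x.tail x.chain le_rfl le_rfl
  have e : loopForm R none ([] : Word n m).length x.u x.s₀ x.tail x.chain = x :=
    loopForm_zero R x.u x.s₀ x.tail x.chain
  rw [e] at a2
  refine ⟨β, C, s, tail, h, (Run.seq (run_set _ _ _) r).mono (by omega), fun ht => a2 _ ?_, a2,
    by simpa using a3, a4, a5⟩
  exact algorithmIII_terminal R h ((Commute.refl _).pow_right _) ht a1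

end Loop

end Miller

/-! ### Writing out the postponed conjugation -/

namespace Miller

section Build

variable {n m : ℕ} (R : Fin m → FreeGroup (Fin n))

open Prog

/-- The homomorphism `u ↦ u * twist u` given by a sign, or the identity. -/
def signGraphG (β : Option Bool) : FreeGroup (Gen n m) →* FreeGroup (Gen n m) :=
  β.elim (MonoidHom.id _) (graphG R)

lemma letterBound_signGraphG_le (β : Option Bool) : letterBound (signGraphG R β) ≤ homBound R := by
  cases β
  · exact letterBound_id_le R
  · exact letterBound_graphG_le R _

lemma valG_signGraphG (β : Option Bool) (u : FreeGroup (Fin m ⊕ Fin n)) :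
    valG R (signGraphG R β (embTD u)) = ofTD R u * ofS R (signTwist R β u) := by
  cases β
  · simp [signGraphG, signTwist, valG_embTD]
  · exact valG_graphG R _ u

lemma norm_signGraphG_le (β : Option Bool) (u : FreeGroup (Fin m ⊕ Fin n)) :
    (signGraphG R β (embTD u)).norm ≤ homBound R * u.norm := by
  have := norm_map_le (signGraphG R β) (letterBound_signGraphG_le R β) (embTD u).toWord
  rwa [FreeGroup.mk_toWord, ← FreeGroup.norm, norm_embTD] at this

lemma qCount_inv (w : FreeGroup (Gen n m)) : qCount w⁻¹ = qCount w := by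
  rw [qCount, FreeGroup.toWord_inv, FreeGroup.invRev, List.countP_reverse, List.countP_map]
  rfl

lemma qCount_embTD (u : FreeGroup (Fin m ⊕ Fin n)) :
    qCount (embTD u : FreeGroup (Gen n m)) = 0 := by
  rw [qCount, toWord_embTD, List.countP_eq_zero]
  intro x hx
  obtain ⟨⟨i | j, b⟩, -, rfl⟩ := List.mem_map.mp hx <;> simp [isQ]

lemma qCount_signGraphG (β : Option Bool) (u : FreeGroup (Fin m ⊕ Fin n)) :
    qCount (signGraphG R β (embTD u)) = 0 := by
  cases β with
  | none => exact qCount_embTD u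
  | some ε =>
    change qCount (graphG R ε (embTD u)) = 0
    induction u using FreeGroup.induction_on with
    | C1 => simp [qCount]
    | inv_of x h => rw [map_inv, map_inv, qCount_inv]; exact h
    | mul x y hx hy =>
      have := qCount_mul_le (graphG R ε (embTD x)) (graphG R ε (embTD y))
      rw [map_mul, map_mul]
      omega
    | of x =>
      have h := twistG_embTD R ε (FreeGroup.of x)
      have h' : embTD (FreeGroup.of x) = (FreeGroup.of (Sum.elim Gen.t Gen.d x) :
        FreeGroup (Gen n m)) := by simp [embTD]
      have e : graphG R ε (embTD (FreeGroup.of x)) =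
          embTD (FreeGroup.of x) * embS (twist R ε (FreeGroup.of x)) := by
        rw [h', graphG, FreeGroup.lift_apply_of, ← h', h]
      have := qCount_mul_le (embTD (FreeGroup.of x)) (embS (twist R ε (FreeGroup.of x)) :
        FreeGroup (Gen n m))
      rw [qCount_embTD, qCount_embS] at this
      rw [e]
      omega

lemma qCount_pow {w : FreeGroup (Gen n m)} (h : qCount w = 0) (r : ℕ) : qCount (w ^ r) = 0 := by
  induction r with
  | zero => simp [qCount]
  | succ r ih =>
    have := qCount_mul_le (w ^ r) w
    rw [pow_succ]
    omega

lemma norm_pow_le (w : FreeGroup (Gen n m)) (r : ℕ) : (w ^ r).norm ≤ r * w.norm := by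
  induction r with
  | zero => simp
  | succ r ih =>
    have := FreeGroup.norm_mul_le (w ^ r) w
    rw [pow_succ, Nat.succ_mul]
    omega

/-- Write the element that is represented by the contents of the stacks during the iteration as a
word on `I`. -/
noncomputable def buildWord : Pg n m :=
  seq (forEach Stk.C (seq (push Stk.Q fun v => v.reg.toList)
    (mulHom Stk.U Stk.X Stk.I (homBound R) fun v => signGraphG R v.sgn)))
  (seq (mulHom Stk.W Stk.T Stk.I (homBound R) fun _ => MonoidHom.id _)
  (seq (clear Stk.W)
  (seq (mulHom Stk.U Stk.X Stk.I (homBound R) fun v => signTwistG R v.sgn)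
  (seq (mulHom Stk.U Stk.X Stk.I (homBound R) fun _ => MonoidHom.id _)
  (seq (forEach Stk.Q (mulHomInv Stk.U Stk.X Stk.I (homBound R) fun v => signGraphG R v.sgn))
  (seq (clear Stk.U) (set fun _ => {})))))))

/-- The word is assembled from its right end. The first loop consumes the unary counter `C` but
copies it to `Q`, so that the inverse of the conjugator can be applied the same number of times at
the left end. -/
lemma run_buildWord (β : Option Bool) (u : FreeGroup (Fin m ⊕ Fin n)) (C W : Word n m) :
    Run (buildWord R) ({ sgn := β }, ({ U := NormalForm.wordTD u, C := C, W := W } : Tapes n m).get)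
      ({}, ({ I := ((signGraphG R β (embTD u) ^ C.length)⁻¹ * (embTD u *
        (embS (signTwist R β u) * (FreeGroup.mk W *
          signGraphG R β (embTD u) ^ C.length)))).toWord } : Tapes n m).get)
      ((2 * C.length + 2) * ((homBound R + 7) * u.norm + 7) + (homBound R + 10) * W.length +
        3 * u.norm + 15) := by
  set b := signGraphG R β (embTD u) with hb
  set N := homBound R with hN
  have hU : FreeGroup.mk (NormalForm.wordTD u) = embTD u := mk_wordTD u
  have r1 := run_forEach (k := Stk.C) (body := seq (push Stk.Q fun v => v.reg.toList)
    (mulHom Stk.U Stk.X Stk.I N fun v => signGraphG R v.sgn)) (v := { sgn := β }) (L := C)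
    (fun d l => ({ U := NormalForm.wordTD u, W := W, C := l, Q := d, I := (b ^ d.length).toWord } :
      Tapes n m).get) (fun _ => (N + 7) * u.norm + 5) (fun d l => rfl) (fun d x l _ => ⟨none, by
      have h1 := run_push Stk.Q (fun v => v.reg.toList) { sgn := β, reg := some x }
        ({ U := NormalForm.wordTD u, W := W, C := l, Q := d, I := (b ^ d.length).toWord } :
          Tapes n m).get
      have h2 := run_mulHom (k := Stk.U) (x := Stk.X) (z := Stk.I) (N := N)
        (v := { sgn := β, reg := some x }) (S := ({ U := NormalForm.wordTD u, W := W, C := l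
                                                    Q := x :: d
                                                    I := (b ^ d.length).toWord } : Tapes n m).get)
        (ψ := fun v => signGraphG R v.sgn)
        (by decide) (by decide) (by decide) (fun _ => rfl) (letterBound_signGraphG_le R _) rfl rfl
      simp only [Tapes.get_U, Tapes.get_Q, Tapes.update_I, Tapes.update_Q, hU, ← hb, ← pow_succ',
        length_wordTD] at h1 h2
      rw [Tapes.update_C]
      exact (Run.seq h1 h2).congr (t' := (N + 7) * u.norm + 5) rfl rfl (by omega)⟩)
  have r2 := run_mulHom (k := Stk.W) (x := Stk.T) (z := Stk.I) (N := N)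
    (v := { sgn := β }) (S := ({ U := NormalForm.wordTD u, W := W, Q := C.reverse
                                 I := (b ^ C.reverse.length).toWord } : Tapes n m).get)
    (ψ := fun _ => MonoidHom.id _)
    (by decide) (by decide) (by decide) (fun _ => rfl) (letterBound_id_le R) rfl rfl
  have r3 := run_clear Stk.W { sgn := β } ({ U := NormalForm.wordTD u, W := W, Q := C.reverse
                                             I := (FreeGroup.mk W * b ^ C.length).toWord } :
    Tapes n m).get
  have r4 := run_mulHom (k := Stk.U) (x := Stk.X) (z := Stk.I) (N := N)
    (v := { sgn := β }) (S := ({ U := NormalForm.wordTD u, Q := C.reverse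
                                 I := (FreeGroup.mk W * b ^ C.length).toWord } : Tapes n m).get)
    (ψ := fun v => signTwistG R v.sgn)
    (by decide) (by decide) (by decide) (fun _ => rfl) (letterBound_signTwistG_le R _) rfl rfl
  have r5 := run_mulHom (k := Stk.U) (x := Stk.X) (z := Stk.I) (N := N)
    (v := { sgn := β }) (S := ({ U := NormalForm.wordTD u, Q := C.reverse
                                 I := (embS (signTwist R β u) *
                                  (FreeGroup.mk W * b ^ C.length)).toWord } : Tapes n m).get)
    (ψ := fun _ => MonoidHom.id _)
    (by decide) (by decide) (by decide) (fun _ => rfl) (letterBound_id_le R) rfl rfl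
  set w := (embTD u * (embS (signTwist R β u) * (FreeGroup.mk W * b ^ C.length))) with hw
  have r6 := run_forEach (k := Stk.Q)
    (body := mulHomInv Stk.U Stk.X Stk.I N fun v => signGraphG R v.sgn) (v := { sgn := β })
    (L := C.reverse) (fun d l => ({ U := NormalForm.wordTD u, Q := l
                                    I := ((b ^ d.length)⁻¹ * w).toWord } :
      Tapes n m).get) (fun _ => (N + 7) * u.norm + 4) (fun d l => rfl) (fun d x l _ => ⟨none, by
      have h2 := run_mulHomInv (k := Stk.U) (x := Stk.X) (z := Stk.I) (N := N)
        (v := { sgn := β, reg := some x }) (S := ({ U := NormalForm.wordTD u, Q := l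
                                                    I := ((b ^ d.length)⁻¹ * w).toWord } :
          Tapes n m).get)
        (ψ := fun v => signGraphG R v.sgn)
        (by decide) (by decide) (by decide) (fun _ => rfl) (letterBound_signGraphG_le R _) rfl rfl
      simp only [Tapes.get_U, Tapes.update_I, hU, ← hb, length_wordTD] at h2
      have e : b⁻¹ * ((b ^ d.length)⁻¹ * w) = (b ^ (d.length + 1))⁻¹ * w := by
        rw [pow_succ, mul_inv_rev, mul_assoc]
      rw [e] at h2
      rw [Tapes.update_Q]
      exact h2⟩)
  have r7 := run_clear Stk.U { sgn := β } ({ U := NormalForm.wordTD u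
                                             I := ((b ^ C.length)⁻¹ * w).toWord } :
    Tapes n m).get
  simp only [Tapes.get_U, Tapes.get_W, Tapes.update_U, Tapes.update_W, Tapes.update_I, hU,
    length_wordTD, signTwistG_embTD, MonoidHom.id_apply, List.length_reverse, List.reverse_reverse,
    List.length_nil, pow_zero, inv_one, one_mul, FreeGroup.toWord_one, List.map_const',
    List.sum_replicate, smul_eq_mul, ← hw] at r1 r2 r3 r4 r5 r6 r7
  refine (Run.seq r1 (Run.seq r2 (Run.seq r3 (Run.seq r4 (Run.seq r5 (Run.seq r6
    (Run.seq r7 (run_set _ _ _)))))))).mono ?_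
  have e6 : (N + 10) * W.length = (N + 7) * W.length + 3 * W.length := by ring
  have e7 : (2 * C.length + 2) * ((N + 7) * u.norm + 7) =
    C.length * ((N + 7) * u.norm + 5 + 2) + C.length * ((N + 7) * u.norm + 4 + 2) + C.length +
      2 * ((N + 7) * u.norm) + 14 := by ring
  rw [e6, e7]
  omega

/-- The conjugator is the power `graphHom R ε u ^ r`, or `u ^ r` without a sign. It contains no
letter q and has length O(r|u|), so writing it out keeps the length quadratic and does not increase
the number of letters q. -/
lemma exists_run_buildWord (β : Option Bool) (u : FreeGroup (Fin m ⊕ Fin n)) (C : Word n m)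
    (s : FreeGroup (Fin n)) (tail : List (Bool × FreeGroup (Fin n))) (h : TailReduced tail) :
    ∃ l : Word n m, val R l = (loopForm R β C.length u s tail h).elt R ∧
      l.countP isQ ≤ tail.length ∧
      l.length ≤ (2 * C.length + 2) * homBound R * u.norm + (sylWord s tail : Word n m).length ∧
      Run (buildWord R) ({ sgn := β }, ({ U := NormalForm.wordTD u, C := C
                                          W := sylWord s tail } : Tapes n m).get)
      ({}, ({ I := l } : Tapes n m).get)
      ((2 * C.length + 2) * ((homBound R + 7) * u.norm + 7) +
        (homBound R + 10) * (sylWord s tail : Word n m).length + 3 * u.norm + 15) := by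
  refine ⟨_, ?_, ?_, ?_, run_buildWord R β u C _⟩
  · rw [loopForm, elt_conjForm R h ((Commute.refl u).pow_right _), ← valG_mk, FreeGroup.mk_toWord]
    have e : ofTD R (u ^ C.length) * ofS R (signTwist R β (u ^ C.length)) =
        valG R (signGraphG R β (embTD u)) ^ C.length := by
      rw [← valG_signGraphG, map_pow, map_pow, map_pow]
    rw [e]
    simp only [map_mul, map_inv, map_pow, valG_embTD, valG_embS, valG_mk, val_sylWord, mul_assoc]
  · have h0 := qCount_pow (qCount_signGraphG R β u) C.length
    have h1 := qCount_mul_le (FreeGroup.mk (sylWord s tail))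
      (signGraphG R β (embTD u) ^ C.length)
    have h2 := qCount_mul_le (embS (signTwist R β u)) (FreeGroup.mk (sylWord s tail) *
      signGraphG R β (embTD u) ^ C.length)
    have h3 := qCount_mul_le (embTD u) (embS (signTwist R β u) * (FreeGroup.mk (sylWord s tail) *
      signGraphG R β (embTD u) ^ C.length))
    have h4 := qCount_mul_le (signGraphG R β (embTD u) ^ C.length)⁻¹
      (embTD u * (embS (signTwist R β u) * (FreeGroup.mk (sylWord s tail) *
      signGraphG R β (embTD u) ^ C.length)))
    have h5 : qCount (FreeGroup.mk (sylWord s tail) : FreeGroup (Gen n m)) ≤ tail.length := by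
      rw [← countP_sylWord (m := m) s]; exact qCount_mk_le _
    rw [qCount_inv] at h4
    rw [qCount_embTD] at h3
    rw [qCount_embS] at h2
    exact h4.trans (by omega)
  · have h0 := (norm_pow_le (signGraphG R β (embTD u)) C.length).trans
      (Nat.mul_le_mul_left _ (norm_signGraphG_le R β u))
    have h1 := FreeGroup.norm_mul_le (FreeGroup.mk (sylWord s tail))
      (signGraphG R β (embTD u) ^ C.length)
    have h2 := FreeGroup.norm_mul_le (embS (signTwist R β u)) (FreeGroup.mk (sylWord s tail) *
      signGraphG R β (embTD u) ^ C.length)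
    have h3 := FreeGroup.norm_mul_le (embTD u) (embS (signTwist R β u) *
      (FreeGroup.mk (sylWord s tail) * signGraphG R β (embTD u) ^ C.length))
    have h4 := FreeGroup.norm_mul_le (signGraphG R β (embTD u) ^ C.length)⁻¹
      (embTD u * (embS (signTwist R β u) * (FreeGroup.mk (sylWord s tail) *
      signGraphG R β (embTD u) ^ C.length)))
    have h5 : (FreeGroup.mk (sylWord s tail) : FreeGroup (Gen n m)).norm ≤
      (sylWord s tail : Word n m).length := FreeGroup.norm_mk_le
    have h6 := norm_embS_signTwist_le R β u
    have h7 : u.norm ≤ homBound R * u.norm := Nat.le_mul_of_pos_left _ (by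
      unfold homBound; omega)
    rw [FreeGroup.norm_inv_eq] at h4
    rw [norm_embTD] at h3
    have e : (2 * C.length + 2) * homBound R * u.norm = 2 * (C.length * (homBound R * u.norm)) +
      2 * (homBound R * u.norm) := by ring
    rw [e]
    exact h4.trans (by omega)

end Build

end Miller

/-! ### A program for cyclic reduction -/

namespace Miller

section Peel

variable {n m : ℕ}

open Prog

/-- Pop letters from `Z` and `X` into the registers. -/
def fetch : Pg n m :=
  seq (pop Stk.Z) (seq (set fun v => { v with fst := v.reg })
    (seq (pop Stk.X) (set fun v => { v with lst := v.reg, reg := none })))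

lemma run_fetch (v : St n m) (t : Tapes n m) :
    Run fetch (v, t.get) ({ v with reg := none, fst := t.Z.head?, lst := t.X.head? },
      ({ t with Z := t.Z.tail, X := t.X.tail } : Tapes n m).get) 4 := by
  have r1 := run_pop Stk.Z v t.get
  have r2 := run_set (fun v : St n m => { v with fst := v.reg })
    ({ v with reg := t.Z.head? }) ({ t with Z := t.Z.tail } : Tapes n m).get
  have r3 := run_pop Stk.X ({ v with reg := t.Z.head?, fst := t.Z.head? })
    ({ t with Z := t.Z.tail } : Tapes n m).get
  simp only [Tapes.get_Z, Tapes.get_X, Tapes.update_Z, Tapes.update_X] at r1 r2 r3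
  exact Run.seq r1 (Run.seq r2 (Run.seq r3 (run_set _ _ _)))

/-- Do the letters in the registers cancel? -/
noncomputable def cancelling (v : St n m) : Bool :=
  v.fst.any fun x => v.lst.any fun y => decide (y = letterInv x)

/-- The current heads of both words sit in the registers and the tails on the stacks. Only the
number of letters on `Q` matters, as a unary record of how many have cancelled. -/
lemma run_loop_fetch (b : Bool) (t : Tapes n m) (l : List (Letter n m)) :
    ∀ (l' q : List (Letter n m)), ∃ l₁ l₂ o, l₁.length ≤ l'.length ∧
    l₂.length = q.length + peelCount l l' ∧
    Run (loop cancelling (seq (push Stk.Q fun v => v.fst.toList) fetch))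
      ({ flag := b, fst := l.head?, lst := l'.head? },
        ({ t with Z := l.tail, X := l'.tail, Q := q } : Tapes n m).get)
      ({ flag := b, fst := (l.drop (peelCount l l')).head?, lst := o },
        ({ t with Z := (l.drop (peelCount l l')).tail, X := l₁, Q := l₂ } : Tapes n m).get)
      (6 * l.length + 1) := by
  induction l with
  | nil =>
    intro l' q
    refine ⟨l'.tail, q, l'.head?, by simp, by simp [peelCount], ?_⟩
    exact (Run.loopFalse (by rfl)).mono (by simp)
  | cons x l ih =>
    intro l' q
    by_cases h : ∃ l'', l' = letterInv x :: l''
    · obtain ⟨l', rfl⟩ := h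
      obtain ⟨l₁, l₂, o, h1, h2, r⟩ := ih l' (x :: q)
      refine ⟨l₁, l₂, o, h1.trans (Nat.le_succ _), ?_, ?_⟩
      · rw [h2]; simp [peelCount]; omega
      · have r1 := run_push Stk.Q (fun v => v.fst.toList)
          { flag := b, fst := some x, lst := some (letterInv x) }
          ({ t with Z := l, X := l', Q := q } : Tapes n m).get
        have r2 := run_fetch { flag := b, fst := some x, lst := some (letterInv x) }
          ({ t with Z := l, X := l', Q := x :: q } : Tapes n m)
        simp only [Tapes.get_Q, Tapes.update_Q] at r1
        refine (Run.loopTrue ?_ (Run.seq r1 r2) r).congr ?_ ?_ ?_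
        · simp [cancelling]
        · simp [peelCount]
        · simp [peelCount]
        · simp only [List.length_cons]; omega
    · have h0 : peelCount (x :: l) l' = 0 := by
        cases l' with
        | nil => rfl
        | cons y l' =>
          rw [peelCount, if_neg]
          rintro rfl
          exact h ⟨l', rfl⟩
      refine ⟨l'.tail, q, l'.head?, by simp, by simp [h0], ?_⟩
      rw [h0]
      refine (Run.loopFalse ?_).mono (by omega)
      cases l' with
      | nil => simp [cancelling]
      | cons y l' =>
        have : y ≠ letterInv x := fun e => h ⟨l', by rw [e]⟩
        simp [cancelling, this]

/-- Replace the word on `Z` by its cyclic reduction. -/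
noncomputable def cycReduce : Pg n m :=
  seq (forEach Stk.Z (seq (push Stk.T fun v => v.reg.toList) (push Stk.X fun v => v.reg.toList)))
  (seq (mv Stk.T Stk.Z)
  (seq fetch
  (seq (loop cancelling (seq (push Stk.Q fun v => v.fst.toList) fetch))
  (seq (push Stk.Z fun v => v.fst.toList)
  (seq (clear Stk.X)
  (seq (mv Stk.Z Stk.T)
  (seq (forEach Stk.Q (pop Stk.T))
  (seq (mv Stk.T Stk.Z) (set fun v => { flag := v.flag })))))))))

lemma peelCount_le (l l' : List (Letter n m)) : peelCount l l' ≤ l.length := by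
  induction l generalizing l' with
  | nil => simp [peelCount]
  | cons x l ih =>
    cases l' with
    | nil => simp [peelCount]
    | cons y l' =>
      rw [peelCount]
      split_ifs
      · have := ih l'; rw [List.length_cons]; omega
      · omega

/-- Comparing the word with its reverse on `X` strips the front; after a reversal, as many letters
as are recorded on `Q` are cut off at the other end. `peel_eq_reduceCyclically` identifies the
result. -/
lemma run_cycReduce (b : Bool) (U W P l : Word n m) (hl : FreeGroup.IsReduced l) :
    Run cycReduce ({ flag := b }, ({ U := U, W := W, P := P, Z := l } : Tapes n m).get)
      ({ flag := b }, ({ U := U, W := W, P := P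
                         Z := FreeGroup.reduceCyclically l } : Tapes n m).get)
      (25 * l.length + 20) := by
  have r1 := run_forEach (k := Stk.Z) (body := seq (push Stk.T fun v => v.reg.toList)
    (push Stk.X fun v => v.reg.toList)) (v := { flag := b }) (L := l)
    (fun d l => ({ U := U, W := W, P := P, Z := l, T := d, X := d } : Tapes n m).get) (fun _ => 2)
    (fun _ _ => rfl) (fun d x l' _ => ⟨some x, by
      have h1 := run_push Stk.T (fun v => v.reg.toList) { flag := b, reg := some x }
        ({ U := U, W := W, P := P, Z := l', T := d, X := d } : Tapes n m).get
      have h2 := run_push Stk.X (fun v => v.reg.toList) { flag := b, reg := some x }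
        ({ U := U, W := W, P := P, Z := l', T := x :: d, X := d } : Tapes n m).get
      simp only [Tapes.get_T, Tapes.get_X, Tapes.update_T, Tapes.update_X] at h1 h2
      rw [Tapes.update_Z]
      exact Run.seq h1 h2⟩)
  have r2 := run_mv (show Stk.T ≠ Stk.Z by decide) { flag := b }
    ({ U := U, W := W, P := P, T := l.reverse, X := l.reverse } : Tapes n m).get
  have r3 := run_fetch { flag := b } ({ U := U, W := W, P := P, Z := l, X := l.reverse } : Tapes n m)
  obtain ⟨l₁, l₂, o, h1, h2, r4⟩ := run_loop_fetch b { U := U, W := W, P := P } l l.reverse []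
  set c := peelCount l l.reverse with hc
  have r5 := run_push Stk.Z (fun v => v.fst.toList)
    { flag := b, fst := (l.drop c).head?, lst := o }
    ({ U := U, W := W, P := P, Z := (l.drop c).tail, X := l₁, Q := l₂ } : Tapes n m).get
  have r6 := run_clear Stk.X { flag := b, fst := (l.drop c).head?, lst := o }
    ({ U := U, W := W, P := P, Z := (l.drop c), X := l₁, Q := l₂ } : Tapes n m).get
  have r7 := run_mv (show Stk.Z ≠ Stk.T by decide)
    { flag := b, fst := (l.drop c).head?, lst := o }
    ({ U := U, W := W, P := P, Z := (l.drop c), Q := l₂ } : Tapes n m).get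
  have r8 := run_forEach (k := Stk.Q) (body := pop Stk.T)
    (v := { flag := b, fst := (l.drop c).head?, lst := o }) (L := l₂)
    (fun d q => ({ U := U, W := W, P := P, T := (l.drop c).reverse.drop d.length, Q := q } :
      Tapes n m).get) (fun _ => 1)
    (fun _ _ => rfl) (fun d x l' _ => ⟨_, by
      have h1 := run_pop Stk.T { flag := b, fst := (l.drop c).head?, lst := o, reg := some x }
        ({ U := U, W := W, P := P, T := (l.drop c).reverse.drop d.length, Q := l' } :
          Tapes n m).get
      rw [Tapes.update_Q]
      simp only [Tapes.get_T, Tapes.update_T, List.tail_drop] at h1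
      exact h1⟩)
  have r9 := run_mv (show Stk.T ≠ Stk.Z by decide)
    { flag := b, fst := (l.drop c).head?, lst := o }
    ({ U := U, W := W, P := P, T := (l.drop c).reverse.drop c } : Tapes n m).get
  have hl2 : l₂.length = c := by simpa using h2
  have hhd : (l.drop c).head?.toList ++ (l.drop c).tail = l.drop c := by cases l.drop c <;> simp
  simp only [Tapes.get_T, Tapes.get_X, Tapes.get_Z, Tapes.update_T, Tapes.update_X,
    Tapes.update_Z, List.reverse_reverse, List.append_nil, hhd, List.length_nil, List.drop_zero,
    List.length_reverse, hl2, List.map_const', List.sum_replicate, smul_eq_mul,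
    List.length_drop] at r1 r2 r3 r4 r5 r6 r7 r8 r9
  refine (Run.seq r1 (Run.seq r2 (Run.seq r3 (Run.seq r4 (Run.seq r5 (Run.seq r6 (Run.seq r7
    (Run.seq r8 (Run.seq r9 (run_set _ _ _)))))))))).congr rfl ?_ ?_
  · rw [peel_eq_reduceCyclically hl]
  · rw [List.length_reverse] at h1
    have := peelCount_le l l.reverse
    omega

end Peel

end Miller

/-! ### Tests for equality and for conjugacy up to rotation -/

namespace Miller

section Base

variable {n m : ℕ} (R : Fin m → FreeGroup (Fin n))

open Prog

/-- F(S) is a retract of the free group on all generators: the homomorphism `ρ` kills every other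
generator and carries a conjugating element back to F(S). -/
lemma isConj_embS_iff {s t : FreeGroup (Fin n)} :
    IsConj (embS s : FreeGroup (Gen n m)) (embS t) ↔ IsConj s t := by
  refine ⟨fun h => ?_, fun h => embS.map_isConj h⟩
  let ρ : FreeGroup (Gen n m) →* FreeGroup (Fin n) := FreeGroup.lift fun x => match x with
    | Gen.s j => FreeGroup.of j
    | _ => 1
  have h1 : ∀ s, ρ (embS s) = s := fun s => by
    have : ρ.comp embS = MonoidHom.id _ := FreeGroup.ext_hom _ _ fun x => by simp [ρ, embS]
    exact DFunLike.congr_fun this s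
  have := ρ.map_isConj h
  rwa [h1, h1] at this

lemma length_reduceCyclically_le (l : Word n m) :
    (FreeGroup.reduceCyclically l).length ≤ l.length := by
  conv_rhs => rw [← FreeGroup.reduceCyclically.conj_conjugator_reduceCyclically l]
  simp only [List.length_append]
  omega

/-- Does the word on `W` agree with `twist u`? -/
noncomputable def eqTest (ε : Bool) : Pg n m :=
  seq (mulHom Stk.U Stk.X Stk.Z (homBound R) fun _ => twistG R ε)
  (seq (mulHomInv Stk.W Stk.T Stk.Z (homBound R) fun _ => MonoidHom.id _)
    (testEmpty Stk.Z fun v b => v.flag || b))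

/-- A bound for the time of a pass over the stacks. -/
noncomputable def passTime (a b : ℕ) : ℕ := (homBound R + 40) * (b + a + homBound R * a + 1)

lemma le_passTime {a b x : ℕ} (h : x ≤ b + a + homBound R * a) :
    homBound R * x + 40 * x + 40 ≤ passTime R a b := by
  have := Nat.mul_le_mul_left (homBound R + 40) h
  rw [Nat.add_mul] at this
  rw [passTime, Nat.mul_succ]
  omega

lemma run_eqTest (ε b : Bool) (u : FreeGroup (Fin m ⊕ Fin n)) (s : FreeGroup (Fin n)) :
    Run (eqTest R ε) ({ flag := b },
        ({ U := NormalForm.wordTD u, W := NormalForm.wordS s } : Tapes n m).get)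
      ({ flag := b || decide (s = twist R ε u) },
        ({ U := NormalForm.wordTD u, W := NormalForm.wordS s } : Tapes n m).get)
      (3 * passTime R u.norm (NormalForm.wordS s : Word n m).length) := by
  have r1 := run_mulHom (k := Stk.U) (x := Stk.X) (z := Stk.Z) (N := homBound R)
    (v := { flag := b }) (S := ({ U := NormalForm.wordTD u, W := NormalForm.wordS s } :
      Tapes n m).get) (w := 1) (ψ := fun _ => twistG R ε)
    (by decide) (by decide) (by decide) (fun _ => rfl) (letterBound_twistG_le R ε)
    FreeGroup.toWord_one.symm rfl
  have r2 := run_mulHomInv (k := Stk.W) (x := Stk.T) (z := Stk.Z) (N := homBound R)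
    (v := { flag := b }) (S := ({ U := NormalForm.wordTD u, W := NormalForm.wordS s
                                  Z := (embS (twist R ε u) * 1).toWord } : Tapes n m).get)
    (ψ := fun _ => MonoidHom.id _)
    (by decide) (by decide) (by decide) (fun _ => rfl) (letterBound_id_le R) rfl rfl
  have r3 := run_testEmpty Stk.Z (fun v b => v.flag || b) { flag := b }
    ({ U := NormalForm.wordTD u, W := NormalForm.wordS s
       Z := ((embS s)⁻¹ * (embS (twist R ε u) * 1)).toWord } : Tapes n m).get (fun _ _ => rfl)
  simp only [Tapes.get_U, Tapes.get_W, Tapes.get_Z, Tapes.update_Z, mk_wordTD, mk_wordS,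
    twistG_embTD, MonoidHom.id_apply, length_wordTD] at r1 r2 r3
  refine (Run.seq r1 (Run.seq r2 r3)).congr ?_ rfl ?_
  · have : ((embS s)⁻¹ * (embS (twist R ε u) * 1) : FreeGroup (Gen n m)).toWord = [] ↔
        s = twist R ε u := by
      rw [FreeGroup.toWord_eq_nil_iff, mul_one, inv_mul_eq_one, embS_injective.eq_iff]
    simp only [this]
  · have h1 : ((embS s)⁻¹ * (embS (twist R ε u) * 1) : FreeGroup (Gen n m)).toWord.length ≤
        (NormalForm.wordS s : Word n m).length + homBound R * u.norm := by
      have h1 := FreeGroup.norm_mul_le (embS s : FreeGroup (Gen n m))⁻¹ (embS (twist R ε u) * 1)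
      have h2 := norm_embS_twist_le R ε u
      rw [FreeGroup.norm_inv_eq] at h1
      rw [mul_one] at h1 ⊢
      rw [length_wordS]
      exact h1.trans (by omega)
    set L := (NormalForm.wordS s : Word n m).length
    have a1 := le_passTime R (show u.norm ≤ L + u.norm + homBound R * u.norm by omega)
    have a2 := le_passTime R (show L ≤ L + u.norm + homBound R * u.norm by omega)
    have a3 := le_passTime R (h1.trans (show _ ≤ L + u.norm + homBound R * u.norm by omega))
    rw [Nat.add_mul, Nat.add_mul]
    omega

/-- Compare the words on `P` (reversed) and `Z`. -/
noncomputable def cmpTest : Pg n m :=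
  seq (mulHomRev Stk.P Stk.T Stk.Y (homBound R) fun _ => MonoidHom.id _)
  (seq (mulHomInv Stk.Z Stk.T Stk.Y (homBound R) fun _ => MonoidHom.id _)
    (testEmpty Stk.Y fun v b => v.flag || b))

lemma run_cmpTest (b : Bool) (U W C p z : Word n m) :
    Run (cmpTest R) ({ flag := b },
        ({ U := U, W := W, P := p.reverse, Z := z, C := C } : Tapes n m).get)
      ({ flag := b || decide (FreeGroup.mk z = FreeGroup.mk p) },
        ({ U := U, W := W, P := p.reverse, Z := z, C := C } : Tapes n m).get)
      ((homBound R + 10) * (p.length + z.length) + 12) := by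
  have r1 := run_mulHomRev (k := Stk.P) (x := Stk.T) (z := Stk.Y) (N := homBound R)
    (v := { flag := b }) (S := ({ U := U, W := W, P := p.reverse, Z := z, C := C } :
      Tapes n m).get) (w := 1) (ψ := fun _ => MonoidHom.id _)
    (by decide) (by decide) (by decide) (fun _ => rfl) (letterBound_id_le R)
    FreeGroup.toWord_one.symm rfl
  have r2 := run_mulHomInv (k := Stk.Z) (x := Stk.T) (z := Stk.Y) (N := homBound R)
    (v := { flag := b }) (S := ({ U := U, W := W, P := p.reverse, Z := z, C := C
                                  Y := (FreeGroup.mk p * 1).toWord } : Tapes n m).get)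
    (w := FreeGroup.mk p * 1)
    (ψ := fun _ => MonoidHom.id _)
    (by decide) (by decide) (by decide) (fun _ => rfl) (letterBound_id_le R) rfl rfl
  have r3 := run_testEmpty Stk.Y (fun v b => v.flag || b) { flag := b }
    ({ U := U, W := W, P := p.reverse, Z := z, C := C
       Y := ((FreeGroup.mk z)⁻¹ * (FreeGroup.mk p * 1)).toWord } : Tapes n m).get (fun _ _ => rfl)
  simp only [Tapes.get_P, Tapes.get_Y, Tapes.get_Z, Tapes.update_Y, MonoidHom.id_apply,
    List.reverse_reverse, List.length_reverse] at r1 r2 r3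
  refine (Run.seq r1 (Run.seq r2 r3)).congr ?_ rfl ?_
  · have : ((FreeGroup.mk z)⁻¹ * (FreeGroup.mk p * 1) : FreeGroup (Gen n m)).toWord = [] ↔
        FreeGroup.mk z = FreeGroup.mk p := by
      rw [FreeGroup.toWord_eq_nil_iff, mul_one, inv_mul_eq_one]
    simp only [this]
  · have h1 := FreeGroup.norm_mul_le (FreeGroup.mk z : FreeGroup (Gen n m))⁻¹ (FreeGroup.mk p * 1)
    have h2 := FreeGroup.norm_mk_le (L₁ := z)
    have h3 := FreeGroup.norm_mk_le (L₁ := p)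
    rw [FreeGroup.norm_inv_eq, mul_one] at h1
    rw [mul_one]
    change _ + (_ + (3 * FreeGroup.norm _ + 4)) ≤ _
    simp only [Nat.add_mul, Nat.mul_add]
    omega

/-- Rotate the word on `Z`. -/
def rotateWord : Pg n m :=
  seq (pop Stk.Z) (seq (set fun v => { v with fst := v.reg }) (seq (mv Stk.Z Stk.T)
    (seq (push Stk.Z fun v => v.fst.toList) (seq (mv Stk.T Stk.Z)
      (set fun v => { flag := v.flag })))))

lemma run_rotateWord (b : Bool) (r : Option (Letter n m)) (U W C P z : Word n m) :
    Run rotateWord ({ flag := b, reg := r },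
        ({ U := U, W := W, P := P, Z := z, C := C } : Tapes n m).get)
      ({ flag := b }, ({ U := U, W := W, P := P, Z := z.rotate 1, C := C } : Tapes n m).get)
      (6 * z.length + 8) := by
  have r1 := run_pop Stk.Z { flag := b, reg := r }
    ({ U := U, W := W, P := P, Z := z, C := C } : Tapes n m).get
  have r2 := run_mv (show Stk.Z ≠ Stk.T by decide) { flag := b, reg := z.head?, fst := z.head? }
    ({ U := U, W := W, P := P, Z := z.tail, C := C } : Tapes n m).get
  have r3 := run_push Stk.Z (fun v => v.fst.toList) { flag := b, fst := z.head? }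
    ({ U := U, W := W, P := P, T := z.tail.reverse, C := C } : Tapes n m).get
  have r4 := run_mv (show Stk.T ≠ Stk.Z by decide) { flag := b, fst := z.head? }
    ({ U := U, W := W, P := P, T := z.tail.reverse, Z := z.head?.toList, C := C } :
      Tapes n m).get
  simp only [Tapes.get_T, Tapes.get_Z, Tapes.update_T, Tapes.update_Z, List.reverse_reverse,
    List.append_nil, List.length_reverse, List.length_tail] at r1 r2 r3 r4
  refine (Run.seq r1 (Run.seq (run_set _ _ _) (Run.seq r2 (Run.seq r3 (Run.seq r4
    (run_set _ _ _)))))).congr rfl ?_ (by omega)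
  cases z <;> simp

/-- Compare the word on `P` (reversed) with all rotations of the word on `Z`. -/
noncomputable def rotTest : Pg n m :=
  seq (mulHom Stk.Z Stk.T Stk.C (homBound R) fun _ => MonoidHom.id _)
  (seq (cmpTest R) (seq (forEach Stk.C (seq rotateWord (cmpTest R)))
  (seq (clear Stk.P) (clear Stk.Z))))

/-- A copy of `z` on `C` counts the rotations: one comparison precedes them and one follows each.
The number of comparisons depends on the length of `z` alone, so the shorter word should be put
there. -/
lemma run_rotTest (U W p z : Word n m) (hz : FreeGroup.IsReduced z) :
    ∃ b, (b = true ↔ ∃ i ≤ z.length,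
      FreeGroup.mk (z.rotate i) = (FreeGroup.mk p : FreeGroup (Gen n m))) ∧
    Run (rotTest R) ({}, ({ U := U, W := W, P := p.reverse, Z := z } : Tapes n m).get)
      ({ flag := b }, ({ U := U, W := W } : Tapes n m).get)
      ((z.length + 2) * ((homBound R + 20) * (p.length + z.length) + 30)) := by
  have hC : (FreeGroup.mk z * 1 : FreeGroup (Gen n m)).toWord = z := by
    rw [mul_one, FreeGroup.toWord_mk, hz.reduce_eq]
  -- The value of the flag after `k` rotations: has one of the first `k + 1` comparisons succeeded?
  let f : ℕ → Bool := fun k =>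
    (List.range (k + 1)).any fun i => decide (FreeGroup.mk (z.rotate i) = FreeGroup.mk p)
  have hf0 : f 0 = (false || decide (FreeGroup.mk z = FreeGroup.mk p)) := by simp [f]
  have hf : ∀ k, f (k + 1) =
      (f k || decide (FreeGroup.mk (z.rotate (k + 1)) = FreeGroup.mk p)) := fun k => by
    simp only [f]
    rw [List.range_succ (n := k + 1), List.any_append]
    simp
  have r1 := run_mulHom (k := Stk.Z) (x := Stk.T) (z := Stk.C) (N := homBound R)
    (v := {}) (S := ({ U := U, W := W, P := p.reverse, Z := z } : Tapes n m).get) (w := 1)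
    (ψ := fun _ => MonoidHom.id _)
    (by decide) (by decide) (by decide) (fun _ => rfl) (letterBound_id_le R)
    FreeGroup.toWord_one.symm rfl
  have r2 := run_cmpTest R false U W z p z
  have r3 := run_forEach_state (k := Stk.C) (body := seq rotateWord (cmpTest R)) (L := z)
    (fun d => { flag := f d.length })
    (fun d l => ({ U := U, W := W, P := p.reverse, Z := z.rotate d.length, C := l } :
      Tapes n m).get) (fun _ => 6 * z.length + 8 + ((homBound R + 10) * (p.length + z.length) + 12))
    (fun _ _ => rfl) (fun d x l _ => ⟨none, by
      have h1 := run_rotateWord (f d.length) (some x) U W l p.reverse (z.rotate d.length)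
      rw [List.rotate_rotate] at h1
      have h2 := run_cmpTest R (f d.length) U W l p (z.rotate (d.length + 1))
      rw [← hf, List.length_rotate] at h2
      rw [List.length_rotate] at h1
      rw [Tapes.update_C]
      exact Run.seq h1 h2⟩)
  have r4 := run_clear Stk.P { flag := f z.length } ({ U := U, W := W, P := p.reverse
                                                       Z := z } : Tapes n m).get
  have r5 := run_clear Stk.Z { flag := f z.length } ({ U := U, W := W, Z := z } : Tapes n m).get
  simp only [Tapes.get_Z, Tapes.get_P, Tapes.update_Z, Tapes.update_P, Tapes.update_C,
    MonoidHom.id_apply, hC, List.length_reverse, List.length_nil, List.rotate_zero,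
    List.rotate_length, List.map_const', List.sum_replicate, smul_eq_mul] at r1 r2 r3 r4 r5
  rw [← hf0] at r2
  refine ⟨f z.length, ?_, (Run.seq r1 (Run.seq r2 (Run.seq r3 (Run.seq r4 r5)))).mono ?_⟩
  · simp only [f, List.any_eq_true, List.mem_range, decide_eq_true_eq, Nat.lt_succ_iff]
  · have e1 : (z.length + 2) * ((homBound R + 20) * (p.length + z.length) + 30) =
      z.length * (6 * z.length + 8 + ((homBound R + 10) * (p.length + z.length) + 12) + 2) +
      z.length * (10 * p.length + 4 * z.length) + 8 * z.length +
      2 * ((homBound R + 10) * (p.length + z.length)) + 20 * p.length + 20 * z.length + 60 := by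
      ring
    have e2 : (homBound R + 7) * z.length ≤ (homBound R + 10) * (p.length + z.length) :=
      Nat.mul_le_mul (by omega) (by omega)
    rw [e1]
    omega

end Base

end Miller

/-! ### The case without letters q -/

namespace Miller

section BaseCase

variable {n m : ℕ} (R : Fin m → FreeGroup (Fin n))

open Prog

/-- If the word on `W` is conjugate to `twist u`, replace it by `twist u`. -/
noncomputable def conjTest (ε : Bool) : Pg n m :=
  seq (mulHom Stk.W Stk.T Stk.Z (homBound R) fun _ => MonoidHom.id _)
  (seq cycReduce
  (seq (mv Stk.Z Stk.P)
  (seq (mulHom Stk.U Stk.X Stk.Z (homBound R) fun _ => twistG R ε)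
  (seq cycReduce
  (seq (rotTest R)
    (ite (fun v => v.flag)
      (seq (clear Stk.W) (mulHom Stk.U Stk.X Stk.W (homBound R) fun _ => twistG R ε))
      (set id)))))))

lemma run_conjTest (ε : Bool) (u : FreeGroup (Fin m ⊕ Fin n)) (s : FreeGroup (Fin n)) :
    ∃ b, (b = true ↔ IsConj s (twist R ε u)) ∧
    Run (conjTest R ε) ({},
        ({ U := NormalForm.wordTD u, W := NormalForm.wordS s } : Tapes n m).get)
      ({ flag := b }, ({ U := NormalForm.wordTD u
                         W := NormalForm.wordS (if b then twist R ε u else s) } : Tapes n m).get)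
      ((homBound R * u.norm + 10) * passTime R u.norm (NormalForm.wordS s : Word n m).length) := by
  set L := (NormalForm.wordS s : Word n m).length with hL
  set p := FreeGroup.reduceCyclically (NormalForm.wordS s : Word n m) with hp
  set z := FreeGroup.reduceCyclically (NormalForm.wordS (twist R ε u) : Word n m) with hz
  have hzl : (NormalForm.wordS (twist R ε u) : Word n m).length ≤ homBound R * u.norm := by
    rw [length_wordS]; exact norm_embS_twist_le R ε u
  have hz' : z.length ≤ homBound R * u.norm := (length_reduceCyclically_le _).trans hzl
  have hp' : p.length ≤ L := length_reduceCyclically_le _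
  have r1 := run_mulHom (k := Stk.W) (x := Stk.T) (z := Stk.Z) (N := homBound R)
    (v := {}) (S := ({ U := NormalForm.wordTD u, W := NormalForm.wordS s } :
      Tapes n m).get) (w := 1) (ψ := fun _ => MonoidHom.id _)
    (by decide) (by decide) (by decide) (fun _ => rfl) (letterBound_id_le R)
    FreeGroup.toWord_one.symm rfl
  have r2 := run_cycReduce false (NormalForm.wordTD u) (NormalForm.wordS s) [] _
    (isReduced_wordS (m := m) s)
  have r3 := run_mv (show Stk.Z ≠ Stk.P by decide) {}
    ({ U := NormalForm.wordTD u, W := NormalForm.wordS s, Z := p } : Tapes n m).get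
  have r4 := run_mulHom (k := Stk.U) (x := Stk.X) (z := Stk.Z) (N := homBound R)
    (v := {}) (S := ({ U := NormalForm.wordTD u, W := NormalForm.wordS s, P := p.reverse } :
      Tapes n m).get) (w := 1) (ψ := fun _ => twistG R ε)
    (by decide) (by decide) (by decide) (fun _ => rfl) (letterBound_twistG_le R ε)
    FreeGroup.toWord_one.symm rfl
  have r5 := run_cycReduce false (NormalForm.wordTD u) (NormalForm.wordS s) p.reverse _
    (isReduced_wordS (m := m) (twist R ε u))
  obtain ⟨b, hb, r6⟩ := run_rotTest R (NormalForm.wordTD u) (NormalForm.wordS s) p z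
    (FreeGroup.reduceCyclically.isCyclicallyReduced (isReduced_wordS _)).1
  simp only [Tapes.get_W, Tapes.get_U, Tapes.get_Z, Tapes.get_P, Tapes.update_Z, Tapes.update_P,
    MonoidHom.id_apply, mk_wordS, mk_wordTD, mul_one, toWord_embS, twistG_embTD,
    List.append_nil, length_wordTD, ← hp, ← hz, ← hL] at r1 r2 r3 r4 r5
  have a1 := le_passTime R (show L ≤ L + u.norm + homBound R * u.norm by omega)
  have a2 := le_passTime R (show u.norm ≤ L + u.norm + homBound R * u.norm by omega)
  have a3 := le_passTime R (show homBound R * u.norm ≤ L + u.norm + homBound R * u.norm by omega)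
  have a4 := le_passTime R (show p.length + z.length ≤ L + u.norm + homBound R * u.norm by omega)
  -- The rotated word comes from `twist R ε u`, so the number of comparisons is linear in `u.norm`,
  -- however long `s` is.
  have a5 : (z.length + 2) * ((homBound R + 20) * (p.length + z.length) + 30) ≤
      (homBound R * u.norm + 2) * passTime R u.norm L := by
    refine Nat.mul_le_mul (by omega) ?_
    rw [Nat.add_mul]
    omega
  have e1 : (homBound R * u.norm + 10) * passTime R u.norm L =
    (homBound R * u.norm + 2) * passTime R u.norm L + 8 * passTime R u.norm L := by ring
  refine ⟨b, ?_, (Run.seq r1 (Run.seq r2 (Run.seq r3 (Run.seq r4 (Run.seq r5 (Run.seq r6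
    (?_ : Run _ _ _ (2 * passTime R u.norm L)))))))).mono ?_⟩
  · rw [hb, ← isConj_embS_iff (m := m), isConj_iff_rotate, toWord_embS, toWord_embS]
  · cases b with
    | false =>
      refine (Run.iteFalse rfl (run_set _ _ _)).congr rfl ?_ (by omega)
      rfl
    | true =>
      have r7 := run_clear Stk.W ({ flag := true } : St n m)
        ({ U := NormalForm.wordTD u, W := NormalForm.wordS s } : Tapes n m).get
      have r8 := run_mulHom (k := Stk.U) (x := Stk.X) (z := Stk.W) (N := homBound R)
        (v := { flag := true }) (S := ({ U := NormalForm.wordTD u } :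
          Tapes n m).get) (w := 1) (ψ := fun _ => twistG R ε)
        (by decide) (by decide) (by decide) (fun _ => rfl) (letterBound_twistG_le R ε)
        FreeGroup.toWord_one.symm rfl
      simp only [Tapes.get_W, Tapes.get_U, Tapes.update_W, mk_wordTD, mul_one, toWord_embS,
        twistG_embTD, length_wordTD, ← hL] at r7 r8
      refine (Run.iteTrue rfl (Run.seq r7 r8)).congr rfl ?_ ?_
      · simp
      · rw [Nat.add_mul]; omega
  · rw [e1]
    simp only [Nat.add_mul (homBound R) 7] at *
    omega

/-- The base case of Algorithm III for an element of `K`. -/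
noncomputable def baseTest : Pg n m :=
  seq (set fun _ => {}) (seq (eqTest R false) (seq (eqTest R true) (ite (fun v => v.flag)
    (set fun _ => {})
    (seq (conjTest R false) (ite (fun v => v.flag) (set fun _ => {})
      (seq (conjTest R true) (set fun _ => {})))))))

lemma exists_run_baseTest (v : St n m) (x : NormalForm n m) (hx : x.tail = []) :
    ∃ y : NormalForm n m, AlgorithmIII R x y ∧ y.u = x.u ∧ y.tail = [] ∧
    (NormalForm.wordS y.s₀ : Word n m).length ≤
      (NormalForm.wordS x.s₀ : Word n m).length + homBound R * x.u.norm ∧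
    Run (baseTest R) (v,
        ({ U := NormalForm.wordTD x.u, W := NormalForm.wordS x.s₀ } : Tapes n m).get)
      ({}, ({ U := NormalForm.wordTD y.u, W := NormalForm.wordS y.s₀ } : Tapes n m).get)
      ((2 * (homBound R * x.u.norm) + 27) *
        passTime R x.u.norm (NormalForm.wordS x.s₀ : Word n m).length) := by
  obtain ⟨u, s, tail, h⟩ := x
  dsimp only at hx ⊢
  subst hx
  have hM : 40 ≤ passTime R u.norm (NormalForm.wordS s : Word n m).length := by
    have := le_passTime R (show 0 ≤ (NormalForm.wordS s : Word n m).length + u.norm +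
      homBound R * u.norm by omega)
    omega
  have e1 : ∀ k, (2 * (homBound R * u.norm) + 27) * k =
    2 * ((homBound R * u.norm + 10) * k) + 7 * k := fun k => by ring
  rw [e1]
  have htw : ∀ ε, (NormalForm.wordS (twist R ε u) : Word n m).length ≤ homBound R * u.norm :=
    fun ε => by rw [length_wordS]; exact norm_embS_twist_le R ε u
  have r1 := run_eqTest R false false u s
  have r2 := run_eqTest R true (false || decide (s = twist R false u)) u s
  -- Equality with a twist must be excluded before conjugacy is tested: on an element of `A ∪ B` the
  -- algorithm returns the element itself.
  by_cases heq : ∃ ε, s = twist R ε u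
  · obtain ⟨ε, hε⟩ := heq
    have hb : (false || decide (s = twist R false u) || decide (s = twist R true u)) = true := by
      cases ε
      · rw [decide_eq_true hε]; rfl
      · rw [decide_eq_true hε]; simp
    rw [hb] at r2
    refine ⟨⟨u, s, [], h⟩, algorithmIII_base_mem R rfl hε, rfl, rfl, Nat.le_add_right _ _, ?_⟩
    refine (Run.seq (run_set _ _ _) (Run.seq r1 (Run.seq r2 (Run.iteTrue rfl
      (run_set _ _ _))))).mono ?_
    omega
  · have hne : ∀ ε, s ≠ twist R ε u := fun ε e => heq ⟨ε, e⟩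
    have hb : (false || decide (s = twist R false u) || decide (s = twist R true u)) = false := by
      rw [decide_eq_false (hne _), decide_eq_false (hne _)]; rfl
    rw [hb] at r2
    obtain ⟨b, hb, r3⟩ := run_conjTest R false u s
    cases b with
    | true =>
      refine ⟨⟨u, twist R false u, [], List.isChain_nil⟩,
        algorithmIII_base_conj R rfl hne (hb.mp rfl), rfl, rfl, (htw _).trans (Nat.le_add_left _ _),
        ?_⟩
      refine (Run.seq (run_set _ _ _) (Run.seq r1 (Run.seq r2 (Run.iteFalse rfl (Run.seq r3
        (Run.iteTrue rfl (run_set _ _ _))))))).mono ?_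
      omega
    | false =>
      have r3' : Run (conjTest R false) ({},
          ({ U := NormalForm.wordTD u, W := NormalForm.wordS s } : Tapes n m).get)
        ({}, ({ U := NormalForm.wordTD u, W := NormalForm.wordS s } : Tapes n m).get)
        ((homBound R * u.norm + 10) * passTime R u.norm (NormalForm.wordS s : Word n m).length) := r3
      obtain ⟨b, hb', r4⟩ := run_conjTest R true u s
      refine ⟨⟨u, if b then twist R true u else s, [], List.isChain_nil⟩, ?_, rfl, rfl, ?_, ?_⟩
      · cases b with
        | true => exact algorithmIII_base_conj R rfl hne (hb'.mp rfl)
        | false =>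
          refine algorithmIII_base_not_conj R rfl fun ε hε => ?_
          cases ε
          · exact Bool.false_ne_true (hb.mpr hε)
          · exact Bool.false_ne_true (hb'.mpr hε)
      · cases b with
        | true => exact (htw _).trans (Nat.le_add_left _ _)
        | false => exact Nat.le_add_right _ _
      · refine (Run.seq (run_set _ _ _) (Run.seq r1 (Run.seq r2 (Run.iteFalse rfl (Run.seq r3'
          (Run.iteFalse rfl (Run.seq r4 (run_set _ _ _)))))))).mono ?_
        omega

/-- Treat the base case if there is no letter `q^{±1}` on `W`. -/
noncomputable def baseCase : Pg n m :=
  seq (spanPop Stk.W Stk.P) (seq (set fun v => { fst := v.reg, flag := v.reg.isNone })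
    (seq (push Stk.W fun v => v.fst.toList) (seq (mv Stk.P Stk.W)
      (ite (fun v => v.flag) (baseTest R) (set fun _ => {})))))

/-- The presence of a letter q is detected by popping up to the first one, which is then put back.
The product of |u| with the length is charged only if there is none, the only case in which the word
is known to be short enough for it. -/
lemma exists_run_baseCase (x : NormalForm n m) :
    ∃ y : NormalForm n m, (x.tail ≠ [] → y = x) ∧ (x.tail = [] → AlgorithmIII R x y) ∧
    y.u = x.u ∧ (sylWord y.s₀ y.tail : Word n m).length ≤
      (sylWord x.s₀ x.tail : Word n m).length + homBound R * x.u.norm ∧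
    Run (baseCase R) ({},
        ({ U := NormalForm.wordTD x.u, W := sylWord x.s₀ x.tail } : Tapes n m).get)
      ({}, ({ U := NormalForm.wordTD y.u, W := sylWord y.s₀ y.tail } : Tapes n m).get)
      (6 * (sylWord x.s₀ x.tail : Word n m).length + 8 +
        if x.tail = [] then (2 * (homBound R * x.u.norm) + 27) *
          passTime R x.u.norm (sylWord x.s₀ x.tail : Word n m).length else 0) := by
  have key : ∀ (f : Option (Letter n m)) (V : Word n m), (∀ x ∈ f, isQ x = true) →
      (f = none → V = []) →
      (sylWord x.s₀ x.tail : Word n m) = NormalForm.wordS x.s₀ ++ (f.toList ++ V) →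
      ∀ (c : St n m × Stacks n m) (t : ℕ),
      Run (ite (fun v => v.flag) (baseTest R) (set fun _ => {})) ({ fst := f, flag := f.isNone },
        ({ U := NormalForm.wordTD x.u, W := sylWord x.s₀ x.tail } : Tapes n m).get) c (t + 1) →
      Run (baseCase R) ({},
        ({ U := NormalForm.wordTD x.u, W := sylWord x.s₀ x.tail } : Tapes n m).get) c
        (6 * (sylWord x.s₀ x.tail : Word n m).length + 7 + t) := by
    intro f V hf hf' h c t r
    have a : (∀ x ∈ (f.toList ++ V).head?, isQ x = true) ∧
        (f.toList ++ V).head? = f ∧ (f.toList ++ V).tail = V := by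
      rcases f with _ | y
      · simp [hf' rfl]
      · simpa using hf
    obtain ⟨c1, c2⟩ := takeWhile_wordS_append x.s₀ a.1
    have r1 := run_spanPop (show Stk.W ≠ Stk.P by decide) {}
      ({ U := NormalForm.wordTD x.u, W := sylWord x.s₀ x.tail } : Tapes n m).get
    simp only [Tapes.get_W, Tapes.get_P, Tapes.update_W, Tapes.update_P, List.append_nil] at r1
    rw [h, c1, c2, a.2.1, a.2.2, ← h] at r1
    have r2 := run_push Stk.W (fun v => v.fst.toList) { fst := f, flag := f.isNone }
      ({ U := NormalForm.wordTD x.u, W := V, P := (NormalForm.wordS x.s₀).reverse } :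
        Tapes n m).get
    have r3 := run_mv (show Stk.P ≠ Stk.W by decide) { fst := f, flag := f.isNone }
      ({ U := NormalForm.wordTD x.u, W := f.toList ++ V
         P := (NormalForm.wordS x.s₀).reverse } : Tapes n m).get
    simp only [Tapes.get_W, Tapes.get_P, Tapes.update_W, Tapes.update_P, List.reverse_reverse,
      List.length_reverse, ← h] at r2 r3
    refine (Run.seq r1 (Run.seq (run_set _ _ _) (Run.seq r2 (Run.seq r3 r)))).mono ?_
    have := congrArg List.length h
    simp only [List.length_append] at this
    omega
  obtain ⟨u, s, tail, hx⟩ := x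
  rcases tail with _ | ⟨p, t⟩
  · obtain ⟨y, h1, h2, h3, h4, r⟩ := exists_run_baseTest R { fst := none, flag := true }
      ⟨u, s, [], hx⟩ rfl
    refine ⟨y, fun h => absurd rfl h, fun _ => h1, h2, ?_, ?_⟩
    · rw [h3, sylWord_nil, sylWord_nil]; exact h4
    · rw [if_pos rfl, h3, sylWord_nil, sylWord_nil]
      simp only [sylWord_nil] at key
      exact (key none [] (by simp) (fun _ => rfl) (by simp) _ _ (Run.iteTrue rfl r)).mono
        (by dsimp only; omega)
  · refine ⟨⟨u, s, p :: t, hx⟩, fun _ => rfl, fun h => by simp at h, rfl, Nat.le_add_right _ _, ?_⟩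
    exact (key (some (Gen.q, p.1)) (sylWord p.2 t) (by simp [isQ]) (by simp)
      (by simp [sylWord_cons_eq]) _ 1 (Run.iteFalse rfl (run_set _ _ _))).mono (by simp)

end BaseCase

end Miller

/-! ### The two machines and their cubic time bounds -/

namespace Miller

section Machines

variable {n m : ℕ} (R : Fin m → FreeGroup (Fin n))

open Prog

/-- Write the normal form on `U` and `W` as one word on `W`. -/
def output : Pg n m := seq (mv Stk.U Stk.X) (mv Stk.X Stk.W)

lemma run_output (x : NormalForm n m) :
    Run output ({}, ({ U := NormalForm.wordTD x.u, W := sylWord x.s₀ x.tail } : Tapes n m).get)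
      ({}, ({ W := x.toWord } : Tapes n m).get) (6 * x.u.norm + 4) := by
  have r1 := run_mv (show Stk.U ≠ Stk.X by decide) {}
    ({ U := NormalForm.wordTD x.u, W := sylWord x.s₀ x.tail } : Tapes n m).get
  have r2 := run_mv (show Stk.X ≠ Stk.W by decide) {}
    ({ X := (NormalForm.wordTD x.u).reverse, W := sylWord x.s₀ x.tail } : Tapes n m).get
  simp only [Tapes.get_U, Tapes.get_X, Tapes.get_W, Tapes.update_U, Tapes.update_X, Tapes.update_W,
    List.append_nil, List.reverse_reverse, List.length_reverse, length_wordTD, ← toWord_eq] at r1 r2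
  exact (Run.seq r1 r2).mono (by omega)

/-- The time for bringing a word of length `a` with `b` letters `q^{±1}` into normal form. -/
noncomputable def normTime (a b : ℕ) : ℕ := b * (2 * (homBound R + 7) * a + 15) + 9 * a + 4

lemma exists_run_normalForm (l : Word n m) : ∃ x : NormalForm n m, x.elt R = val R l ∧
    x.u.norm ≤ l.length ∧ x.tail.length ≤ l.countP isQ ∧
    (sylWord x.s₀ x.tail : Word n m).length ≤
      l.length + l.countP isQ * (2 * homBound R * l.length) ∧
    Run (normalize R) ({}, ({ I := l } : Tapes n m).get)
      ({}, ({ U := NormalForm.wordTD x.u, W := sylWord x.s₀ x.tail } : Tapes n m).get)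
      (normTime R l.length (l.countP isQ)) := by
  obtain ⟨u, s, tail, ht, h1, h2, h3, h4, r⟩ := exists_run_normalize R l
  exact ⟨⟨u, s, tail, ht⟩, by rw [elt_eq, ← h1, mul_assoc], h2, h3, h4, r⟩

lemma cubic_le (a b c d : ℕ) {k : ℕ} (hk : 1 ≤ k) :
    a * k ^ 3 + b * k ^ 2 + c * k + d ≤ (a + b + c + d) * k ^ 3 := by
  have h1 : k ^ 2 ≤ k ^ 3 := Nat.pow_le_pow_right hk (by omega)
  have h2 : k ≤ k ^ 3 := by simpa using Nat.pow_le_pow_right hk (show 1 ≤ 3 by omega)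
  have h3 : 1 ≤ k ^ 3 := hk.trans h2
  have e1 := Nat.mul_le_mul_left b h1
  have e2 := Nat.mul_le_mul_left c h2
  have e3 := Nat.mul_le_mul_left d h3
  simp only [Nat.add_mul]
  omega

theorem computableInCubicTime_of_run (p : Pg n m) (f : Word n m → Word n m) (c : ℕ)
    (h : ∀ w, Run p ({}, ({ I := w } : Tapes n m).get) ({}, ({ W := f w } : Tapes n m).get)
      (c * (w.length + 1) ^ 3)) : ComputableInCubicTime f := by
  obtain ⟨M, hM⟩ := exists_computableInTime p {} Stk.I Stk.W f (fun k => c * (k + 1) ^ 3) (by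
    intro w
    have := h w
    rw [Tapes.get_empty, Tapes.update_I, Tapes.update_W]
    exact this)
  refine ⟨M, c + 1, fun k => ?_⟩
  have : 1 ≤ (k + 1) ^ 3 := Nat.one_le_pow _ _ (Nat.succ_pos k)
  rw [hM]
  change c * (k + 1) ^ 3 + 1 ≤ _
  rw [Nat.add_mul]
  omega

/-- The first machine: normal forms. -/
noncomputable def nfProgram : Pg n m := seq (normalize R) output

lemma normTime_le {a b k : ℕ} (ha : a ≤ k) (hb : b ≤ k) (hk : 1 ≤ k) :
    normTime R a b ≤ (2 * (homBound R + 7) + 28) * k ^ 3 := by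
  have h1 : normTime R a b ≤ normTime R k k := by unfold normTime; gcongr
  have h2 := cubic_le 0 (2 * (homBound R + 7)) 24 4 hk
  have e : normTime R k k = 0 * k ^ 3 + 2 * (homBound R + 7) * k ^ 2 + 24 * k + 4 := by
    unfold normTime; ring
  rw [e] at h1
  refine h1.trans (h2.trans (Nat.mul_le_mul_right _ (by omega)))

lemma exists_run_nfProgram (w : Word n m) : ∃ x : NormalForm n m, x.elt R = val R w ∧
    Run (nfProgram R) ({}, ({ I := w } : Tapes n m).get) ({}, ({ W := x.toWord } : Tapes n m).get)
      ((2 * (homBound R + 7) + 38) * (w.length + 1) ^ 3) := by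
  obtain ⟨x, h1, h2, h3, h4, r⟩ := exists_run_normalForm R w
  refine ⟨x, h1, (Run.seq r (run_output x)).mono ?_⟩
  have h5 := normTime_le R (Nat.le_succ w.length)
    ((List.countP_le_length (p := isQ) (l := w)).trans (Nat.le_succ _)) (Nat.succ_pos _)
  have h6 := cubic_le 0 0 6 4 (Nat.succ_pos w.length)
  simp only [Nat.add_mul, Nat.succ_eq_add_one] at *
  omega

/-- The second machine: Algorithm III. -/
noncomputable def crProgram : Pg n m :=
  seq (normalize R) (seq (iterLoop R) (seq (buildWord R) (seq (normalize R)
    (seq (baseCase R) output))))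

/-- The constant in the bound for the time of the second machine. -/
noncomputable def crConst : ℕ :=
  (2 * (homBound R + 7) + 28) +
  ((homBound R + 25) * (2 * homBound R + 1) + (8 * homBound R + 14) + 46) +
  (2 * (homBound R + 7) + (homBound R + 10) * (2 * homBound R + 1) + 32) +
  (2 * (homBound R + 7) * (4 * homBound R + 1) + 9 * (4 * homBound R + 1) + 19) +
  (6 * ((4 * homBound R + 1) * (2 * homBound R + 1)) + 8 +
    (2 * homBound R + 27) * ((homBound R + 40) * (5 * homBound R + 3))) + 10

/-- With `k = |w| + 1`, the first normal form has length O(k²) and at most `k` letters q, so all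
rounds together cost O(k³). The word written out has again length O(k²) and at most `k` letters q;
its normalization takes time O(k³) and gives a word of length O(k³), on which only linear passes
follow unless the tail is empty. -/
lemma exists_run_crProgram (w : Word n m) : ∃ x y : NormalForm n m, x.elt R = val R w ∧
    AlgorithmIII R x y ∧
    Run (crProgram R) ({}, ({ I := w } : Tapes n m).get) ({}, ({ W := y.toWord } : Tapes n m).get)
      (crConst R * (w.length + 1) ^ 3) := by
  obtain ⟨x, h1, h2, h3, h4, r1⟩ := exists_run_normalForm R w
  obtain ⟨β, C, s, tail, ht, r2, a1, a2, a3, a4, a5⟩ := exists_run_iterLoop R x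
  obtain ⟨l, b1, b2, b3, r3⟩ := exists_run_buildWord R β x.u C s tail ht
  obtain ⟨x', c1, -, -, c4, r4⟩ := exists_run_normalForm R l
  -- By uniqueness, normalizing the word written out yields exactly the form that the iteration has
  -- represented implicitly.
  have hx' := elt_injective R (c1.trans b1)
  subst hx'
  obtain ⟨y, d1, d2, d3, d4, r5⟩ := exists_run_baseCase R (loopForm R β C.length x.u s tail ht)
  have htail : (loopForm R β C.length x.u s tail ht).tail.length = tail.length :=
    moveTail_length R _ _ _
  have hu : (loopForm R β C.length x.u s tail ht).u = x.u := rfl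
  refine ⟨x, y, h1, ?_, (Run.seq r1 (Run.seq r2 (Run.seq r3 (Run.seq r4 (Run.seq r5
    (run_output y)))))).mono ?_⟩
  -- If syllables remain, the form at the end of the loop is already a result and the base case
  -- leaves it alone; otherwise the base case supplies the result.
  · by_cases h : tail = []
    · refine a2 y (d2 (List.length_eq_zero_iff.mp ?_))
      rw [htail, h]; rfl
    · rw [d1 (fun e => h (List.length_eq_zero_iff.mp (by rw [← htail, e]; rfl)))]
      exact a1 h
  · rw [d3, hu] at *
    set N := homBound R with hN
    set k := w.length + 1 with hk
    set x₂ := loopForm R β C.length x.u s tail ht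
    have k1 : 1 ≤ k := Nat.succ_pos _
    have hcw : w.countP isQ ≤ w.length := List.countP_le_length
    have hW : (sylWord x.s₀ x.tail : Word n m).length ≤ (2 * N + 1) * k ^ 2 := by
      have : w.countP isQ * (2 * N * w.length) ≤ k * (2 * N * k) := by gcongr <;> omega
      have h5 : k ≤ k ^ 2 := by simpa using Nat.pow_le_pow_right k1 (show 1 ≤ 2 by omega)
      have e : (2 * N + 1) * k ^ 2 = k * (2 * N * k) + k ^ 2 := by ring
      omega
    have hW' := a5.trans hW
    have hl : l.length ≤ (4 * N + 1) * k ^ 2 := by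
      have : (2 * C.length + 2) * N * x.u.norm ≤ (2 * k) * N * k := by gcongr <;> omega
      have e : (4 * N + 1) * k ^ 2 = (2 * k) * N * k + (2 * N + 1) * k ^ 2 := by ring
      omega
    have hlq : l.countP isQ ≤ k := by omega
    have hW2 : (sylWord x₂.s₀ x₂.tail : Word n m).length ≤ (4 * N + 1) * (2 * N + 1) * k ^ 3 := by
      have : l.length + l.countP isQ * (2 * N * l.length) ≤
          (4 * N + 1) * k ^ 2 + k * (2 * N * ((4 * N + 1) * k ^ 2)) := by gcongr
      have h6 := Nat.mul_le_mul_left (4 * N + 1)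
        (Nat.pow_le_pow_right k1 (show 2 ≤ 3 by omega))
      have e : (4 * N + 1) * (2 * N + 1) * k ^ 3 =
        (4 * N + 1) * k ^ 3 + k * (2 * N * ((4 * N + 1) * k ^ 2)) := by ring
      omega
    have t1 := normTime_le R (show w.length ≤ k by omega) (show w.countP isQ ≤ k by omega) k1
    have t2 : (x.tail.length + 1) *
        (roundTime R x.u.norm (sylWord x.s₀ x.tail : Word n m).length + 1) + 2 ≤
        ((N + 25) * (2 * N + 1) + (8 * N + 14) + 46) * k ^ 3 := by
      have h5 : (x.tail.length + 1) *
          (roundTime R x.u.norm (sylWord x.s₀ x.tail : Word n m).length + 1) + 2 ≤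
          k * (roundTime R k ((2 * N + 1) * k ^ 2) + 1) + 2 := by
        unfold roundTime
        gcongr <;> omega
      have h6 := cubic_le ((N + 25) * (2 * N + 1)) (8 * N + 14) 44 2 k1
      have e : k * (roundTime R k ((2 * N + 1) * k ^ 2) + 1) + 2 =
        (N + 25) * (2 * N + 1) * k ^ 3 + (8 * N + 14) * k ^ 2 + 44 * k + 2 := by
        unfold roundTime; rw [← hN]; ring
      rw [e] at h5
      exact h5.trans h6
    have t3 : (2 * C.length + 2) * ((N + 7) * x.u.norm + 7) +
        (N + 10) * (sylWord s tail : Word n m).length + 3 * x.u.norm + 15 ≤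
        (2 * (N + 7) + (N + 10) * (2 * N + 1) + 32) * k ^ 3 := by
      have h5 : (2 * C.length + 2) * ((N + 7) * x.u.norm + 7) +
          (N + 10) * (sylWord s tail : Word n m).length + 3 * x.u.norm + 15 ≤
          (2 * k) * ((N + 7) * k + 7) + (N + 10) * ((2 * N + 1) * k ^ 2) + 3 * k + 15 := by
        gcongr <;> omega
      have h6 := cubic_le 0 (2 * (N + 7) + (N + 10) * (2 * N + 1)) 17 15 k1
      have e : (2 * k) * ((N + 7) * k + 7) + (N + 10) * ((2 * N + 1) * k ^ 2) + 3 * k + 15 =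
        0 * k ^ 3 + (2 * (N + 7) + (N + 10) * (2 * N + 1)) * k ^ 2 + 17 * k + 15 := by ring
      rw [e] at h5
      exact h5.trans (h6.trans (Nat.mul_le_mul_right _ (by omega)))
    have t4 : normTime R l.length (l.countP isQ) ≤
        (2 * (N + 7) * (4 * N + 1) + 9 * (4 * N + 1) + 19) * k ^ 3 := by
      have h5 : normTime R l.length (l.countP isQ) ≤ normTime R ((4 * N + 1) * k ^ 2) k := by
        unfold normTime; gcongr
      have h6 := cubic_le (2 * (N + 7) * (4 * N + 1)) (9 * (4 * N + 1)) 15 4 k1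
      have e : normTime R ((4 * N + 1) * k ^ 2) k = 2 * (N + 7) * (4 * N + 1) * k ^ 3 +
        9 * (4 * N + 1) * k ^ 2 + 15 * k + 4 := by unfold normTime; rw [← hN]; ring
      rw [e] at h5
      exact h5.trans h6
    have t5 : 6 * (sylWord x₂.s₀ x₂.tail : Word n m).length + 8 +
        (if x₂.tail = [] then (2 * (N * x.u.norm) + 27) *
          passTime R x.u.norm (sylWord x₂.s₀ x₂.tail : Word n m).length else 0) ≤
        (6 * ((4 * N + 1) * (2 * N + 1)) + 8 + (2 * N + 27) * ((N + 40) * (5 * N + 3))) *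
          k ^ 3 := by
      have h5 : (if x₂.tail = [] then (2 * (N * x.u.norm) + 27) *
          passTime R x.u.norm (sylWord x₂.s₀ x₂.tail : Word n m).length else 0) ≤
          (2 * N + 27) * ((N + 40) * (5 * N + 3)) * k ^ 3 := by
        split_ifs with h
        -- Without syllables the word written out has no letter q, so its normalization inserts no
        -- twists and the length stays quadratic. The general cubic bound, multiplied by |u|, would
        -- be quartic.
        · have h0 : l.countP isQ = 0 := by
            have : tail.length = 0 := by rw [← htail, h]; rfl
            omega
          rw [h0, Nat.zero_mul, Nat.add_zero] at c4
          have hu' : x.u.norm ≤ k := by omega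
          have h7 : k ≤ k ^ 2 := by simpa using Nat.pow_le_pow_right k1 (show 1 ≤ 2 by omega)
          have h8 : passTime R x.u.norm (sylWord x₂.s₀ x₂.tail : Word n m).length ≤
              (N + 40) * ((4 * N + 1) * k ^ 2 + k ^ 2 + N * k ^ 2 + k ^ 2) := by
            unfold passTime
            have := c4.trans hl
            gcongr <;> omega
          have h9 : 2 * (N * x.u.norm) + 27 ≤ 2 * (N * k) + 27 * k := by gcongr; omega
          refine (Nat.mul_le_mul h9 h8).trans (le_of_eq ?_)
          ring
        · exact Nat.zero_le _
      have h6 : 1 ≤ k ^ 3 := Nat.one_le_pow _ _ k1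
      have e : (6 * ((4 * N + 1) * (2 * N + 1)) + 8 +
          (2 * N + 27) * ((N + 40) * (5 * N + 3))) * k ^ 3 =
        6 * ((4 * N + 1) * (2 * N + 1) * k ^ 3) + 8 * k ^ 3 +
          (2 * N + 27) * ((N + 40) * (5 * N + 3)) * k ^ 3 := by ring
      rw [e]
      omega
    have t6 := cubic_le 0 0 6 4 k1
    have t6' : 6 * x.u.norm + 4 ≤ 10 * k ^ 3 := by omega
    refine (Nat.add_le_add t1 (Nat.add_le_add t2 (Nat.add_le_add t3 (Nat.add_le_add t4
      (Nat.add_le_add t5 t6'))))).trans (le_of_eq ?_)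
    unfold crConst
    rw [← hN]
    ring

end Machines

end Miller

/-! ### The theorem -/

theorem mainTheorem7 (n m : ℕ) (R : Fin m → FreeGroup (Fin n)) :
    (∃ nf : Miller.Word n m → Miller.NormalForm n m,
      (∀ w, (nf w).elt R = Miller.val R w ∧
        ∀ x : Miller.NormalForm n m, x.elt R = Miller.val R w → x = nf w) ∧
      Miller.ComputableInCubicTime fun w => (nf w).toWord) ∧
    (∃ cr : Miller.Word n m → Miller.NormalForm n m,
      (∀ w,
        (∃ x : Miller.NormalForm n m, x.elt R = Miller.val R w ∧
          Miller.AlgorithmIII R x (cr w)) ∧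
        Miller.IsCyclicallyReduced R ((cr w).elt R) ∧
        IsConj (Miller.val R w) ((cr w).elt R)) ∧
      Miller.ComputableInCubicTime fun w => (cr w).toWord) := by
  constructor
  · choose nf h r using Miller.exists_run_nfProgram R
    exact ⟨nf, fun w => ⟨h w, fun x hx => Miller.elt_injective R (hx.trans (h w).symm)⟩,
      Miller.computableInCubicTime_of_run _ _ _ r⟩
  · choose x cr h h' r using Miller.exists_run_crProgram R
    refine ⟨cr, fun w => ⟨⟨x w, h w, h' w⟩, Miller.AlgorithmIII.isCyclicallyReduced R (h' w), ?_⟩,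
      Miller.computableInCubicTime_of_run _ _ _ r⟩
    rw [← h w]
    exact Miller.AlgorithmIII.isConj R (h' w)
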